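/- **Setting.** Let $d\ge 2$. The binary and ternary cross-sections are $$B_2(u,\omega)=|u|^{\gamma_2}\,b_2(\hat u\cdot\omega)\ \ (u\in\mathbb R^d,\ \omega\in\mathbb S^{d-1}),\qquad B_3(\boldsymbol u,\boldsymbol\omega)=|\tilde{\boldsymbol u}|^{\gamma_3}\,b_3(\bar{\boldsymbol u}\cdot\boldsymbol\omega,\ \omega_1\cdot\omega_2)\ \ (\boldsymbol u\in\mathbb R^{2d},\ \boldsymbol\omega=(\omega_1,\omega_2)\in\mathbb S^{2d-1}),$$ where $\hat u=u/|u|$, $|\tilde{\boldsymbol u}|^2=|a|^2+|b|^2+|a-b|^2$ and $\bar{\boldsymbol u}=\boldsymbol u/|\tilde{\boldsymbol u}|$ for $\boldsymbol u=(a,b)$, $\gamma_2\in(-d+1,1]$ and $\gamma_3\in(-2d+1,1]$. The functions $b_2:[-1,1]\to[0,\infty)$ and $b_3:[-1,1]\times[-\frac12,\frac12]\to[0,\infty)$ are measurable and even in the first argument, with $$\|b_2\|=\int_{\mathbb S^{d-1}}b_2(\nu\cdot\omega)\,d\omega<\infty\ \ (|\nu|=1),\qquad \|b_3\|=\sup_{|\nu_1|^2+|\nu_2|^2+|\nu_1-\nu_2|^2=1}\int_{\mathbb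 S^{2d-1}}b_3(\boldsymbol\nu\cdot\boldsymbol\omega,\omega_1\cdot\omega_2)\,d\boldsymbol\omega<\infty ,$$ and $\|b_2\|,\|b_3\|$ are not both $0$. Put $u=v_1-v$, $\boldsymbol u=(v_1-v,v_2-v)$, $$v'=v+(\omega\cdot u)\omega,\quad v_1'=v_1-(\omega\cdot u)\omega,\quad c=\frac{\omega_1\cdot(v_1-v)+\omega_2\cdot(v_2-v)}{1+\omega_1\cdot\omega_2},$$ $$v^*=v+c(\omega_1+\omega_2),\quad v_1^*=v_1-c\,\omega_1,\quad v_2^*=v_2-c\,\omega_2 .$$ For non-negative functions $f,g,h$ of $(t,x,v)$ the gain and loss operators are (at $(t,x)$, which is not written in the integrands) $$G(f,g,h)(v)=\int_{\mathbb S^{d-1}\times\mathbb R^d}B_2(u,\omega)\,f(v')g(v_1')\,d\omega\,dv_1+\int_{\mathbb S^{2d-1}\times\mathbb R^{2d}}B_3(\boldsymbol u,\boldsymbol\omega)\,f(v^*)g(v_1^*)h(v_2^*)\,d\boldsymbol\omega\,dv_1dv_2,$$ $$L(f,g,h)(v)=\int_{\mathbb S^{d-1}\times\mathbb R^d}B_2(u,\omega)\,f(v)g(v_1)\,d\omega\,dv_1+\int_{\mathbb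 S^{2d-1}\times\mathbb R^{2d}}B_3(\boldsymbol u,\boldsymbol\omega)\,f(v)g(v_1)h(v_2)\,d\boldsymbol\omega\,dv_1dv_2 .$$ Write $f^\#(t,x,v)=f(t,x+tv,v)$, and likewise $G^\#=(G)^\#$, $L^\#=(L)^\#$. Let $L^{1,+}_{x,v}$ be the set of non-negative integrable functions on $\mathbb R^d\times\mathbb R^d$. For $\alpha,\beta>0$ let $M_{\alpha,\beta}(x,v)=e^{-\alpha|x|^2-\beta|v|^2}$ and $\|f\|_{\mathcal M_{\alpha,\beta}}=\|f/M_{\alpha,\beta}\|_{L^\infty}$; let $\mathcal M^+_{\alpha,\beta}$ be the set of non-negative measurable functions of $(x,v)$ with finite norm. Convergence $f_n\to f$ in $\mathcal M_{\alpha,\beta}$ means $f_n\to f$ a.e. and $\sup_n\|f_n\|_{\mathcal M_{\alpha,\beta}}<\infty$. For $0<T\le\infty$ let $|||f|||_\infty=\sup_{t\in[0,T)}\|f(t)\|_{\mathcal M_{\alpha,\beta}}$, and let $L^\infty([0,T),\mathcal M^+_{\alpha,\beta})$ be the set of $f$ with $f(t)\in\mathcal M^+_{\alpha,\beta}$ for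 all $t$ and $|||f|||_\infty<\infty$. Equalities and inequalities between functions of $(x,v)$ are almost everywhere. *Mild solutions.* For $f_0\in\mathcal M^+_{\alpha,\beta}$, a mild solution in $[0,T)$ of $\partial_tf+v\cdot\nabla_xf=G(f,f,f)-L(f,f,f)$, $f(0)=f_0$, is an $f\ge0$ with $f^\#\in C^0([0,T),L^{1,+}_{x,v})\cap L^\infty([0,T),\mathcal M^+_{\alpha,\beta})$, $L^\#(f,f,f),G^\#(f,f,f)\in L^\infty([0,T),L^{1,+}_{x,v})$, $\frac{df^\#}{dt}+L^\#(f,f,f)=G^\#(f,f,f)$ as $L^1_{x,v}$-valued distributions on $(0,T)$, and $f^\#(0)=f_0$. For $g^\#\in L^\infty([0,T),\mathcal M^+_{\alpha,\beta})$ and $h^\#\in L^1_{loc}([0,T),L^{1,+}_{x,v})$, a mild solution in $[0,T)$ of the linear problem $\partial_tf+v\cdot\nabla_xf=h-L(f,g,g)$, $f(0)=f_0$, is an $f\ge0$ with $f^\#\in C^0([0,T),L^{1,+}_{x,v})$, $L^\#(f,g,g)\in L^1_{loc}([0,T),L^{1,+}_{x,v})$, $\frac{df^\#}{dt}+L^\#(f,g,g)=h^\#$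 in the same sense, and $f^\#(0)=f_0$. *Iteration.* Given $l_0,u_0$, the Kaniel–Shinbrot iteration asks that, for $n\ge1$, $l_n$ and $u_n$ be mild solutions of the linear problems $$\partial_tl_n+v\cdot\nabla_xl_n=G(l_{n-1},l_{n-1},l_{n-1})-L(l_n,u_{n-1},u_{n-1}),\qquad l_n(0)=f_0,\tag{1}$$ $$\partial_tu_n+v\cdot\nabla_xu_n=G(u_{n-1},u_{n-1},u_{n-1})-L(u_n,l_{n-1},l_{n-1}),\qquad u_n(0)=f_0.\tag{2}$$ **Theorem 4.1.** For every $d\ge2$ there is a constant $C_d>0$, depending only on $d$, such that the following holds for all cross-sections as above, all $0<T\le\infty$ and all $\alpha,\beta>0$. Put $$K_\beta=C_d\Big[\|b_2\|\Big(\beta^{-d/2}+\frac1{d+\gamma_2-1}\Big)+\|b_3\|\Big(\beta^{-d}+\frac1{2d+\gamma_3-1}\Big)\Big],\qquad \lambda_{\alpha,\beta}=\min\Big\{\frac{\alpha^{1/2}}{24K_\beta},\frac{\alpha^{1/4}}{2\sqrt{6K_\beta}}\Big\}.$$ Let $f_0\in\mathcal M^+_{\alpha,\beta}$, and let $l_0,u_0$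 be such that $l_0^\#,u_0^\#$ do not depend on $t$, belong to $\mathcal M^+_{\alpha,\beta}$, and $\|u_0^\#\|_{\mathcal M_{\alpha,\beta}}<\lambda_{\alpha,\beta}$. Let $l_1,u_1$ be the mild solutions of (1), (2) for $n=1$, and assume that $$0\le l_0^\#\le l_1^\#(t)\le u_1^\#(t)\le u_0^\#\qquad\text{for all }t\in[0,T).$$ Then: (i) There are unique sequences $(l_n)_n,(u_n)_n$ such that, for every $n\ge1$, $l_n,u_n$ are mild solutions of (1), (2). Moreover, for all $n$ and all $t\in[0,T)$, $$0\le l_0^\#\le l_1^\#(t)\le\dots\le l_n^\#(t)\le u_n^\#(t)\le\dots\le u_1^\#(t)\le u_0^\#.$$ (ii) For all $t\in[0,T)$ the sequences $l_n^\#(t)$ and $u_n^\#(t)$ converge in $\mathcal M_{\alpha,\beta}$. Their limits $l^\#(t),u^\#(t)$ satisfy $l^\#,u^\#\in C^0([0,T),L^{1,+}_{x,v})\cap L^\infty([0,T),\mathcal M^+_{\alpha,\beta})$, the functions $L^\#(l,u,u)$, $L^\#(u,l,l)$, $G^\#(l,l,l)$, $G^\#(u,u,u)$ belong to $L^\infty([0,T),L^{1,+}_{x,v})$,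 and for all $t\in[0,T)$ $$l^\#(t)+\int_0^tL^\#(l,u,u)(\tau)\,d\tau=f_0+\int_0^tG^\#(l,l,l)(\tau)\,d\tau,\qquad u^\#(t)+\int_0^tL^\#(u,l,l)(\tau)\,d\tau=f_0+\int_0^tG^\#(u,u,u)(\tau)\,d\tau ,$$ the integrals being Bochner integrals in $L^1_{x,v}$. (iii) $l=u$. (iv) The function $f:=l=u$ is a mild solution of $\partial_tf+v\cdot\nabla_xf=G(f,f,f)-L(f,f,f)$ in $[0,T)$ with $f(0)=f_0$ and $|||f^\#|||_\infty\le\|u_0^\#\|_{\mathcal M_{\alpha,\beta}}$, and it is the only mild solution that satisfies this bound. -/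

import Mathlib

open MeasureTheory Set Filter Topology
open scoped ENNReal RealInnerProductSpace

namespace BinaryTernary

noncomputable section

/-! ### Spaces -/

/-- The space `ℝ^d` of positions, or of velocities, with its Euclidean norm. -/
abbrev Vec (d : ℕ) := EuclideanSpace ℝ (Fin d)

/-- The space `ℝ^{2d} = ℝ^d × ℝ^d` with its Euclidean norm. -/
abbrev Vec2 (d : ℕ) := WithLp 2 (Vec d × Vec d)

/-- The unit sphere `S^{d-1}` of `ℝ^d`. -/
abbrev Sph (d : ℕ) := Metric.sphere (0 : Vec d) 1

/-- The unit sphere `S^{2d-1}` of `ℝ^{2d}`. -/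
abbrev Sph2 (d : ℕ) := Metric.sphere (0 : Vec2 d) 1

/-- The surface measure on `S^{d-1}`. -/
def surf (d : ℕ) : Measure (Sph d) := (volume : Measure (Vec d)).toSphere

/-- The surface measure on `S^{2d-1}`. -/
def surf2 (d : ℕ) : Measure (Sph2 d) := (volume : Measure (Vec2 d)).toSphere

/-- Non-negative, possibly infinite functions of position and velocity `(x, v)`. Equality and order
of such functions are always understood almost everywhere. -/
abbrev Phase (d : ℕ) := Vec d × Vec d → ℝ≥0∞

/-- Time dependent functions of `(x, v)`; only the times in `[0, T)` matter. -/
abbrev TimeFun (d : ℕ) := ℝ → Phase d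

/-- The time interval `[0, T)`, where `T` may be `∞`. -/
def timeSet (T : ℝ≥0∞) : Set ℝ := {t | 0 ≤ t ∧ ENNReal.ofReal t < T}

/-- The open time interval `(0, T)`, where `T` may be `∞`. -/
def openTimeSet (T : ℝ≥0∞) : Set ℝ := {t | 0 < t ∧ ENNReal.ofReal t < T}

/-! ### Collision kernels -/

/-- The data of the two cross-sections
`B₂(u, ω) = |u|^γ₂ b₂(û · ω)` and `B₃(u, ω) = |ũ|^γ₃ b₃(ū · ω, ω₁ · ω₂)`. Only the values of `b₂` on
`[-1, 1]` and of `b₃` on `[-1, 1] × [-1/2, 1/2]` matter. -/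
structure Kernel where
  /-- the binary exponent -/
  γ₂ : ℝ
  /-- the ternary exponent -/
  γ₃ : ℝ
  /-- the binary angular transition probability density -/
  b₂ : ℝ → ℝ
  /-- the ternary angular transition probability density -/
  b₃ : ℝ → ℝ → ℝ

/-- `‖b₂‖_{L¹(S^{d-1})}`, the integral of `ω ↦ b₂(ν · ω)` over the sphere for a unit vector `ν`
(by rotation invariance all unit vectors `ν` give the same value). -/
def Kernel.norm₂ (K : Kernel) (d : ℕ) : ℝ≥0∞ :=
  ⨆ ν : Sph d, ∫⁻ ω, ENNReal.ofReal (K.b₂ ⟪(ν : Vec d), (ω : Vec d)⟫) ∂(surf d)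

/-- The ellipsoid `{(ν₁, ν₂) : |ν₁|² + |ν₂|² + |ν₁ - ν₂|² = 1}` of `ℝ^{2d}`. -/
def ellipsoid (d : ℕ) : Set (Vec2 d) :=
  {ν | ‖ν.fst‖ ^ 2 + ‖ν.snd‖ ^ 2 + ‖ν.fst - ν.snd‖ ^ 2 = 1}

/-- `‖b₃‖_{L¹(S^{2d-1})}`, the supremum over the `ν` in the ellipsoid of the integral of
`ω ↦ b₃(ν · ω, ω₁ · ω₂)` over the sphere `S^{2d-1}`. -/
def Kernel.norm₃ (K : Kernel) (d : ℕ) : ℝ≥0∞ :=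
  ⨆ ν : ellipsoid d, ∫⁻ ω,
    ENNReal.ofReal (K.b₃ ⟪(ν : Vec2 d), (ω : Vec2 d)⟫ ⟪(ω : Vec2 d).fst, (ω : Vec2 d).snd⟫)
      ∂(surf2 d)

/-- The standing assumptions on the cross-sections in dimension `d`. -/
structure Kernel.Admissible (K : Kernel) (d : ℕ) : Prop where
  γ₂_gt : -(d : ℝ) + 1 < K.γ₂
  γ₂_le : K.γ₂ ≤ 1
  γ₃_gt : -(2 * (d : ℝ)) + 1 < K.γ₃
  γ₃_le : K.γ₃ ≤ 1
  measurable₂ : Measurable K.b₂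
  nonneg₂ : ∀ z ∈ Icc (-1 : ℝ) 1, 0 ≤ K.b₂ z
  even₂ : ∀ z ∈ Icc (-1 : ℝ) 1, K.b₂ (-z) = K.b₂ z
  norm₂_lt : K.norm₂ d < ∞
  measurable₃ : Measurable (Function.uncurry K.b₃)
  nonneg₃ : ∀ z ∈ Icc (-1 : ℝ) 1, ∀ w ∈ Icc (-(1 / 2) : ℝ) (1 / 2), 0 ≤ K.b₃ z w
  even₃ : ∀ z ∈ Icc (-1 : ℝ) 1, ∀ w ∈ Icc (-(1 / 2) : ℝ) (1 / 2), K.b₃ (-z) w = K.b₃ z w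
  norm₃_lt : K.norm₃ d < ∞
  /-- at least one of the two densities is not trivially zero -/
  nontrivial : K.norm₂ d ≠ 0 ∨ K.norm₃ d ≠ 0

variable {d : ℕ}

/-- The binary cross-section `B₂(u, ω)`. -/
def Kernel.B₂ (K : Kernel) (u : Vec d) (ω : Sph d) : ℝ≥0∞ :=
  ENNReal.ofReal (‖u‖ ^ K.γ₂ * K.b₂ ⟪‖u‖⁻¹ • u, (ω : Vec d)⟫)

/-- `|ũ| = (|v - v₁|² + |v - v₂|² + |v₁ - v₂|²)^{1/2}`, as a function of `u = (v₁ - v, v₂ - v)`. -/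
def magTilde (u : Vec2 d) : ℝ :=
  Real.sqrt (‖u.fst‖ ^ 2 + ‖u.snd‖ ^ 2 + ‖u.fst - u.snd‖ ^ 2)

/-- The ternary cross-section `B₃(u, ω)`. -/
def Kernel.B₃ (K : Kernel) (u : Vec2 d) (ω : Sph2 d) : ℝ≥0∞ :=
  ENNReal.ofReal (magTilde u ^ K.γ₃ *
    K.b₃ ⟪(magTilde u)⁻¹ • u, (ω : Vec2 d)⟫ ⟪(ω : Vec2 d).fst, (ω : Vec2 d).snd⟫)

/-! ### Collision laws -/

/-- The outgoing velocity `v'` of a binary interaction. -/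
def post (ω : Sph d) (v v₁ : Vec d) : Vec d :=
  v + ⟪(ω : Vec d), v₁ - v⟫ • (ω : Vec d)

/-- The outgoing velocity `v₁'` of a binary interaction. -/
def post₁ (ω : Sph d) (v v₁ : Vec d) : Vec d :=
  v₁ - ⟪(ω : Vec d), v₁ - v⟫ • (ω : Vec d)

/-- The scalar `(ω₁ · (v₁ - v) + ω₂ · (v₂ - v)) / (1 + ω₁ · ω₂)` of a ternary interaction. -/
def ternCoeff (ω : Sph2 d) (v v₁ v₂ : Vec d) : ℝ :=
  (⟪(ω : Vec2 d).fst, v₁ - v⟫ + ⟪(ω : Vec2 d).snd, v₂ - v⟫) /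
    (1 + ⟪(ω : Vec2 d).fst, (ω : Vec2 d).snd⟫)

/-- The outgoing velocity `v*` of a ternary interaction. -/
def star (ω : Sph2 d) (v v₁ v₂ : Vec d) : Vec d :=
  v + ternCoeff ω v v₁ v₂ • ((ω : Vec2 d).fst + (ω : Vec2 d).snd)

/-- The outgoing velocity `v₁*` of a ternary interaction. -/
def star₁ (ω : Sph2 d) (v v₁ v₂ : Vec d) : Vec d :=
  v₁ - ternCoeff ω v v₁ v₂ • (ω : Vec2 d).fst

/-- The outgoing velocity `v₂*` of a ternary interaction. -/
def star₂ (ω : Sph2 d) (v v₁ v₂ : Vec d) : Vec d :=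
  v₂ - ternCoeff ω v v₁ v₂ • (ω : Vec2 d).snd

/-! ### Gain and loss operators -/

/-- The binary gain operator. -/
def Kernel.G₂ (K : Kernel) (f g : TimeFun d) : TimeFun d := fun t z =>
  ∫⁻ v₁, ∫⁻ ω, K.B₂ (v₁ - z.2) ω *
    (f t (z.1, post ω z.2 v₁) * g t (z.1, post₁ ω z.2 v₁)) ∂(surf d)

/-- The binary loss operator. -/
def Kernel.L₂ (K : Kernel) (f g : TimeFun d) : TimeFun d := fun t z =>
  ∫⁻ v₁, ∫⁻ ω, K.B₂ (v₁ - z.2) ω * (f t (z.1, z.2) * g t (z.1, v₁)) ∂(surf d)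

/-- The ternary gain operator. -/
def Kernel.G₃ (K : Kernel) (f g h : TimeFun d) : TimeFun d := fun t z =>
  ∫⁻ v₁, ∫⁻ v₂, ∫⁻ ω, K.B₃ (WithLp.toLp 2 (v₁ - z.2, v₂ - z.2)) ω *
    (f t (z.1, star ω z.2 v₁ v₂) * g t (z.1, star₁ ω z.2 v₁ v₂) *
      h t (z.1, star₂ ω z.2 v₁ v₂)) ∂(surf2 d)

/-- The ternary loss operator. -/
def Kernel.L₃ (K : Kernel) (f g h : TimeFun d) : TimeFun d := fun t z =>
  ∫⁻ v₁, ∫⁻ v₂, ∫⁻ ω, K.B₃ (WithLp.toLp 2 (v₁ - z.2, v₂ - z.2)) ω *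
    (f t (z.1, z.2) * g t (z.1, v₁) * h t (z.1, v₂)) ∂(surf2 d)

/-- The gain operator `G(f, g, h) = G₂(f, g) + G₃(f, g, h)`. -/
def Kernel.G (K : Kernel) (f g h : TimeFun d) : TimeFun d := fun t z =>
  K.G₂ f g t z + K.G₃ f g h t z

/-- The loss operator `L(f, g, h) = L₂(f, g) + L₃(f, g, h)`. -/
def Kernel.L (K : Kernel) (f g h : TimeFun d) : TimeFun d := fun t z =>
  K.L₂ f g t z + K.L₃ f g h t z

/-! ### Transport -/

/-- `f^#(t, x, v) = f(t, x + t v, v)`. -/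
def sharp (f : TimeFun d) : TimeFun d := fun t z => f t (z.1 + t • z.2, z.2)

/-- The function `f` for which `f^#(t) = φ` at all times, i.e. `f(t, x, v) = φ(x - t v, v)`. -/
def ofStationarySharp (φ : Phase d) : TimeFun d := fun t z => φ (z.1 - t • z.2, z.2)

/-! ### Function spaces -/

/-- The Maxwellian `M_{α,β}(x, v) = exp(-α|x|² - β|v|²)`. -/
def maxwellian (α β : ℝ) : Phase d := fun z =>
  ENNReal.ofReal (Real.exp (-α * ‖z.1‖ ^ 2 - β * ‖z.2‖ ^ 2))

/-- `‖f‖_{M_{α,β}}`, the essential supremum of `f / M_{α,β}`. -/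
def normM (α β : ℝ) (f : Phase d) : ℝ≥0∞ :=
  essSup (fun z => f z / maxwellian α β z) volume

/-- `f ∈ M_{α,β}^+`. -/
def MemM (α β : ℝ) (f : Phase d) : Prop := Measurable f ∧ normM α β f < ∞

/-- Convergence in `M_{α,β}`: almost everywhere, with bounded norms. -/
def TendstoM (α β : ℝ) (F : ℕ → Phase d) (f : Phase d) : Prop :=
  (∀ᵐ z, Tendsto (fun n => F n z) atTop (𝓝 (f z))) ∧ ⨆ n, normM α β (F n) < ∞

/-- `|||f|||_∞`, the supremum over all `t ∈ [0, T)` of `‖f(t)‖_{M_{α,β}}`. -/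
def tripleNorm (T : ℝ≥0∞) (α β : ℝ) (f : TimeFun d) : ℝ≥0∞ :=
  ⨆ t ∈ timeSet T, normM α β (f t)

/-- `f ∈ L^∞([0, T), M_{α,β}^+)`. -/
def MemLinftyM (T : ℝ≥0∞) (α β : ℝ) (f : TimeFun d) : Prop :=
  (∀ t ∈ timeSet T, Measurable (f t)) ∧ tripleNorm T α β f < ∞

/-- `f ∈ L^{1,+}_{x,v}`. -/
def MemL1 (f : Phase d) : Prop := Measurable f ∧ ∫⁻ z, f z ≠ ∞

open Classical in
/-- The element of the Banach space `L¹_{x,v}` given by a function in `L^{1,+}_{x,v}`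
(and `0` for any other function). -/
def toL1 (f : Phase d) : Lp ℝ 1 (volume : Measure (Vec d × Vec d)) :=
  if h : MemL1 f then
    (integrable_toReal_of_lintegral_ne_top h.1.aemeasurable h.2).toL1 (fun z => (f z).toReal)
  else 0

/-- `f ∈ C⁰([0, T), L^{1,+}_{x,v})`. -/
def MemC0L1 (T : ℝ≥0∞) (f : TimeFun d) : Prop :=
  (∀ t ∈ timeSet T, MemL1 (f t)) ∧ ContinuousOn (fun t => toL1 (f t)) (timeSet T)

/-- `f ∈ L^∞([0, T), L^{1,+}_{x,v})`, a Bochner space. -/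
def MemLinftyL1 (T : ℝ≥0∞) (f : TimeFun d) : Prop :=
  (∀ t ∈ timeSet T, MemL1 (f t)) ∧
    MemLp (fun t => toL1 (f t)) ∞ (volume.restrict (timeSet T))

/-- `f ∈ L¹_loc([0, T), L^{1,+}_{x,v})`, a Bochner space: `f(t)` is integrable for almost every `t`,
and `t ↦ f(t) ∈ L¹_{x,v}` is Bochner integrable on the compact subsets of `[0, T)`. -/
def MemL1locL1 (T : ℝ≥0∞) (f : TimeFun d) : Prop :=
  (∀ t ∈ timeSet T, Measurable (f t)) ∧
    (∀ᵐ t ∂(volume.restrict (timeSet T)), MemL1 (f t)) ∧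
    LocallyIntegrableOn (fun t => toL1 (f t)) (timeSet T)

/-- `df/dt + p = q` in the sense of `L¹_{x,v}`-valued distributions on `(0, T)`. -/
def WeakDeriv (T : ℝ≥0∞) (f p q : TimeFun d) : Prop :=
  ∀ φ : ℝ → ℝ, ContDiff ℝ (⊤ : ℕ∞) φ → HasCompactSupport φ → tsupport φ ⊆ openTimeSet T →
    -(∫ t in timeSet T, deriv φ t • toL1 (f t)) + ∫ t in timeSet T, φ t • toL1 (p t) =
      ∫ t in timeSet T, φ t • toL1 (q t)

/-! ### Mild solutions -/

/-- `f` is a mild solution in `[0, T)` of the binary-ternary Boltzmann equation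
`∂ₜf + v · ∇ₓf = G(f, f, f) - L(f, f, f)`, `f(0) = f₀`. -/
structure IsMildSolution (K : Kernel) (T : ℝ≥0∞) (α β : ℝ) (f₀ : Phase d) (f : TimeFun d) :
    Prop where
  measurable : ∀ t ∈ timeSet T, Measurable (f t)
  continuous : MemC0L1 T (sharp f)
  bounded : MemLinftyM T α β (sharp f)
  loss : MemLinftyL1 T (sharp (K.L f f f))
  gain : MemLinftyL1 T (sharp (K.G f f f))
  equation : WeakDeriv T (sharp f) (sharp (K.L f f f)) (sharp (K.G f f f))
  initial : sharp f 0 =ᵐ[volume] f₀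

/-- `f` is a mild solution in `[0, T)` of the linear problem
`∂ₜf + v · ∇ₓf = h - L(f, g, g)`, `f(0) = f₀`. -/
structure IsLinearMildSolution (K : Kernel) (T : ℝ≥0∞) (f₀ : Phase d) (g h f : TimeFun d) :
    Prop where
  measurable : ∀ t ∈ timeSet T, Measurable (f t)
  continuous : MemC0L1 T (sharp f)
  loss : MemL1locL1 T (sharp (K.L f g g))
  equation : WeakDeriv T (sharp f) (sharp (K.L f g g)) (sharp h)
  initial : sharp f 0 =ᵐ[volume] f₀

/-- What is required of the data `g, h` of the linear problem:
`g^# ∈ L^∞([0, T), M_{α,β}^+)` and `h^# ∈ L¹_loc([0, T), L^{1,+}_{x,v})`. -/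
def IsLinearData (T : ℝ≥0∞) (α β : ℝ) (g h : TimeFun d) : Prop :=
  MemLinftyM T α β (sharp g) ∧ MemL1locL1 T (sharp h)

/-- `(l_n)`, `(u_n)` is a Kaniel-Shinbrot iteration that starts from `l₀^# = φ`, `u₀^# = ψ`: for
all `n ≥ 1`,
`∂ₜl_n + v · ∇ₓl_n = G(l_{n-1}, l_{n-1}, l_{n-1}) - L(l_n, u_{n-1}, u_{n-1})`, `l_n(0) = f₀`,
`∂ₜu_n + v · ∇ₓu_n = G(u_{n-1}, u_{n-1}, u_{n-1}) - L(u_n, l_{n-1}, l_{n-1})`, `u_n(0) = f₀`. -/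
structure IsKSIteration (K : Kernel) (T : ℝ≥0∞) (f₀ φ ψ : Phase d) (l u : ℕ → TimeFun d) :
    Prop where
  l_zero : l 0 = ofStationarySharp φ
  u_zero : u 0 = ofStationarySharp ψ
  l_succ : ∀ n, IsLinearMildSolution K T f₀ (u n) (K.G (l n) (l n) (l n)) (l (n + 1))
  u_succ : ∀ n, IsLinearMildSolution K T f₀ (l n) (K.G (u n) (u n) (u n)) (u (n + 1))

/-! ### The constants -/

/-- The constant `K_β`, for the value `C` of the dimensional constant. -/
def Kernel.Kconst (K : Kernel) (d : ℕ) (C β : ℝ) : ℝ :=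
  C * ((K.norm₂ d).toReal * (β ^ (-(d : ℝ) / 2) + 1 / (d + K.γ₂ - 1)) +
    (K.norm₃ d).toReal * (β ^ (-(d : ℝ)) + 1 / (2 * d + K.γ₃ - 1)))

/-- The threshold `λ_{α,β}`. -/
def Kernel.lam (K : Kernel) (d : ℕ) (C α β : ℝ) : ℝ :=
  min (α ^ (1 / 2 : ℝ) / (24 * K.Kconst d C β))
    (α ^ (1 / 4 : ℝ) / (2 * Real.sqrt (6 * K.Kconst d C β)))

end

end BinaryTernary

open BinaryTernary

namespace BinaryTernary

/-! ### Weak time derivatives of Banach-valued functions -/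

section WeakTime

variable {E : Type*} [NormedAddCommGroup E] [NormedSpace ℝ E] {T : ℝ≥0∞}

/-! Everything is measured against the transported Maxwellian W = `transMax`, for which W^# =
M_{α,β} at all times. Binary and ternary collisions conserve momentum and energy, so a product of
values of W is the same before and after a collision. Gain and loss of W are therefore one function
`Kernel.Q`, equal to W R(W) with R the collision frequency `Kernel.R`.

Free transport makes this function small on average in time. Along a characteristic, a Gaussian in x
- τ(w - v) has time integral at most √(π/α)/|w - v|. This lowers the exponent of the cross-section
by one, and the singularity that remains is integrable because γ₂ - 1 > -d and γ₃ - 1 > -2d. The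
result is ∫ R(W)^# dτ ≤ K_β/√α (`Kernel.lintegral_sharp_R_transMax_le`), and so ∫ Q^# dτ ≤ (K_β/√α)
M.

Since L(f, g, g) = f R(g), the linear problem is a scalar linear equation along each characteristic.
Duhamel's formula `linSol` solves it, and it increases with the source and decreases with the
frequency. Induction from the beginning condition gives the order of all iterates
(`BeginningCondition.monotone_step`), and all of them lie below mW with m = ‖u₀^#‖.

On the ball of radius m the operators are Lipschitz: an error δW in the arguments changes G and L by
at most δ(2m + 3m²)Q (`Kernel.G_le_add`, `Kernel.L_le_add`). Integrated in time, u_n ≤ l_n + δW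
implies u_{n+1} ≤ l_{n+1} + qδW with q = 2(2m + 3m²)K_β/√α (`Setting.upper_le_lower_add`). The
threshold λ forces q < 1, so the gap tends to 0 geometrically. Both sequences then have the same
limit, and the integral equation passes to the limit with errors of size δ_n
(`integralForm_of_approx`). The same contraction, applied to two mild solutions below mW, proves
their uniqueness.

Uniqueness for the linear problem is a different matter, because its solutions are only known to be
integrable and R(g) may grow linearly in v. The loss term is local in (x, v), so Grönwall's
inequality can be applied on each set |v| ≤ N (`ae_eq_of_linear_integral_eq`).

Mild solutions are defined by distributions in time. They are converted to integral equations, and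
these are tested on measurable sets (`IntegralForm`), where all terms are non-negative and the
estimates need no subtraction. -/

lemma Icc_subset_timeSet {t : ℝ} (ht : t ∈ timeSet T) : Icc 0 t ⊆ timeSet T := fun _ hs =>
  ⟨hs.1, (ENNReal.ofReal_le_ofReal hs.2).trans_lt ht.2⟩

lemma zero_mem_timeSet (hT : 0 < T) : (0 : ℝ) ∈ timeSet T := ⟨le_rfl, by simpa using hT⟩

lemma pos_of_mem_timeSet {t : ℝ} (ht : t ∈ timeSet T) : 0 < T := zero_le.trans_lt ht.2

lemma openTimeSet_subset : openTimeSet T ⊆ timeSet T := fun _ ht => ⟨ht.1.le, ht.2⟩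

lemma isOpen_openTimeSet : IsOpen (openTimeSet T) :=
  isOpen_Ioi.inter (isOpen_Iio.preimage ENNReal.continuous_ofReal)

lemma measurableSet_timeSet : MeasurableSet (timeSet T) :=
  measurableSet_Ici.inter (measurableSet_Iio.preimage ENNReal.measurable_ofReal)

lemma exists_openTimeSet_gt {t : ℝ} (ht : t ∈ timeSet T) : ∃ s ∈ openTimeSet T, t < s := by
  obtain ⟨c, hc, hc'⟩ := exists_between ht.2
  refine ⟨c.toReal, ⟨?_, ?_⟩, ?_⟩
  · exact ENNReal.toReal_pos (ne_bot_of_gt hc) (hc'.trans_le le_top).ne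
  · rwa [ENNReal.ofReal_toReal (hc'.trans_le le_top).ne]
  · exact (ENNReal.ofReal_lt_iff_lt_toReal ht.1 (hc'.trans_le le_top).ne).1 hc

lemma openTimeSet_nonempty (hT : 0 < T) : (openTimeSet T).Nonempty :=
  let ⟨s, hs, _⟩ := exists_openTimeSet_gt (zero_mem_timeSet hT); ⟨s, hs⟩

/-- Continuous functions that agree almost everywhere on [0, T) agree everywhere on it, the initial
time included. The inclusion is what that argument asks of the set. -/
lemma timeSet_subset_closure_interior : timeSet T ⊆ closure (interior (timeSet T)) := by
  intro t ht
  have hU : openTimeSet T ⊆ interior (timeSet T) :=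
    interior_maximal openTimeSet_subset isOpen_openTimeSet
  refine closure_mono hU ?_
  obtain ⟨s, hs, hts⟩ := exists_openTimeSet_gt ht
  have hsub : Ioo t s ⊆ openTimeSet T := fun r hr => ⟨ht.1.trans_lt hr.1,
    (ENNReal.ofReal_le_ofReal hr.2.le).trans_lt hs.2⟩
  refine closure_mono hsub ?_
  rw [closure_Ioo hts.ne]
  exact left_mem_Icc.2 hts.le

/-- The support of a test function is enclosed in a bounded interval away from 0 and T, so that
integrals over [0, T) become interval integrals even for T = ∞. -/
lemma exists_Icc_subset_openTimeSet (hT : 0 < T) {K : Set ℝ} (hK : IsCompact K)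
    (hKT : K ⊆ openTimeSet T) :
    ∃ a b, 0 < a ∧ a ≤ b ∧ b ∈ openTimeSet T ∧ K ⊆ Ioo a b := by
  rcases K.eq_empty_or_nonempty with rfl | hne
  · obtain ⟨s, hs⟩ := openTimeSet_nonempty hT
    exact ⟨s, s, hs.1, le_rfl, hs, empty_subset _⟩
  · have h1 := hKT (hK.sInf_mem hne)
    have h2 := hKT (hK.sSup_mem hne)
    obtain ⟨b, hb, hb'⟩ := exists_openTimeSet_gt (openTimeSet_subset h2)
    have hlt : ∀ x ∈ K, x ∈ Ioo (sInf K / 2) b := fun x hx =>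
      ⟨(half_lt_self h1.1).trans_le (csInf_le hK.bddBelow hx),
        (le_csSup hK.bddAbove hx).trans_lt hb'⟩
    obtain ⟨x, hx⟩ := hne
    exact ⟨sInf K / 2, b, half_pos h1.1, ((hlt x hx).1.trans (hlt x hx).2).le, hb, hlt⟩

lemma setIntegral_timeSet_eq {a b : ℝ} (ha : 0 ≤ a) (hab : a ≤ b) (hb : b ∈ timeSet T) {f : ℝ → E}
    (hf : ∀ t, t ∉ Ioc a b → f t = 0) : ∫ t in timeSet T, f t = ∫ t in a..b, f t := by
  rw [intervalIntegral.integral_of_le hab]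
  refine setIntegral_eq_of_subset_of_forall_sdiff_eq_zero measurableSet_timeSet ?_
    (fun t ht => hf t ht.2)
  exact fun t ht => Icc_subset_timeSet hb ⟨ha.trans ht.1.le, ht.2⟩

omit [NormedSpace ℝ E] in
lemma LocallyIntegrableOn.intervalIntegrable_timeSet {r : ℝ → E}
    (hr : LocallyIntegrableOn r (timeSet T)) {t : ℝ} (ht : t ∈ timeSet T) :
    IntervalIntegrable r volume 0 t := by
  rw [intervalIntegrable_iff_integrableOn_Icc_of_le ht.1]
  exact hr.integrableOn_compact_subset (Icc_subset_timeSet ht) isCompact_Icc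

lemma continuousOn_primitive_timeSet {r : ℝ → E}
    (hr : LocallyIntegrableOn r (timeSet T)) :
    ContinuousOn (fun t => ∫ s in (0 : ℝ)..t, r s) (timeSet T) := by
  intro t ht
  obtain ⟨b, hb, htb⟩ := exists_openTimeSet_gt ht
  have h := hr.integrableOn_compact_subset (Icc_subset_timeSet (openTimeSet_subset hb)) isCompact_Icc
  have hc : ContinuousOn (fun t => ∫ s in (0 : ℝ)..t, r s) (Icc 0 b) := by
    have := intervalIntegral.continuousOn_primitive_interval (a := (0 : ℝ)) (b := b) (f := r)
      (μ := volume) (by rwa [uIcc_of_le (openTimeSet_subset hb).1])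
    rwa [uIcc_of_le (openTimeSet_subset hb).1] at this
  refine ((hc t ⟨ht.1, htb.le⟩).mono_of_mem_nhdsWithin ?_)
  refine mem_nhdsWithin.2 ⟨Iio b, isOpen_Iio, htb, fun x hx => ⟨hx.2.1, hx.1.le⟩⟩

/-- Integration by parts when `r` is merely integrable: by Fubini on the triangle s ≤ t, the inner
integral of φ' over [s, b] is -φ(s). No boundary term appears at `a`, where the primitive vanishes.
-/
lemma integral_deriv_smul_primitive [CompleteSpace E] {a b : ℝ} (hab : a ≤ b) {r : ℝ → E}
    (hr : IntervalIntegrable r volume a b) {φ : ℝ → ℝ} (hφ : ContDiff ℝ (⊤ : ℕ∞) φ)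
    (hb : φ b = 0) :
    ∫ t in a..b, deriv φ t • ∫ s in a..t, r s = -∫ s in a..b, φ s • r s := by
  have hφ' : Continuous (deriv φ) := hφ.continuous_deriv (by simp)
  have hr' : IntegrableOn r (Ioc a b) := (intervalIntegrable_iff_integrableOn_Ioc_of_le hab).1 hr
  have hd : IntegrableOn (deriv φ) (Ioc a b) := (hφ'.integrableOn_Icc).mono_set Ioc_subset_Icc_self
  have hp : Integrable (fun p : ℝ × ℝ => {p : ℝ × ℝ | p.2 ≤ p.1}.indicator
      (fun p => deriv φ p.1 • r p.2) p)
      ((volume.restrict (Ioc a b)).prod (volume.restrict (Ioc a b))) :=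
    (Integrable.smul_prod (f := deriv φ) (g := r) hd hr').indicator
      (measurableSet_le measurable_snd measurable_fst)
  have hsw := integral_integral_swap (f := fun t s => {p : ℝ × ℝ | p.2 ≤ p.1}.indicator
      (fun p => deriv φ p.1 • r p.2) (t, s)) hp
  rw [intervalIntegral.integral_of_le hab, intervalIntegral.integral_of_le hab]
  have h1 : ∫ t in Ioc a b, deriv φ t • ∫ s in a..t, r s = ∫ t in Ioc a b, ∫ s in Ioc a b,
      {p : ℝ × ℝ | p.2 ≤ p.1}.indicator (fun p => deriv φ p.1 • r p.2) (t, s) := by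
    refine setIntegral_congr_fun measurableSet_Ioc fun t ht => ?_
    rw [intervalIntegral.integral_of_le ht.1.le, ← integral_smul]
    have : Ioc a t = Ioc a b ∩ Iic t := by
      rw [Ioc_inter_Iic, min_eq_right ht.2]
    rw [this, ← setIntegral_indicator measurableSet_Iic]
    rfl
  rw [h1, hsw, ← integral_neg]
  refine setIntegral_congr_fun measurableSet_Ioc fun s hs => ?_
  have : ∀ t, {p : ℝ × ℝ | p.2 ≤ p.1}.indicator (fun p => deriv φ p.1 • r p.2) (t, s)
      = (Ici s).indicator (fun t => deriv φ t • r s) t := fun t => rfl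
  simp_rw [this]
  rw [setIntegral_indicator measurableSet_Ici, integral_smul_const]
  have hI : Ioc a b ∩ Ici s = Icc s b := by
    ext x; exact ⟨fun h => ⟨h.2, h.1.2⟩, fun h => ⟨⟨hs.1.trans_le h.1, h.2⟩, h.1⟩⟩
  rw [hI, integral_Icc_eq_integral_Ioc, ← intervalIntegral.integral_of_le hs.2,
    intervalIntegral.integral_deriv_eq_sub (fun x _ => (hφ.differentiable (by simp)) x)
      (hφ'.intervalIntegrable _ _), hb, zero_sub, neg_smul]

/-- A function with an integrable derivative has this derivative in the sense of distributions. -/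
lemma weak_of_integral [CompleteSpace E] {F r : ℝ → E} {F₀ : E}
    (hr : LocallyIntegrableOn r (timeSet T))
    (hF : ∀ t ∈ timeSet T, F t = F₀ + ∫ s in (0 : ℝ)..t, r s)
    {φ : ℝ → ℝ} (hφ : ContDiff ℝ (⊤ : ℕ∞) φ) (hc : HasCompactSupport φ)
    (hφT : tsupport φ ⊆ openTimeSet T) :
    -(∫ t in timeSet T, deriv φ t • F t) = ∫ t in timeSet T, φ t • r t := by
  rcases eq_zero_or_pos T with rfl | hT
  · have : timeSet 0 = ∅ := by ext t; simp [timeSet]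
    simp [this]
  obtain ⟨a, b, ha, hab, hb, hK⟩ := exists_Icc_subset_openTimeSet hT hc hφT
  have hbT := openTimeSet_subset hb
  have hφ0 : ∀ t, t ∉ Ioo a b → φ t = 0 := fun t ht =>
    image_eq_zero_of_notMem_tsupport fun h => ht (hK h)
  have hφd : ∀ t, t ∉ Ioo a b → deriv φ t = 0 := fun t ht =>
    image_eq_zero_of_notMem_tsupport fun h => ht (hK (tsupport_deriv_subset h))
  have hsub : ∀ t, t ∉ Ioc 0 b → t ∉ Ioo a b := fun t ht h => ht ⟨ha.trans h.1, h.2.le⟩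
  rw [setIntegral_timeSet_eq le_rfl hbT.1 hbT (fun t ht => by rw [hφd t (hsub t ht), zero_smul]),
    setIntegral_timeSet_eq le_rfl hbT.1 hbT (fun t ht => by rw [hφ0 t (hsub t ht), zero_smul])]
  have hri := LocallyIntegrableOn.intervalIntegrable_timeSet hr hbT
  have hb0 : φ b = 0 := hφ0 b (fun h => lt_irrefl _ h.2)
  have h00 : φ 0 = 0 := hφ0 0 (fun h => lt_asymm ha h.1)
  have hφ' : Continuous (deriv φ) := hφ.continuous_deriv (by simp)
  have e1 : ∫ t in (0 : ℝ)..b, deriv φ t • F t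
      = ∫ t in (0 : ℝ)..b, (deriv φ t • F₀ + deriv φ t • ∫ s in (0 : ℝ)..t, r s) := by
    refine intervalIntegral.integral_congr fun t ht => ?_
    rw [uIcc_of_le hbT.1] at ht
    simp only [hF t (Icc_subset_timeSet hbT ht), smul_add]
  have hcp : ContinuousOn (fun t => ∫ s in (0 : ℝ)..t, r s) (uIcc 0 b) := by
    rw [uIcc_of_le hbT.1]
    exact (continuousOn_primitive_timeSet hr).mono (Icc_subset_timeSet hbT)
  rw [e1, intervalIntegral.integral_add, integral_deriv_smul_primitive hbT.1 hri hφ hb0,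
    intervalIntegral.integral_smul_const, intervalIntegral.integral_deriv_eq_sub
      (fun x _ => (hφ.differentiable (by simp)) x) (hφ'.intervalIntegrable _ _), hb0, h00]
  · simp
  · exact (hφ'.smul continuous_const).intervalIntegrable _ _
  · exact (hφ'.continuousOn.smul hcp).intervalIntegrable

/-- A continuous function whose distributional derivative vanishes is constant. -/
lemma eq_const_of_weak_deriv_zero [CompleteSpace E] {H : ℝ → E} (hH : ContinuousOn H (timeSet T))
    (hw : ∀ φ : ℝ → ℝ, ContDiff ℝ (⊤ : ℕ∞) φ → HasCompactSupport φ → tsupport φ ⊆ openTimeSet T →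
      ∫ t in timeSet T, deriv φ t • H t = 0) {t : ℝ} (ht : t ∈ timeSet T) : H t = H 0 := by
  have hT := pos_of_mem_timeSet ht
  obtain ⟨c, hc⟩ := openTimeSet_nonempty hT
  obtain ⟨ε, hε, hball⟩ := Metric.isOpen_iff.1 (isOpen_openTimeSet (T := T)) c hc
  -- A fixed bump η of integral 1 in (0, T). The constant value of `H` will be its η-average `C`.
  let β : ContDiffBump c := ⟨ε / 4, ε / 2, by positivity, by linarith⟩
  let η : ℝ → ℝ := β.normed volume
  have hη : ContDiff ℝ (⊤ : ℕ∞) η := β.contDiff_normed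
  have hηc : HasCompactSupport η := β.hasCompactSupport_normed
  have hηT : tsupport η ⊆ openTimeSet T := by
    rw [β.tsupport_normed_eq]
    exact (Metric.closedBall_subset_ball (by simp [β]; linarith)).trans hball
  have hη1 : ∫ s, η s = 1 := β.integral_normed
  have hHU : LocallyIntegrableOn H (openTimeSet T) :=
    (hH.mono openTimeSet_subset).locallyIntegrableOn isOpen_openTimeSet.measurableSet
  have hint : ∀ ψ : ℝ → ℝ, ContDiff ℝ (⊤ : ℕ∞) ψ → HasCompactSupport ψ →
      tsupport ψ ⊆ openTimeSet T → IntegrableOn (fun s => ψ s • H s) (timeSet T) := by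
    intro ψ hψ hψc hψT
    obtain ⟨a, b, ha, hab, hb, hK⟩ := exists_Icc_subset_openTimeSet hT hψc hψT
    have h1 : IntegrableOn (fun s => ψ s • H s) (Icc a b) :=
      (hψ.continuous.continuousOn.smul (hH.mono fun s hs => Icc_subset_timeSet
        (openTimeSet_subset hb) ⟨ha.le.trans hs.1, hs.2⟩)).integrableOn_compact isCompact_Icc
    refine (h1.integrable_of_forall_notMem_eq_zero fun s hs => ?_).integrableOn
    rw [image_eq_zero_of_notMem_tsupport (f := ψ) fun h => hs (Ioo_subset_Icc_self (hK h)),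
      zero_smul]
  set C : E := ∫ s in timeSet T, η s • H s with hC
  -- The du Bois-Reymond argument: ψ - (∫ψ)η has integral zero, so it is the derivative of a test
  -- function, and the hypothesis applies to that primitive.
  have key : ∀ ψ : ℝ → ℝ, ContDiff ℝ (⊤ : ℕ∞) ψ → HasCompactSupport ψ →
      tsupport ψ ⊆ openTimeSet T → ∫ s, ψ s • (H s - C) = 0 := by
    intro ψ hψ hψc hψT
    set m : ℝ := ∫ s, ψ s with hm
    let ρ : ℝ → ℝ := fun s => ψ s - m * η s
    have hρ : ContDiff ℝ (⊤ : ℕ∞) ρ := hψ.sub (contDiff_const.mul hη)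
    have hρc : HasCompactSupport ρ := hψc.sub (hηc.mul_left)
    have hρT : tsupport ρ ⊆ openTimeSet T := by
      refine (tsupport_sub _ _).trans (union_subset hψT ?_)
      exact (tsupport_mul_subset_right).trans hηT
    have hψi : Integrable ψ := hψ.continuous.integrable_of_hasCompactSupport hψc
    have hηi : Integrable η := hη.continuous.integrable_of_hasCompactSupport hηc
    have hρ0 : ∫ s, ρ s = 0 := by
      simp only [ρ]
      rw [integral_sub hψi (hηi.const_mul m), integral_const_mul, hη1, ← hm]; ring
    obtain ⟨a, b, ha, hab, hb, hK⟩ := exists_Icc_subset_openTimeSet hT hρc hρT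
    have hz : ∀ s, s ∉ Ioo a b → ρ s = 0 := fun s hs =>
      image_eq_zero_of_notMem_tsupport fun h => hs (hK h)
    let φ : ℝ → ℝ := fun t => ∫ s in a..t, ρ s
    have hφd : ∀ t, HasDerivAt φ (ρ t) t := fun t =>
      intervalIntegral.integral_hasDerivAt_right (hρ.continuous.intervalIntegrable _ _)
        (hρ.continuous.stronglyMeasurableAtFilter _ _) hρ.continuous.continuousAt
    have hφd' : deriv φ = ρ := funext fun t => (hφd t).deriv
    have hφ : ContDiff ℝ (⊤ : ℕ∞) φ := by
      rw [contDiff_infty_iff_deriv]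
      exact ⟨fun t => (hφd t).differentiableAt, hφd' ▸ hρ⟩
    -- To the left of `a` the integrand vanishes; to the right of `b` the primitive equals the full
    -- integral of ρ, which is zero. Hence the primitive has compact support.
    have hφz : ∀ t, t ∉ Icc a b → φ t = 0 := by
      intro t ht
      simp only [φ]
      rcases lt_or_ge t a with h | h
      · rw [intervalIntegral.integral_symm, neg_eq_zero,
          intervalIntegral.integral_of_le h.le]
        exact setIntegral_eq_zero_of_forall_eq_zero fun s hs => hz s fun h' =>
          absurd h'.1 (not_lt.2 hs.2)
      · have hbt : b < t := by by_contra h'; exact ht ⟨h, not_lt.1 h'⟩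
        rw [intervalIntegral.integral_of_le h, ← hρ0]
        exact setIntegral_eq_integral_of_forall_compl_eq_zero fun s hs => hz s fun h' =>
          hs ⟨h'.1, (h'.2.trans hbt).le⟩
    have hsupp : tsupport φ ⊆ Icc a b := by
      refine closure_minimal (fun t ht => ?_) isClosed_Icc
      by_contra h; exact ht (hφz t h)
    have hφc : HasCompactSupport φ := isCompact_Icc.of_isClosed_subset (isClosed_tsupport _) hsupp
    have hφT : tsupport φ ⊆ openTimeSet T := hsupp.trans fun s hs => ⟨ha.trans_le hs.1,
      (ENNReal.ofReal_le_ofReal hs.2).trans_lt hb.2⟩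
    have h0 := hw φ hφ hφc hφT
    rw [hφd'] at h0
    have e : ∀ s, ρ s • H s = ψ s • H s - m • (η s • H s) := fun s => by
      simp only [ρ, sub_smul, mul_smul]
    simp_rw [e] at h0
    have hmi : Integrable (fun s => m • (η s • H s)) (volume.restrict (timeSet T)) :=
      (hint η hη hηc hηT).smul m
    rw [integral_sub (hint ψ hψ hψc hψT) hmi, integral_smul, ← hC] at h0
    have hz2 : ∀ s, s ∉ timeSet T → ψ s • H s = 0 := fun s hs => by
      rw [image_eq_zero_of_notMem_tsupport (f := ψ) fun h => hs (openTimeSet_subset (hψT h)),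
        zero_smul]
    have hi2 : Integrable (fun s => ψ s • H s) := by
      refine (hint ψ hψ hψc hψT).integrable_of_forall_notMem_eq_zero hz2
    simp_rw [smul_sub]
    rw [integral_sub hi2 (hψi.smul_const C), integral_smul_const, ← hm, ← h0,
      setIntegral_eq_integral_of_forall_compl_eq_zero hz2]
  have hae := isOpen_openTimeSet.ae_eq_zero_of_integral_contDiff_smul_eq_zero (μ := volume)
    (f := fun s => H s - C) (U := openTimeSet T)
    (hHU.sub ((locallyIntegrable_const C).locallyIntegrableOn _)) key
  -- [0, T) and (0, T) differ by the null set {0}; continuity then removes the exceptional set.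
  have hae2 : H =ᵐ[volume.restrict (timeSet T)] fun _ => C := by
    refine (ae_restrict_iff' measurableSet_timeSet).2 ?_
    filter_upwards [hae, (show ∀ᵐ x : ℝ, x ≠ 0 by simp [ae_iff])] with s hs hs0 hsT
    exact sub_eq_zero.1 (hs ⟨lt_of_le_of_ne hsT.1 hs0.symm, hsT.2⟩)
  have := Measure.eqOn_of_ae_eq hae2 hH continuousOn_const timeSet_subset_closure_interior
  rw [this ht, this (zero_mem_timeSet hT)]

/-- The integral form of an equation that holds in the sense of distributions. -/
lemma integral_of_weak [CompleteSpace E] {F r : ℝ → E} (hFc : ContinuousOn F (timeSet T))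
    (hr : LocallyIntegrableOn r (timeSet T))
    (hw : ∀ φ : ℝ → ℝ, ContDiff ℝ (⊤ : ℕ∞) φ → HasCompactSupport φ → tsupport φ ⊆ openTimeSet T →
      -(∫ t in timeSet T, deriv φ t • F t) = ∫ t in timeSet T, φ t • r t)
    {t : ℝ} (ht : t ∈ timeSet T) : F t = F 0 + ∫ s in (0 : ℝ)..t, r s := by
  have hT := pos_of_mem_timeSet ht
  have hcR := continuousOn_primitive_timeSet hr
  have hint : ∀ (G : ℝ → E), ContinuousOn G (timeSet T) → ∀ ψ : ℝ → ℝ,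
      ContDiff ℝ (⊤ : ℕ∞) ψ → HasCompactSupport ψ →
      tsupport ψ ⊆ openTimeSet T → IntegrableOn (fun s => deriv ψ s • G s) (timeSet T) := by
    intro G hG ψ hψ hψc hψT
    obtain ⟨a, b, ha, hab, hb, hK⟩ := exists_Icc_subset_openTimeSet hT hψc hψT
    have h1 : IntegrableOn (fun s => deriv ψ s • G s) (Icc a b) :=
      ((hψ.continuous_deriv (by simp)).continuousOn.smul (hG.mono fun s hs => Icc_subset_timeSet
        (openTimeSet_subset hb) ⟨ha.le.trans hs.1, hs.2⟩)).integrableOn_compact isCompact_Icc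
    refine (h1.integrable_of_forall_notMem_eq_zero fun s hs => ?_).integrableOn
    rw [image_eq_zero_of_notMem_tsupport (f := deriv ψ) fun h =>
      hs (Ioo_subset_Icc_self (hK (tsupport_deriv_subset h))), zero_smul]
  -- `F` minus the primitive of `r` has zero distributional derivative, since the primitive has
  -- derivative `r` by `weak_of_integral`.
  have h := eq_const_of_weak_deriv_zero (H := fun t => F t - ∫ s in (0 : ℝ)..t, r s)
    (hFc.sub hcR) (fun φ hφ hc hφT => by
      simp_rw [smul_sub]
      rw [integral_sub (hint F hFc φ hφ hc hφT) (hint _ hcR φ hφ hc hφT)]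
      have h1 := hw φ hφ hc hφT
      have h2 := weak_of_integral (F := fun t => ∫ s in (0 : ℝ)..t, r s) (F₀ := 0) hr
        (fun t _ => by simp) hφ hc hφT
      rw [← h2, neg_inj] at h1
      rw [h1, sub_self]) ht
  simp only [intervalIntegral.integral_same, sub_zero] at h
  rw [← h]; abel

lemma integrable_smul_test {r : ℝ → E} (hr : LocallyIntegrableOn r (timeSet T)) {φ : ℝ → ℝ}
    (hφ : Continuous φ) (hc : HasCompactSupport φ) (hφT : tsupport φ ⊆ openTimeSet T) :
    Integrable (fun t => φ t • r t) (volume.restrict (timeSet T)) := by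
  have hi : IntegrableOn (fun t => φ t • r t) (tsupport φ) :=
    IntegrableOn.continuousOn_smul
      (hr.integrableOn_compact_subset (hφT.trans openTimeSet_subset) hc) hφ.continuousOn hc
  refine Integrable.integrableOn (hi.integrable_of_forall_notMem_eq_zero fun s hs => ?_)
  rw [image_eq_zero_of_notMem_tsupport hs, zero_smul]

end WeakTime
end BinaryTernary

namespace BinaryTernary

noncomputable section

/-! ### Non-negative functions as elements of `L¹` -/

section L1

variable {d : ℕ} {T : ℝ≥0∞}

instance isAddHaarMeasure_phase :
    (volume : Measure (Vec d × Vec d)).IsAddHaarMeasure :=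
  inferInstanceAs (((volume : Measure (Vec d)).prod (volume : Measure (Vec d))).IsAddHaarMeasure)

instance sigmaFinite_phase : SigmaFinite (volume : Measure (Vec d × Vec d)) := inferInstance

instance fact_one_ne_top : Fact ((1 : ℝ≥0∞) ≠ ∞) := ⟨ENNReal.one_ne_top⟩

instance isSeparable_phase : IsSeparable (volume : Measure (Vec d × Vec d)) := by
  have : SFinite (volume : Measure (Vec d × Vec d)) := inferInstance
  infer_instance

/-- The Banach space `L¹_{x,v}`. -/
abbrev PhaseL1 (d : ℕ) := Lp ℝ 1 (volume : Measure (Vec d × Vec d))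

lemma MemL1.congr {f g : Phase d} (hf : MemL1 f) (hg : Measurable g) (h : g =ᵐ[volume] f) :
    MemL1 g := ⟨hg, by rw [lintegral_congr_ae h]; exact hf.2⟩

lemma MemL1.mono {f g : Phase d} (hf : MemL1 f) (hg : Measurable g) (h : g ≤ᵐ[volume] f) :
    MemL1 g := ⟨hg, ((lintegral_mono_ae h).trans_lt hf.2.lt_top).ne⟩

lemma MemL1.ae_lt_top {f : Phase d} (hf : MemL1 f) : ∀ᵐ z, f z < ∞ :=
  MeasureTheory.ae_lt_top hf.1 hf.2

lemma coeFn_toL1 {f : Phase d} (hf : MemL1 f) : toL1 f =ᵐ[volume] fun z => (f z).toReal := by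
  rw [toL1, dif_pos hf]
  exact Integrable.coeFn_toL1 _

lemma toL1_congr {f g : Phase d} (hf : Measurable f) (hg : Measurable g) (h : f =ᵐ[volume] g) :
    toL1 f = toL1 g := by
  by_cases hfm : MemL1 f
  · have hgm : MemL1 g := hfm.congr hg h.symm
    refine Lp.ext ?_
    filter_upwards [coeFn_toL1 hfm, coeFn_toL1 hgm, h] with z h1 h2 h3
    rw [h1, h2, h3]
  · have hgm : ¬ MemL1 g := fun hgm => hfm (hgm.congr hf h)
    rw [toL1, toL1, dif_neg hfm, dif_neg hgm]

lemma ae_eq_of_toL1_eq {f g : Phase d} (hf : MemL1 f) (hg : MemL1 g) (h : toL1 f = toL1 g) :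
    f =ᵐ[volume] g := by
  filter_upwards [coeFn_toL1 hf, coeFn_toL1 hg, hf.ae_lt_top, hg.ae_lt_top] with z h1 h2 h3 h4
  rw [← ENNReal.toReal_eq_toReal_iff' h3.ne h4.ne, ← h1, ← h2, h]

lemma enorm_toL1 {f : Phase d} (hf : MemL1 f) : ‖toL1 f‖ₑ = ∫⁻ z, f z := by
  rw [Lp.enorm_def, eLpNorm_one_eq_lintegral_enorm]
  refine lintegral_congr_ae ?_
  filter_upwards [coeFn_toL1 hf, hf.ae_lt_top] with z h1 h2
  rw [h1, Real.enorm_of_nonneg ENNReal.toReal_nonneg, ENNReal.ofReal_toReal h2.ne]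

lemma enorm_toL1_le {f : Phase d} : ‖toL1 f‖ₑ ≤ ∫⁻ z, f z := by
  by_cases hf : MemL1 f
  · exact (enorm_toL1 hf).le
  · rw [toL1, dif_neg hf]; simp

open Classical in
/-- A jointly measurable function of `(t, x, v)` is a measurable function of `t` with values
in `L¹`. -/
lemma measurable_toL1 {A : TimeFun d} (hA : Measurable (Function.uncurry A)) :
    StronglyMeasurable (fun t => toL1 (A t)) := by
  have hs : MeasurableSet {t : ℝ | MemL1 (A t)} := by
    have : {t : ℝ | MemL1 (A t)} = {t | ∫⁻ z, A t z = ∞}ᶜ := by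
      ext t
      simp only [mem_ofPred_eq, mem_compl_iff, MemL1]
      exact ⟨fun h => h.2, fun h => ⟨hA.of_uncurry_left, h⟩⟩
    rw [this]
    exact (measurableSet_eq_fun hA.lintegral_prod_right' measurable_const).compl
  borelize ↥(PhaseL1 d)
  refine Measurable.stronglyMeasurable ?_
  refine measurable_of_isOpen fun U hU => ?_
  obtain ⟨D, hD, hDd⟩ := TopologicalSpace.exists_countable_dense (PhaseL1 d)
  have hball : ∀ (g : PhaseL1 d) (r : ℝ), MeasurableSet {t | edist (toL1 (A t)) g < ENNReal.ofReal r} := by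
    intro g r
    refine measurableSet_lt ?_ measurable_const
    have hgm := (Lp.stronglyMeasurable g).measurable
    -- Where `A t` is not integrable, `toL1` is 0 and the distance is a constant. Elsewhere it is an
    -- integral with parameter, measurable by Tonelli.
    have e : (fun t => edist (toL1 (A t)) g) = {t : ℝ | MemL1 (A t)}.piecewise
        (fun t => ∫⁻ z, ‖(A t z).toReal - g z‖ₑ) (fun _ => edist 0 g) := by
      ext t
      by_cases ht : MemL1 (A t)
      · rw [piecewise_eq_of_mem _ _ _ (show t ∈ {t : ℝ | MemL1 (A t)} from ht), Lp.edist_def, eLpNorm_one_eq_lintegral_enorm]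
        refine lintegral_congr_ae ?_
        filter_upwards [coeFn_toL1 ht] with z hz
        rw [Pi.sub_apply, hz]
      · rw [piecewise_eq_of_notMem _ _ _ (show t ∉ {t : ℝ | MemL1 (A t)} from ht), toL1, dif_neg ht]
    rw [e]
    refine Measurable.piecewise hs ?_ measurable_const
    have : Measurable (fun p : ℝ × (Vec d × Vec d) =>
        ‖(Function.uncurry A p).toReal - g p.2‖ₑ) := by fun_prop
    exact this.lintegral_prod_right'
  -- `PhaseL1` is separable, so every open set is a countable union of balls. Measurability of the
  -- distances to fixed points is therefore enough.
  have hU' : U = ⋃ q ∈ {q : PhaseL1 d × ℚ | q.1 ∈ D ∧ Metric.ball q.1 (q.2 : ℝ) ⊆ U},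
      Metric.ball q.1 (q.2 : ℝ) := by
    ext x
    simp only [mem_iUnion, exists_prop]
    refine ⟨fun hx => ?_, fun ⟨q, hq, hxq⟩ => hq.2 hxq⟩
    obtain ⟨ε, hε, hb⟩ := Metric.isOpen_iff.1 hU x hx
    obtain ⟨q, hq0, hqε⟩ := exists_rat_btwn (half_pos hε)
    obtain ⟨y, hyD, hy⟩ := hDd.exists_dist_lt x hq0
    refine ⟨(y, q), ⟨hyD, fun w hw => hb ?_⟩, hy⟩
    rw [Metric.mem_ball] at hw ⊢
    calc dist w x ≤ dist w y + dist y x := dist_triangle _ _ _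
      _ < ε := by rw [dist_comm y x]; linarith
  rw [hU', preimage_iUnion₂]
  refine MeasurableSet.biUnion ?_ fun q _ => ?_
  · refine (hD.prod (countable_univ (α := ℚ))).mono fun (q : PhaseL1 d × ℚ) hq => mem_prod.2 ⟨hq.1, mem_univ _⟩
  · convert hball q.1 q.2 using 1
    ext t
    rw [mem_preimage, Metric.mem_ball, mem_ofPred_eq, edist_dist,
      ENNReal.ofReal_lt_ofReal_iff_of_nonneg dist_nonneg]

/-- Integration over a set, as a functional on `L¹`. -/
def setInt (S : Set (Vec d × Vec d)) : PhaseL1 d →L[ℝ] ℝ :=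
  (L1.integralCLM (μ := (volume : Measure (Vec d × Vec d)).restrict S)).comp
    (LpToLpRestrictCLM (Vec d × Vec d) ℝ ℝ volume 1 S)

lemma setInt_apply (S : Set (Vec d × Vec d)) (f : PhaseL1 d) : setInt S f = ∫ z in S, f z := by
  have h : setInt S f = L1.integral (LpToLpRestrictCLM (Vec d × Vec d) ℝ ℝ volume 1 S f) := by
    rw [L1.integral_eq]; rfl
  rw [h, L1.integral_eq_integral]
  exact integral_congr_ae (LpToLpRestrictCLM_coeFn ℝ S f)

lemma setInt_toL1 {f : Phase d} (hf : MemL1 f) (S : Set (Vec d × Vec d)) :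
    setInt S (toL1 f) = (∫⁻ z in S, f z).toReal := by
  rw [setInt_apply, integral_congr_ae (ae_restrict_of_ae (coeFn_toL1 hf)),
    integral_toReal hf.1.aemeasurable (ae_restrict_of_ae hf.ae_lt_top)]

lemma MemL1.setLIntegral_ne_top {f : Phase d} (hf : MemL1 f) (S : Set (Vec d × Vec d)) :
    ∫⁻ z in S, f z ≠ ∞ := ((setLIntegral_le_lintegral _ _).trans_lt hf.2.lt_top).ne

lemma eq_of_setInt_eq {f g : PhaseL1 d} (h : ∀ S, MeasurableSet S → setInt S f = setInt S g) :
    f = g := by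
  refine Lp.ext ?_
  refine Integrable.ae_eq_of_forall_setIntegral_eq f g (L1.integrable_coeFn f)
    (L1.integrable_coeFn g) fun S hS _ => ?_
  rw [← setInt_apply, ← setInt_apply, h S hS]

/-! ### Integrability in time -/

lemma MemL1locL1.congr {f g : TimeFun d} (hf : MemL1locL1 T f)
    (hg : ∀ t ∈ timeSet T, Measurable (g t)) (h : ∀ t ∈ timeSet T, g t =ᵐ[volume] f t) :
    MemL1locL1 T g := by
  refine ⟨hg, ?_, ?_⟩
  · filter_upwards [hf.2.1, ae_restrict_mem measurableSet_timeSet] with t h1 ht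
    exact h1.congr (hg t ht) (h t ht)
  · refine hf.2.2.congr ?_
    filter_upwards [ae_restrict_mem measurableSet_timeSet] with t ht
    exact toL1_congr (hf.1 t ht) (hg t ht) (h t ht).symm

lemma MemLinftyL1.memL1locL1 {f : TimeFun d} (hf : MemLinftyL1 T f) : MemL1locL1 T f := by
  refine ⟨fun t ht => (hf.1 t ht).1, ?_, ?_⟩
  · filter_upwards [ae_restrict_mem measurableSet_timeSet] with t ht using hf.1 t ht
  · have h : LocallyIntegrable (fun t => toL1 (f t)) (volume.restrict (timeSet T)) :=
      hf.2.locallyIntegrable le_top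
    exact (locallyIntegrableOn_of_locallyIntegrable_restrict h)

lemma memLinftyL1_of_le {A : TimeFun d} (hA : Measurable (Function.uncurry A)) {C : ℝ≥0∞}
    (hC : C ≠ ∞) (h : ∀ t ∈ timeSet T, ∫⁻ z, A t z ≤ C) : MemLinftyL1 T A := by
  refine ⟨fun t ht => ⟨hA.of_uncurry_left, ((h t ht).trans_lt hC.lt_top).ne⟩, ?_⟩
  refine memLp_top_of_bound (measurable_toL1 hA).aestronglyMeasurable C.toReal ?_
  filter_upwards [ae_restrict_mem measurableSet_timeSet] with t ht
  rw [← toReal_enorm]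
  exact ENNReal.toReal_mono hC (enorm_toL1_le.trans (h t ht))

/-- A continuous functional commutes with the Bochner integral. The finiteness half is what later
allows cancellation of time integrals in `ℝ≥0∞`. -/
lemma MemL1locL1.setInt_integral {A : TimeFun d} (hA : MemL1locL1 T A) {t : ℝ}
    (ht : t ∈ timeSet T) (S : Set (Vec d × Vec d)) :
    ∫⁻ τ in Ioc 0 t, ∫⁻ z in S, A τ z ≠ ∞ ∧
      setInt S (∫ τ in (0 : ℝ)..t, toL1 (A τ)) =
        (∫⁻ τ in Ioc 0 t, ∫⁻ z in S, A τ z).toReal := by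
  have hi := LocallyIntegrableOn.intervalIntegrable_timeSet hA.2.2 ht
  have hi' : IntegrableOn (fun τ => toL1 (A τ)) (Ioc 0 t) :=
    (intervalIntegrable_iff_integrableOn_Ioc_of_le ht.1).1 hi
  have hsub : Ioc 0 t ⊆ timeSet T := Ioc_subset_Icc_self.trans (Icc_subset_timeSet ht)
  have hm : ∀ᵐ τ ∂(volume.restrict (Ioc 0 t)), MemL1 (A τ) := ae_restrict_of_ae_restrict_of_subset
    hsub hA.2.1
  have hsi : Integrable (fun τ => setInt S (toL1 (A τ))) (volume.restrict (Ioc 0 t)) :=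
    (setInt S).integrable_comp hi'
  have e : (fun τ => setInt S (toL1 (A τ))) =ᵐ[volume.restrict (Ioc 0 t)]
      fun τ => (∫⁻ z in S, A τ z).toReal := by
    filter_upwards [hm] with τ hτ using setInt_toL1 hτ S
  have e2 : (fun τ => ∫⁻ z in S, A τ z) =ᵐ[volume.restrict (Ioc 0 t)]
      fun τ => ‖setInt S (toL1 (A τ))‖ₑ := by
    filter_upwards [hm, e] with τ hτ hτ2
    rw [hτ2, Real.enorm_of_nonneg ENNReal.toReal_nonneg,
      ENNReal.ofReal_toReal (hτ.setLIntegral_ne_top S)]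
  constructor
  · rw [lintegral_congr_ae e2]
    exact hsi.2.ne
  · rw [← (setInt S).intervalIntegral_comp_comm hi, intervalIntegral.integral_of_le ht.1,
      integral_congr_ae e, integral_toReal]
    · exact (hsi.1.enorm.congr e2.symm)
    · filter_upwards [hm] with τ hτ using (hτ.setLIntegral_ne_top S).lt_top

/-! ### The integral form of an evolution equation -/

/-- The integral form `F(t) + ∫₀ᵗ P = f₀ + ∫₀ᵗ Q`, tested on sets. -/
def IntegralForm (T : ℝ≥0∞) (f₀ : Phase d) (F P Q : TimeFun d) : Prop :=
  ∀ t ∈ timeSet T, ∀ S, MeasurableSet S →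
    (∫⁻ z in S, F t z) + ∫⁻ τ in Ioc 0 t, ∫⁻ z in S, P τ z =
      (∫⁻ z in S, f₀ z) + ∫⁻ τ in Ioc 0 t, ∫⁻ z in S, Q τ z

/-- The functionals `setInt S` separate the points of L¹, and all four terms are finite, so nothing
is lost between real numbers and `ℝ≥0∞`. -/
lemma integralForm_iff {f₀ : Phase d} {F P Q : TimeFun d} (hf₀ : MemL1 f₀)
    (hF : ∀ t ∈ timeSet T, MemL1 (F t)) (hP : MemL1locL1 T P) (hQ : MemL1locL1 T Q) :
    IntegralForm T f₀ F P Q ↔ ∀ t ∈ timeSet T,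
      toL1 (F t) + ∫ τ in (0 : ℝ)..t, toL1 (P τ) = toL1 f₀ + ∫ τ in (0 : ℝ)..t, toL1 (Q τ) := by
  have key : ∀ t ∈ timeSet T, ∀ S, 
      (setInt S (toL1 (F t) + ∫ τ in (0 : ℝ)..t, toL1 (P τ)) =
        setInt S (toL1 f₀ + ∫ τ in (0 : ℝ)..t, toL1 (Q τ)) ↔
      (∫⁻ z in S, F t z) + ∫⁻ τ in Ioc 0 t, ∫⁻ z in S, P τ z =
      (∫⁻ z in S, f₀ z) + ∫⁻ τ in Ioc 0 t, ∫⁻ z in S, Q τ z) := by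
    intro t ht S
    have h1 := (hF t ht).setLIntegral_ne_top S
    have h2 := hf₀.setLIntegral_ne_top S
    obtain ⟨hP1, hP2⟩ := hP.setInt_integral ht S
    obtain ⟨hQ1, hQ2⟩ := hQ.setInt_integral ht S
    rw [map_add, map_add, hP2, hQ2, setInt_toL1 (hF t ht), setInt_toL1 hf₀,
      ← ENNReal.toReal_add h1 hP1, ← ENNReal.toReal_add h2 hQ1,
      ENNReal.toReal_eq_toReal_iff' (by finiteness) (by finiteness)]
  constructor
  · intro h t ht
    exact eq_of_setInt_eq fun S hS => (key t ht S).2 (h t ht S hS)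
  · intro h t ht S _
    rw [← key t ht S, h t ht]

lemma weakDeriv_of_integral {f₀ : Phase d} {F P Q : TimeFun d}
    (hP : MemL1locL1 T P) (hQ : MemL1locL1 T Q)
    (h : ∀ t ∈ timeSet T,
      toL1 (F t) + ∫ τ in (0 : ℝ)..t, toL1 (P τ) = toL1 f₀ + ∫ τ in (0 : ℝ)..t, toL1 (Q τ)) :
    WeakDeriv T F P Q := by
  intro φ hφ hc hφT
  have hr : LocallyIntegrableOn (fun τ => toL1 (Q τ) - toL1 (P τ)) (timeSet T) :=
    hQ.2.2.sub hP.2.2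
  have hw := weak_of_integral (F := fun t => toL1 (F t)) (F₀ := toL1 f₀) hr (fun t ht => by
    rw [intervalIntegral.integral_sub
      (LocallyIntegrableOn.intervalIntegrable_timeSet hQ.2.2 ht)
      (LocallyIntegrableOn.intervalIntegrable_timeSet hP.2.2 ht), add_sub, ← h t ht,
      add_sub_cancel_right]) hφ hc hφT
  have hi : ∀ A : TimeFun d, MemL1locL1 T A →
      Integrable (fun t => φ t • toL1 (A t)) (volume.restrict (timeSet T)) := fun A hA =>
    integrable_smul_test hA.2.2 hφ.continuous hc hφT
  rw [hw]
  simp_rw [smul_sub]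
  rw [integral_sub (hi Q hQ) (hi P hP)]
  abel

lemma integral_of_weakDeriv {F P Q : TimeFun d} (hF : MemC0L1 T F)
    (hP : MemL1locL1 T P) (hQ : MemL1locL1 T Q) (h : WeakDeriv T F P Q) {t : ℝ}
    (ht : t ∈ timeSet T) :
    toL1 (F t) + ∫ τ in (0 : ℝ)..t, toL1 (P τ) = toL1 (F 0) + ∫ τ in (0 : ℝ)..t, toL1 (Q τ) := by
  have hr : LocallyIntegrableOn (fun τ => toL1 (Q τ) - toL1 (P τ)) (timeSet T) :=
    hQ.2.2.sub hP.2.2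
  have := integral_of_weak hF.2 hr (fun φ hφ hc hφT => by
    have hi : ∀ A : TimeFun d, MemL1locL1 T A →
        Integrable (fun t => φ t • toL1 (A t)) (volume.restrict (timeSet T)) := fun A hA =>
      integrable_smul_test hA.2.2 hφ.continuous hc hφT
    simp_rw [smul_sub]
    rw [integral_sub (hi Q hQ) (hi P hP), ← h φ hφ hc hφT]
    abel) ht
  rw [this, intervalIntegral.integral_sub
      (LocallyIntegrableOn.intervalIntegrable_timeSet hQ.2.2 ht)
      (LocallyIntegrableOn.intervalIntegrable_timeSet hP.2.2 ht)]
  abel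

lemma memC0L1_of_integral {f₀ : Phase d} {F P Q : TimeFun d}
    (hF : ∀ t ∈ timeSet T, MemL1 (F t)) (hP : MemL1locL1 T P) (hQ : MemL1locL1 T Q)
    (h : ∀ t ∈ timeSet T,
      toL1 (F t) + ∫ τ in (0 : ℝ)..t, toL1 (P τ) = toL1 f₀ + ∫ τ in (0 : ℝ)..t, toL1 (Q τ)) :
    MemC0L1 T F := by
  refine ⟨hF, ?_⟩
  refine ContinuousOn.congr (f := fun t => toL1 f₀ + (∫ τ in (0 : ℝ)..t, toL1 (Q τ))
    - ∫ τ in (0 : ℝ)..t, toL1 (P τ)) ?_ fun t ht => ?_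
  · exact (continuousOn_const.add (continuousOn_primitive_timeSet hQ.2.2)).sub
      (continuousOn_primitive_timeSet hP.2.2)
  · simp only [← h t ht, add_sub_cancel_right]

lemma WeakDeriv.congr {F P Q F' P' Q' : TimeFun d} (h : WeakDeriv T F P Q)
    (hF : ∀ t ∈ timeSet T, toL1 (F' t) = toL1 (F t))
    (hP : ∀ t ∈ timeSet T, toL1 (P' t) = toL1 (P t))
    (hQ : ∀ t ∈ timeSet T, toL1 (Q' t) = toL1 (Q t)) : WeakDeriv T F' P' Q' := by
  intro φ hφ hc hφT
  have h1 : ∫ t in timeSet T, deriv φ t • toL1 (F' t) = ∫ t in timeSet T, deriv φ t • toL1 (F t) :=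
    setIntegral_congr_fun measurableSet_timeSet fun t ht => by simp only [hF t ht]
  have h2 : ∫ t in timeSet T, φ t • toL1 (P' t) = ∫ t in timeSet T, φ t • toL1 (P t) :=
    setIntegral_congr_fun measurableSet_timeSet fun t ht => by simp only [hP t ht]
  have h3 : ∫ t in timeSet T, φ t • toL1 (Q' t) = ∫ t in timeSet T, φ t • toL1 (Q t) :=
    setIntegral_congr_fun measurableSet_timeSet fun t ht => by simp only [hQ t ht]
  rw [h1, h2, h3]
  exact h φ hφ hc hφT

end L1

end

end BinaryTernary

namespace BinaryTernary

noncomputable section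

/-! ### Measurability of the collision operators -/

section Operators

variable {d : ℕ}

instance isFiniteMeasure_surf : IsFiniteMeasure (surf d) := by unfold surf; infer_instance

instance isFiniteMeasure_surf2 : IsFiniteMeasure (surf2 d) := by unfold surf2; infer_instance

lemma Kernel.measurable_B₂ {K : Kernel} (hK : K.Admissible d) :
    Measurable (fun p : Vec d × Sph d => K.B₂ p.1 p.2) := by
  have := hK.measurable₂
  unfold Kernel.B₂
  fun_prop

lemma measurable_magTilde : Measurable (magTilde : Vec2 d → ℝ) := by
  unfold magTilde
  fun_prop

lemma Kernel.measurable_B₃ {K : Kernel} (hK : K.Admissible d) :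
    Measurable (fun p : Vec2 d × Sph2 d => K.B₃ p.1 p.2) := by
  have := hK.measurable₃
  have hm := measurable_magTilde (d := d)
  unfold Kernel.B₃
  have h : Measurable (fun p : Vec2 d × Sph2 d => Function.uncurry K.b₃
    (⟪(magTilde p.1)⁻¹ • p.1, (p.2 : Vec2 d)⟫, ⟪(p.2 : Vec2 d).fst, (p.2 : Vec2 d).snd⟫)) := by
    fun_prop
  simp only [Function.uncurry] at h
  fun_prop

lemma measurable_post : Measurable (fun p : (Vec d × Vec d) × Sph d => post p.2 p.1.1 p.1.2) := by
  unfold post; fun_prop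

lemma measurable_post₁ : Measurable (fun p : (Vec d × Vec d) × Sph d => post₁ p.2 p.1.1 p.1.2) := by
  unfold post₁; fun_prop

lemma measurable_ternCoeff : Measurable (fun p : (Vec d × Vec d × Vec d) × Sph2 d =>
    ternCoeff p.2 p.1.1 p.1.2.1 p.1.2.2) := by
  unfold ternCoeff; fun_prop

lemma measurable_star : Measurable (fun p : (Vec d × Vec d × Vec d) × Sph2 d =>
    star p.2 p.1.1 p.1.2.1 p.1.2.2) := by
  have := measurable_ternCoeff (d := d)
  unfold star; fun_prop

lemma measurable_star₁ : Measurable (fun p : (Vec d × Vec d × Vec d) × Sph2 d =>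
    star₁ p.2 p.1.1 p.1.2.1 p.1.2.2) := by
  have := measurable_ternCoeff (d := d)
  unfold star₁; fun_prop

lemma measurable_star₂ : Measurable (fun p : (Vec d × Vec d × Vec d) × Sph2 d =>
    star₂ p.2 p.1.1 p.1.2.1 p.1.2.2) := by
  have := measurable_ternCoeff (d := d)
  unfold star₂; fun_prop

/-- Measurability of an iterated integral over `v₁`, `ω` that depends on a parameter. -/
lemma measurable_lintegral_two {X : Type*} [MeasurableSpace X] {Φ : X → Vec d → Sph d → ℝ≥0∞}
    (h : Measurable fun p : (X × Vec d) × Sph d => Φ p.1.1 p.1.2 p.2) :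
    Measurable fun x => ∫⁻ v₁, ∫⁻ ω, Φ x v₁ ω ∂(surf d) := by
  have h1 : Measurable fun p : X × Vec d => ∫⁻ ω, Φ p.1 p.2 ω ∂(surf d) := h.lintegral_prod_right'
  exact h1.lintegral_prod_right'

lemma measurable_lintegral_three {X : Type*} [MeasurableSpace X]
    {Φ : X → Vec d → Vec d → Sph2 d → ℝ≥0∞}
    (h : Measurable fun p : ((X × Vec d) × Vec d) × Sph2 d => Φ p.1.1.1 p.1.1.2 p.1.2 p.2) :
    Measurable fun x => ∫⁻ v₁, ∫⁻ v₂, ∫⁻ ω, Φ x v₁ v₂ ω ∂(surf2 d) := by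
  have h1 : Measurable fun p : (X × Vec d) × Vec d => ∫⁻ ω, Φ p.1.1 p.1.2 p.2 ω ∂(surf2 d) :=
    h.lintegral_prod_right'
  have h2 : Measurable fun p : X × Vec d => ∫⁻ v₂, ∫⁻ ω, Φ p.1 p.2 v₂ ω ∂(surf2 d) :=
    h1.lintegral_prod_right'
  exact h2.lintegral_prod_right'

variable {K : Kernel} (hK : K.Admissible d) {f g h : TimeFun d}
include hK

lemma Kernel.measurable_gain₂_integrand (hf : Measurable (Function.uncurry f))
    (hg : Measurable (Function.uncurry g)) :
    Measurable fun p : ((ℝ × Vec d × Vec d) × Vec d) × Sph d =>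
      K.B₂ (p.1.2 - p.1.1.2.2) p.2 * (f p.1.1.1 (p.1.1.2.1, post p.2 p.1.1.2.2 p.1.2) *
        g p.1.1.1 (p.1.1.2.1, post₁ p.2 p.1.1.2.2 p.1.2)) := by
  have h0 := K.measurable_B₂ hK
  have h1 := measurable_post (d := d)
  have h2 := measurable_post₁ (d := d)
  refine (h0.comp (by fun_prop : Measurable fun p : ((ℝ × Vec d × Vec d) × Vec d) × Sph d =>
    (p.1.2 - p.1.1.2.2, p.2))).mul ?_
  refine (hf.comp (f := fun p : ((ℝ × Vec d × Vec d) × Vec d) × Sph d =>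
    (p.1.1.1, (p.1.1.2.1, post p.2 p.1.1.2.2 p.1.2))) ?_).mul
    (hg.comp (f := fun p : ((ℝ × Vec d × Vec d) × Vec d) × Sph d =>
    (p.1.1.1, (p.1.1.2.1, post₁ p.2 p.1.1.2.2 p.1.2))) ?_)
  · have := h1.comp (by fun_prop : Measurable fun p : ((ℝ × Vec d × Vec d) × Vec d) × Sph d =>
      ((p.1.1.2.2, p.1.2), p.2))
    exact Measurable.prodMk (by fun_prop) (Measurable.prodMk (by fun_prop) this)
  · have := h2.comp (by fun_prop : Measurable fun p : ((ℝ × Vec d × Vec d) × Vec d) × Sph d =>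
      ((p.1.1.2.2, p.1.2), p.2))
    exact Measurable.prodMk (by fun_prop) (Measurable.prodMk (by fun_prop) this)

lemma Kernel.measurable_loss₂_integrand (hf : Measurable (Function.uncurry f))
    (hg : Measurable (Function.uncurry g)) :
    Measurable fun p : ((ℝ × Vec d × Vec d) × Vec d) × Sph d =>
      K.B₂ (p.1.2 - p.1.1.2.2) p.2 * (f p.1.1.1 (p.1.1.2.1, p.1.1.2.2) *
        g p.1.1.1 (p.1.1.2.1, p.1.2)) := by
  have h0 := K.measurable_B₂ hK
  refine (h0.comp (by fun_prop : Measurable fun p : ((ℝ × Vec d × Vec d) × Vec d) × Sph d =>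
    (p.1.2 - p.1.1.2.2, p.2))).mul ?_
  exact (hf.comp (by fun_prop : Measurable fun p : ((ℝ × Vec d × Vec d) × Vec d) × Sph d =>
    (p.1.1.1, (p.1.1.2.1, p.1.1.2.2)))).mul
    (hg.comp (by fun_prop : Measurable fun p : ((ℝ × Vec d × Vec d) × Vec d) × Sph d =>
    (p.1.1.1, (p.1.1.2.1, p.1.2))))

omit hK in
lemma measurable_relative_velocity :
    Measurable fun p : (((ℝ × Vec d × Vec d) × Vec d) × Vec d) × Sph2 d =>
      ((WithLp.toLp 2 (p.1.1.2 - p.1.1.1.2.2, p.1.2 - p.1.1.1.2.2) : Vec2 d), p.2) := by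
  fun_prop

lemma Kernel.measurable_B₃_comp :
    Measurable fun p : (((ℝ × Vec d × Vec d) × Vec d) × Vec d) × Sph2 d =>
      K.B₃ (WithLp.toLp 2 (p.1.1.2 - p.1.1.1.2.2, p.1.2 - p.1.1.1.2.2)) p.2 := by
  have := (K.measurable_B₃ hK).comp measurable_relative_velocity
  exact this

lemma Kernel.measurable_gain₃_integrand (hf : Measurable (Function.uncurry f))
    (hg : Measurable (Function.uncurry g)) (hh : Measurable (Function.uncurry h)) :
    Measurable fun p : (((ℝ × Vec d × Vec d) × Vec d) × Vec d) × Sph2 d =>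
      K.B₃ (WithLp.toLp 2 (p.1.1.2 - p.1.1.1.2.2, p.1.2 - p.1.1.1.2.2)) p.2 *
        (f p.1.1.1.1 (p.1.1.1.2.1, star p.2 p.1.1.1.2.2 p.1.1.2 p.1.2) *
        g p.1.1.1.1 (p.1.1.1.2.1, star₁ p.2 p.1.1.1.2.2 p.1.1.2 p.1.2) *
        h p.1.1.1.1 (p.1.1.1.2.1, star₂ p.2 p.1.1.1.2.2 p.1.1.2 p.1.2)) := by
  have hp : Measurable fun p : (((ℝ × Vec d × Vec d) × Vec d) × Vec d) × Sph2 d =>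
      ((p.1.1.1.2.2, p.1.1.2, p.1.2), p.2) := by fun_prop
  refine (K.measurable_B₃_comp hK).mul ?_
  refine ((hf.comp (f := fun p : (((ℝ × Vec d × Vec d) × Vec d) × Vec d) × Sph2 d =>
    (p.1.1.1.1, (p.1.1.1.2.1, star p.2 p.1.1.1.2.2 p.1.1.2 p.1.2))) ?_).mul
    (hg.comp (f := fun p : (((ℝ × Vec d × Vec d) × Vec d) × Vec d) × Sph2 d =>
    (p.1.1.1.1, (p.1.1.1.2.1, star₁ p.2 p.1.1.1.2.2 p.1.1.2 p.1.2))) ?_)).mul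
    (hh.comp (f := fun p : (((ℝ × Vec d × Vec d) × Vec d) × Vec d) × Sph2 d =>
    (p.1.1.1.1, (p.1.1.1.2.1, star₂ p.2 p.1.1.1.2.2 p.1.1.2 p.1.2))) ?_)
  · exact Measurable.prodMk (by fun_prop) (Measurable.prodMk (by fun_prop)
      (measurable_star.comp hp))
  · exact Measurable.prodMk (by fun_prop) (Measurable.prodMk (by fun_prop)
      (measurable_star₁.comp hp))
  · exact Measurable.prodMk (by fun_prop) (Measurable.prodMk (by fun_prop)
      (measurable_star₂.comp hp))

lemma Kernel.measurable_loss₃_integrand (hf : Measurable (Function.uncurry f))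
    (hg : Measurable (Function.uncurry g)) (hh : Measurable (Function.uncurry h)) :
    Measurable fun p : (((ℝ × Vec d × Vec d) × Vec d) × Vec d) × Sph2 d =>
      K.B₃ (WithLp.toLp 2 (p.1.1.2 - p.1.1.1.2.2, p.1.2 - p.1.1.1.2.2)) p.2 *
        (f p.1.1.1.1 (p.1.1.1.2.1, p.1.1.1.2.2) *
        g p.1.1.1.1 (p.1.1.1.2.1, p.1.1.2) *
        h p.1.1.1.1 (p.1.1.1.2.1, p.1.2)) := by
  refine (K.measurable_B₃_comp hK).mul ?_
  exact ((hf.comp (by fun_prop : Measurable fun p :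
      (((ℝ × Vec d × Vec d) × Vec d) × Vec d) × Sph2 d =>
      (p.1.1.1.1, (p.1.1.1.2.1, p.1.1.1.2.2)))).mul
    (hg.comp (by fun_prop : Measurable fun p :
      (((ℝ × Vec d × Vec d) × Vec d) × Vec d) × Sph2 d =>
      (p.1.1.1.1, (p.1.1.1.2.1, p.1.1.2))))).mul
    (hh.comp (by fun_prop : Measurable fun p :
      (((ℝ × Vec d × Vec d) × Vec d) × Vec d) × Sph2 d =>
      (p.1.1.1.1, (p.1.1.1.2.1, p.1.2))))

lemma Kernel.measurable_G (hf : Measurable (Function.uncurry f))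
    (hg : Measurable (Function.uncurry g)) (hh : Measurable (Function.uncurry h)) :
    Measurable (Function.uncurry (K.G f g h)) :=
  (measurable_lintegral_two (K.measurable_gain₂_integrand hK hf hg)).add
    (measurable_lintegral_three (K.measurable_gain₃_integrand hK hf hg hh))

lemma Kernel.measurable_L (hf : Measurable (Function.uncurry f))
    (hg : Measurable (Function.uncurry g)) (hh : Measurable (Function.uncurry h)) :
    Measurable (Function.uncurry (K.L f g h)) :=
  (measurable_lintegral_two (K.measurable_loss₂_integrand hK hf hg)).add
    (measurable_lintegral_three (K.measurable_loss₃_integrand hK hf hg hh))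

omit hK in
lemma measurable_const_time {φ : Phase d} (hφ : Measurable φ) :
    Measurable (Function.uncurry fun _ : ℝ => φ) := hφ.comp measurable_snd

/-- The operators act at each time separately. Freezing the arguments at time `t` reduces the claim
to jointly measurable functions. -/
lemma Kernel.measurable_G_apply {t : ℝ} (hf : Measurable (f t)) (hg : Measurable (g t))
    (hh : Measurable (h t)) : Measurable (K.G f g h t) :=
  (K.measurable_G hK (measurable_const_time hf) (measurable_const_time hg)
    (measurable_const_time hh)).of_uncurry_left (x := t)

lemma Kernel.measurable_L_apply {t : ℝ} (hf : Measurable (f t)) (hg : Measurable (g t))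
    (hh : Measurable (h t)) : Measurable (K.L f g h t) :=
  (K.measurable_L hK (measurable_const_time hf) (measurable_const_time hg)
    (measurable_const_time hh)).of_uncurry_left (x := t)

omit hK

/-! ### The collision frequency -/

/-- The collision frequency, for which `L(f, g, g) = f R(g)`. -/
def Kernel.R (K : Kernel) (g : TimeFun d) : TimeFun d := fun t z => K.L (fun _ _ => 1) g g t z

lemma lintegral_lintegral_mul_const_mul {X Y : Type*} [MeasurableSpace X] [MeasurableSpace Y]
    {μ : Measure X} {ν : Measure Y} [SFinite ν] {B : X × Y → ℝ≥0∞} {G : X → ℝ≥0∞}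
    (hB : Measurable B) (hG : Measurable G) (c : ℝ≥0∞) :
    ∫⁻ x, ∫⁻ y, B (x, y) * (c * G x) ∂ν ∂μ = c * ∫⁻ x, ∫⁻ y, B (x, y) * (1 * G x) ∂ν ∂μ := by
  rw [← lintegral_const_mul _ (by fun_prop)]
  refine lintegral_congr fun x => ?_
  rw [← lintegral_const_mul _ (by fun_prop)]
  exact lintegral_congr fun y => by ring

lemma lintegral_lintegral_lintegral_mul_const_mul {X Y Z : Type*} [MeasurableSpace X]
    [MeasurableSpace Y] [MeasurableSpace Z] {μ : Measure X} {ν : Measure Y} {κ : Measure Z}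
    [SFinite ν] [SFinite κ] {B : X × (Y × Z) → ℝ≥0∞} {G : X → ℝ≥0∞} {H : Y → ℝ≥0∞}
    (hB : Measurable B) (hG : Measurable G) (hH : Measurable H) (c : ℝ≥0∞) :
    ∫⁻ x, ∫⁻ y, ∫⁻ w, B (x, (y, w)) * (c * G x * H y) ∂κ ∂ν ∂μ =
      c * ∫⁻ x, ∫⁻ y, ∫⁻ w, B (x, (y, w)) * (1 * G x * H y) ∂κ ∂ν ∂μ := by
  have h1 : Measurable fun p : (X × Y) × Z => B (p.1.1, (p.1.2, p.2)) * (1 * G p.1.1 * H p.1.2) := by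
    fun_prop
  have h2 : Measurable fun p : X × Y => ∫⁻ w, B (p.1, (p.2, w)) * (1 * G p.1 * H p.2) ∂κ :=
    h1.lintegral_prod_right'
  have h3 : Measurable fun x => ∫⁻ y, ∫⁻ w, B (x, (y, w)) * (1 * G x * H y) ∂κ ∂ν :=
    h2.lintegral_prod_right'
  rw [← lintegral_const_mul _ h3]
  refine lintegral_congr fun x => ?_
  rw [← lintegral_const_mul _ (by fun_prop)]
  refine lintegral_congr fun y => ?_
  rw [← lintegral_const_mul _ (by fun_prop)]
  exact lintegral_congr fun w => by ring

lemma measurable_relative_velocity_pair (v : Vec d) :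
    Measurable fun p : Vec d × (Vec d × Sph2 d) =>
      ((WithLp.toLp 2 (p.1 - v, p.2.1 - v) : Vec2 d), p.2.2) := by
  fun_prop

lemma Kernel.measurable_B₃_pair (hK : K.Admissible d) (v : Vec d) :
    Measurable fun p : Vec d × (Vec d × Sph2 d) =>
      K.B₃ (WithLp.toLp 2 (p.1 - v, p.2.1 - v)) p.2.2 := by
  have := (K.measurable_B₃ hK).comp (measurable_relative_velocity_pair v)
  exact this

lemma Kernel.measurable_B₂_pair (hK : K.Admissible d) (v : Vec d) :
    Measurable fun p : Vec d × Sph d => K.B₂ (p.1 - v) p.2 := by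
  have hp : Measurable fun p : Vec d × Sph d => (p.1 - v, p.2) := by fun_prop
  have := (K.measurable_B₂ hK).comp hp
  exact this

/-- The first factor of the loss term does not involve the integration variables. This is what turns
the linear problem into a scalar equation on each characteristic. -/
lemma Kernel.L_eq_mul_R (hK : K.Admissible d) (f : TimeFun d) {t : ℝ} (hg : Measurable (g t))
    (z : Vec d × Vec d) : K.L f g g t z = f t z * K.R g t z := by
  have hgz : Measurable fun v => g t (z.1, v) := hg.comp measurable_prodMk_left
  have m2 : Measurable fun p : Vec d × Sph d => K.B₂ (p.1 - z.2) p.2 :=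
    K.measurable_B₂_pair hK z.2
  have m3 : Measurable fun p : Vec d × (Vec d × Sph2 d) =>
      K.B₃ (WithLp.toLp 2 (p.1 - z.2, p.2.1 - z.2)) p.2.2 := K.measurable_B₃_pair hK z.2
  simp only [Kernel.R, Kernel.L, Kernel.L₂, Kernel.L₃, mul_add]
  congr 1
  · exact lintegral_lintegral_mul_const_mul m2 hgz (f t z)
  · exact lintegral_lintegral_lintegral_mul_const_mul (κ := surf2 d) m3 hgz hgz (f t z)

lemma Kernel.measurable_R (hK : K.Admissible d) (hg : Measurable (Function.uncurry g)) :
    Measurable (Function.uncurry (K.R g)) := K.measurable_L hK measurable_const hg hg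

/-! ### Transport of null sets by the collisions -/

/-- The image of a Haar measure under a surjective linear map is a multiple of Haar measure, so
preimages of null sets are null. -/
lemma quasiMeasurePreserving_of_surjective {E F : Type*} [NormedAddCommGroup E] [NormedSpace ℝ E]
    [MeasurableSpace E] [BorelSpace E] [FiniteDimensional ℝ E]
    [NormedAddCommGroup F] [NormedSpace ℝ F] [MeasurableSpace F] [BorelSpace F]
    [FiniteDimensional ℝ F] (L : E →ₗ[ℝ] F) (hL : Function.Surjective L)
    (μ : Measure E) (ν : Measure F) [μ.IsAddHaarMeasure] [ν.IsAddHaarMeasure] :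
    Measure.QuasiMeasurePreserving L μ ν := by
  refine ⟨L.continuous_of_finiteDimensional.measurable, ?_⟩
  obtain ⟨c, -, hc⟩ := L.exists_map_addHaar_eq_smul_addHaar μ ν hL
  rw [hc]
  exact Measure.smul_absolutelyContinuous

instance sFinite_phase : SFinite (volume : Measure (Vec d × Vec d)) := inferInstance

instance isAddHaarMeasure_three : ((volume : Measure (Vec d × Vec d)).prod
    (volume : Measure (Vec d))).IsAddHaarMeasure := inferInstance

instance sFinite_three : SFinite ((volume : Measure (Vec d × Vec d)).prod
    (volume : Measure (Vec d))) := inferInstance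

instance isAddHaarMeasure_four : (((volume : Measure (Vec d × Vec d)).prod
    (volume : Measure (Vec d))).prod (volume : Measure (Vec d))).IsAddHaarMeasure :=
  inferInstance

lemma ae_shear {P : Vec d × Vec d → Prop} (t : ℝ) (h : ∀ᵐ z : Vec d × Vec d, P z) :
    ∀ᵐ z : Vec d × Vec d, P (z.1 + t • z.2, z.2) := by
  let L : Vec d × Vec d →ₗ[ℝ] Vec d × Vec d :=
    (LinearMap.fst ℝ _ _ + t • LinearMap.snd ℝ _ _).prod (LinearMap.snd ℝ _ _)
  have hL : Function.Surjective L := fun z => ⟨(z.1 - t • z.2, z.2), by simp [L]⟩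
  exact (quasiMeasurePreserving_of_surjective L hL volume volume).ae h

lemma ae_second {P : Vec d × Vec d → Prop} (h : ∀ᵐ z : Vec d × Vec d, P z) :
    ∀ᵐ z : Vec d × Vec d, ∀ᵐ v₁ : Vec d, P (z.1, v₁) := by
  have h1 : ∀ᵐ x : Vec d, ∀ᵐ v₁ : Vec d, P (x, v₁) := Measure.ae_ae_of_ae_prod h
  exact Measure.quasiMeasurePreserving_fst.ae h1

/-- For fixed ω the map (x, v, v₁) ↦ (x, Ψ) is linear, and it is surjective because v₁ = v gives Ψ =
v. It thus pulls null sets back to null sets, and Fubini collects the directions ω. Through this the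
gain operators respect almost everywhere relations. -/
lemma ae_collision {P : Vec d × Vec d → Prop} (h : ∀ᵐ z : Vec d × Vec d, P z)
    (Ψ : Sph d → Vec d → Vec d → Vec d)
    (hm : Measurable fun p : (Vec d × Vec d) × Sph d => Ψ p.2 p.1.1 p.1.2)
    (hadd : ∀ ω v v' w w', Ψ ω (v + v') (w + w') = Ψ ω v w + Ψ ω v' w')
    (hsmul : ∀ ω (c : ℝ) v w, Ψ ω (c • v) (c • w) = c • Ψ ω v w) (hΨ : ∀ ω v, Ψ ω v v = v) :
    ∀ᵐ z : Vec d × Vec d, ∀ᵐ v₁ : Vec d, ∀ᵐ ω ∂(surf d), P (z.1, Ψ ω z.2 v₁) := by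
  have hq : Measure.QuasiMeasurePreserving
      (fun p : ((Vec d × Vec d) × Vec d) × Sph d => (p.1.1.1, Ψ p.2 p.1.1.2 p.1.2))
      (((volume : Measure (Vec d × Vec d)).prod volume).prod (surf d)) volume := by
    refine QuasiMeasurePreserving.prod_of_left ?_ (ae_of_all _ fun ω => ?_)
    · exact Measurable.prodMk (by fun_prop) (hm.comp
        (by fun_prop : Measurable fun p : ((Vec d × Vec d) × Vec d) × Sph d =>
          ((p.1.1.2, p.1.2), p.2)))
    · let L : (Vec d × Vec d) × Vec d →ₗ[ℝ] Vec d × Vec d :=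
        { toFun := fun p => (p.1.1, Ψ ω p.1.2 p.2)
          map_add' := fun p q => by simp [hadd]
          map_smul' := fun c p => by simp [hsmul] }
      exact quasiMeasurePreserving_of_surjective L (fun z => ⟨(z, z.2), by simp [L, hΨ]⟩) _ _
  have h1 := Measure.ae_ae_of_ae_prod (hq.ae h)
  exact Measure.ae_ae_of_ae_prod h1

/-- The argument of `ae_collision`, with surjectivity read off from v₁ = v₂ = v. -/
lemma ae_collision_ternary {P : Vec d × Vec d → Prop} (h : ∀ᵐ z : Vec d × Vec d, P z)
    (Ψ : Sph2 d → Vec d → Vec d → Vec d → Vec d)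
    (hm : Measurable fun p : (Vec d × Vec d × Vec d) × Sph2 d => Ψ p.2 p.1.1 p.1.2.1 p.1.2.2)
    (hadd : ∀ ω v v' w w' y y', Ψ ω (v + v') (w + w') (y + y') = Ψ ω v w y + Ψ ω v' w' y')
    (hsmul : ∀ ω (c : ℝ) v w y, Ψ ω (c • v) (c • w) (c • y) = c • Ψ ω v w y)
    (hΨ : ∀ ω v, Ψ ω v v v = v) :
    ∀ᵐ z : Vec d × Vec d, ∀ᵐ v₁ : Vec d, ∀ᵐ v₂ : Vec d, ∀ᵐ ω ∂(surf2 d),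
      P (z.1, Ψ ω z.2 v₁ v₂) := by
  have hq : Measure.QuasiMeasurePreserving
      (fun p : (((Vec d × Vec d) × Vec d) × Vec d) × Sph2 d =>
        (p.1.1.1.1, Ψ p.2 p.1.1.1.2 p.1.1.2 p.1.2))
      ((((volume : Measure (Vec d × Vec d)).prod volume).prod volume).prod (surf2 d)) volume := by
    refine QuasiMeasurePreserving.prod_of_left ?_ (ae_of_all _ fun ω => ?_)
    · exact Measurable.prodMk (by fun_prop) (hm.comp
        (by fun_prop : Measurable fun p : (((Vec d × Vec d) × Vec d) × Vec d) × Sph2 d =>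
          ((p.1.1.1.2, p.1.1.2, p.1.2), p.2)))
    · let L : ((Vec d × Vec d) × Vec d) × Vec d →ₗ[ℝ] Vec d × Vec d :=
        { toFun := fun p => (p.1.1.1, Ψ ω p.1.1.2 p.1.2 p.2)
          map_add' := fun p q => by simp [hadd]
          map_smul' := fun c p => by simp [hsmul] }
      exact quasiMeasurePreserving_of_surjective L (fun z => ⟨((z, z.2), z.2), by simp [L, hΨ]⟩)
        _ _
  have h1 := Measure.ae_ae_of_ae_prod (hq.ae h)
  have h2 := Measure.ae_ae_of_ae_prod h1
  exact Measure.ae_ae_of_ae_prod h2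

lemma ae_post {P : Vec d × Vec d → Prop} (h : ∀ᵐ z : Vec d × Vec d, P z) :
    ∀ᵐ z : Vec d × Vec d, ∀ᵐ v₁ : Vec d, ∀ᵐ ω ∂(surf d), P (z.1, post ω z.2 v₁) := by
  refine ae_collision h post measurable_post (fun ω v v' w w' => ?_) (fun ω c v w => ?_)
    (fun ω v => by simp [post])
  · simp only [post, inner_sub_right, inner_add_right]; module
  · simp only [post, inner_sub_right, inner_smul_right]; module

lemma ae_post₁ {P : Vec d × Vec d → Prop} (h : ∀ᵐ z : Vec d × Vec d, P z) :
    ∀ᵐ z : Vec d × Vec d, ∀ᵐ v₁ : Vec d, ∀ᵐ ω ∂(surf d), P (z.1, post₁ ω z.2 v₁) := by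
  refine ae_collision h post₁ measurable_post₁ (fun ω v v' w w' => ?_) (fun ω c v w => ?_)
    (fun ω v => by simp [post₁])
  · simp only [post₁, inner_sub_right, inner_add_right]; module
  · simp only [post₁, inner_sub_right, inner_smul_right]; module

lemma ternCoeff_add (ω : Sph2 d) (v v' w w' y y' : Vec d) :
    ternCoeff ω (v + v') (w + w') (y + y') = ternCoeff ω v w y + ternCoeff ω v' w' y' := by
  simp only [ternCoeff, inner_sub_right, inner_add_right]; ring

lemma ternCoeff_smul (ω : Sph2 d) (c : ℝ) (v w y : Vec d) :
    ternCoeff ω (c • v) (c • w) (c • y) = c * ternCoeff ω v w y := by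
  simp only [ternCoeff, inner_sub_right, inner_smul_right]; ring

lemma ae_star {P : Vec d × Vec d → Prop} (h : ∀ᵐ z : Vec d × Vec d, P z) :
    ∀ᵐ z : Vec d × Vec d, ∀ᵐ v₁ : Vec d, ∀ᵐ v₂ : Vec d, ∀ᵐ ω ∂(surf2 d),
      P (z.1, star ω z.2 v₁ v₂) := by
  refine ae_collision_ternary h star measurable_star (fun ω v v' w w' y y' => ?_)
    (fun ω c v w y => ?_) (fun ω v => by simp [star, ternCoeff])
  · simp only [star, ternCoeff_add]; module
  · simp only [star, ternCoeff_smul]; module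

lemma ae_star₁ {P : Vec d × Vec d → Prop} (h : ∀ᵐ z : Vec d × Vec d, P z) :
    ∀ᵐ z : Vec d × Vec d, ∀ᵐ v₁ : Vec d, ∀ᵐ v₂ : Vec d, ∀ᵐ ω ∂(surf2 d),
      P (z.1, star₁ ω z.2 v₁ v₂) := by
  refine ae_collision_ternary h star₁ measurable_star₁ (fun ω v v' w w' y y' => ?_)
    (fun ω c v w y => ?_) (fun ω v => by simp [star₁, ternCoeff])
  · simp only [star₁, ternCoeff_add]; module
  · simp only [star₁, ternCoeff_smul]; module

lemma ae_star₂ {P : Vec d × Vec d → Prop} (h : ∀ᵐ z : Vec d × Vec d, P z) :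
    ∀ᵐ z : Vec d × Vec d, ∀ᵐ v₁ : Vec d, ∀ᵐ v₂ : Vec d, ∀ᵐ ω ∂(surf2 d),
      P (z.1, star₂ ω z.2 v₁ v₂) := by
  refine ae_collision_ternary h star₂ measurable_star₂ (fun ω v v' w w' y y' => ?_)
    (fun ω c v w y => ?_) (fun ω v => by simp [star₂, ternCoeff])
  · simp only [star₂, ternCoeff_add]; module
  · simp only [star₂, ternCoeff_smul]; module

end Operators

end

end BinaryTernary

namespace BinaryTernary

noncomputable section

section Comparison

variable {d : ℕ}

/-! ### Conservation laws -/

lemma norm_sphere (ω : Sph d) : ‖(ω : Vec d)‖ = 1 := mem_sphere_zero_iff_norm.1 ω.2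

lemma norm_sphere_two (ω : Sph2 d) : ‖(ω : Vec2 d).fst‖ ^ 2 + ‖(ω : Vec2 d).snd‖ ^ 2 = 1 := by
  rw [← WithLp.prod_norm_sq_eq_of_L2, mem_sphere_zero_iff_norm.1 ω.2, one_pow]

lemma post_add_post₁ (ω : Sph d) (v v₁ : Vec d) : post ω v v₁ + post₁ ω v v₁ = v + v₁ := by
  simp only [post, post₁]; abel

lemma norm_post_sq (ω : Sph d) (v v₁ : Vec d) :
    ‖post ω v v₁‖ ^ 2 + ‖post₁ ω v v₁‖ ^ 2 = ‖v‖ ^ 2 + ‖v₁‖ ^ 2 := by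
  simp only [post, post₁, norm_add_sq_real, norm_sub_sq_real, norm_smul, mul_pow, norm_sphere,
    inner_smul_right, Real.norm_eq_abs, sq_abs, inner_sub_right,
    real_inner_comm (ω : Vec d) v, real_inner_comm (ω : Vec d) v₁]
  ring

lemma star_add (ω : Sph2 d) (v v₁ v₂ : Vec d) :
    star ω v v₁ v₂ + star₁ ω v v₁ v₂ + star₂ ω v v₁ v₂ = v + v₁ + v₂ := by
  simp only [star, star₁, star₂, smul_add]; abel

/-- From |ω₁ + ω₂|² = 1 + 2 ω₁·ω₂ ≥ 0 follows ω₁·ω₂ ≥ -1/2, so the denominator of `ternCoeff` is at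
least 1/2. -/
lemma one_add_inner_pos (ω : Sph2 d) : 0 < 1 + ⟪(ω : Vec2 d).fst, (ω : Vec2 d).snd⟫ := by
  have h1 := norm_sphere_two ω
  have h2 := norm_add_sq_real (ω : Vec2 d).fst (ω : Vec2 d).snd
  nlinarith [sq_nonneg ‖(ω : Vec2 d).fst + (ω : Vec2 d).snd‖]

/-- On the sphere |ω₁ + ω₂|² + |ω₁|² + |ω₂|² = 2(1 + ω₁·ω₂). The energy therefore changes by 2c²(1 +
ω₁·ω₂) - 2c(ω₁·(v₁ - v) + ω₂·(v₂ - v)), and `ternCoeff` is the value of c that makes this zero. -/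
lemma norm_star_sq (ω : Sph2 d) (v v₁ v₂ : Vec d) :
    ‖star ω v v₁ v₂‖ ^ 2 + ‖star₁ ω v v₁ v₂‖ ^ 2 + ‖star₂ ω v v₁ v₂‖ ^ 2 =
      ‖v‖ ^ 2 + ‖v₁‖ ^ 2 + ‖v₂‖ ^ 2 := by
  have h1 := norm_sphere_two ω
  have h2 := one_add_inner_pos ω
  have hc : ternCoeff ω v v₁ v₂ * (1 + ⟪(ω : Vec2 d).fst, (ω : Vec2 d).snd⟫) =
      ⟪(ω : Vec2 d).fst, v₁ - v⟫ + ⟪(ω : Vec2 d).snd, v₂ - v⟫ := div_mul_cancel₀ _ h2.ne'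
  rw [inner_sub_right, inner_sub_right, real_inner_comm v, real_inner_comm v, real_inner_comm v₁,
    real_inner_comm v₂] at hc
  simp only [star, star₁, star₂]
  generalize ternCoeff ω v v₁ v₂ = c at *
  simp only [norm_add_sq_real, norm_sub_sq_real, norm_smul, mul_pow,
    inner_smul_right, Real.norm_eq_abs, sq_abs, inner_add_right]
  linear_combination c ^ 2 * 2 * h1 + 2 * c * hc - c ^ 2 * h1 + c ^ 2 * h1

/-! ### Transported Maxwellians -/

/-- The transported Maxwellian, for which `W^# = M_{α,β}` at all times. -/
def transMax (d : ℕ) (α β : ℝ) : TimeFun d := ofStationarySharp (maxwellian α β)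

lemma measurable_maxwellian (α β : ℝ) : Measurable (maxwellian α β : Phase d) := by
  unfold maxwellian; fun_prop

lemma measurable_ofStationarySharp {φ : Phase d} (hφ : Measurable φ) :
    Measurable (Function.uncurry (ofStationarySharp φ)) := by
  have hp : Measurable fun p : ℝ × Vec d × Vec d => (p.2.1 - p.1 • p.2.2, p.2.2) := by fun_prop
  exact hφ.comp hp

lemma measurable_transMax (α β : ℝ) : Measurable (Function.uncurry (transMax d α β)) :=
  measurable_ofStationarySharp (measurable_maxwellian α β)

lemma sharp_ofStationarySharp (φ : Phase d) (t : ℝ) : sharp (ofStationarySharp φ) t = φ := by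
  funext z; simp [sharp, ofStationarySharp]

lemma sharp_transMax (α β : ℝ) (t : ℝ) : sharp (transMax d α β) t = maxwellian α β :=
  sharp_ofStationarySharp _ _

lemma maxwellian_pos (α β : ℝ) (z : Vec d × Vec d) : maxwellian α β z ≠ 0 := by
  simp [maxwellian, Real.exp_pos]

lemma maxwellian_ne_top (α β : ℝ) (z : Vec d × Vec d) : maxwellian α β z ≠ ∞ :=
  ENNReal.ofReal_ne_top

lemma transMax_eq (α β t : ℝ) (x p : Vec d) : transMax d α β t (x, p) = ENNReal.ofReal
    (Real.exp (-α * (‖x‖ ^ 2 - 2 * t * ⟪x, p⟫ + t ^ 2 * ‖p‖ ^ 2) - β * ‖p‖ ^ 2)) := by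
  simp only [transMax, ofStationarySharp, maxwellian]
  rw [norm_sub_sq_real, norm_smul, inner_smul_right, mul_pow, Real.norm_eq_abs, sq_abs, ← mul_assoc]

/-- By `transMax_eq`, log W(t, x, p) = -α|x|² + 2αt x·p - (αt² + β)|p|². A product of values of W
depends on the velocities only through total momentum and total energy. -/
lemma transMax_mul_eq {α β t : ℝ} {x p q p' q' : Vec d} (h : p + q = p' + q')
    (h2 : ‖p‖ ^ 2 + ‖q‖ ^ 2 = ‖p'‖ ^ 2 + ‖q'‖ ^ 2) :
    transMax d α β t (x, p) * transMax d α β t (x, q) =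
      transMax d α β t (x, p') * transMax d α β t (x, q') := by
  have h3 : ⟪x, p⟫ + ⟪x, q⟫ = ⟪x, p'⟫ + ⟪x, q'⟫ := by rw [← inner_add_right, h, inner_add_right]
  simp only [transMax_eq]
  rw [← ENNReal.ofReal_mul (Real.exp_nonneg _), ← ENNReal.ofReal_mul (Real.exp_nonneg _),
    ← Real.exp_add, ← Real.exp_add]
  congr 2
  linear_combination 2 * α * t * h3 + (-α * t ^ 2 - β) * h2

lemma transMax_mul_mul_eq {α β t : ℝ} {x p q r p' q' r' : Vec d} (h : p + q + r = p' + q' + r')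
    (h2 : ‖p‖ ^ 2 + ‖q‖ ^ 2 + ‖r‖ ^ 2 = ‖p'‖ ^ 2 + ‖q'‖ ^ 2 + ‖r'‖ ^ 2) :
    transMax d α β t (x, p) * transMax d α β t (x, q) * transMax d α β t (x, r) =
      transMax d α β t (x, p') * transMax d α β t (x, q') * transMax d α β t (x, r') := by
  have h3 : ⟪x, p⟫ + ⟪x, q⟫ + ⟪x, r⟫ = ⟪x, p'⟫ + ⟪x, q'⟫ + ⟪x, r'⟫ := by
    rw [← inner_add_right, ← inner_add_right, h, inner_add_right, inner_add_right]
  simp only [transMax_eq]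
  rw [← ENNReal.ofReal_mul (Real.exp_nonneg _), ← ENNReal.ofReal_mul (Real.exp_nonneg _),
    ← ENNReal.ofReal_mul (by positivity), ← ENNReal.ofReal_mul (by positivity),
    ← Real.exp_add, ← Real.exp_add, ← Real.exp_add, ← Real.exp_add]
  congr 2
  linear_combination 2 * α * t * h3 + (-α * t ^ 2 - β) * h2

lemma transMax_post (α β t : ℝ) (x v v₁ : Vec d) (ω : Sph d) :
    transMax d α β t (x, post ω v v₁) * transMax d α β t (x, post₁ ω v v₁) =
      transMax d α β t (x, v) * transMax d α β t (x, v₁) :=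
  transMax_mul_eq (post_add_post₁ ω v v₁) (norm_post_sq ω v v₁)

lemma transMax_star (α β t : ℝ) (x v v₁ v₂ : Vec d) (ω : Sph2 d) :
    transMax d α β t (x, star ω v v₁ v₂) * transMax d α β t (x, star₁ ω v v₁ v₂) *
      transMax d α β t (x, star₂ ω v v₁ v₂) =
      transMax d α β t (x, v) * transMax d α β t (x, v₁) * transMax d α β t (x, v₂) :=
  transMax_mul_mul_eq (star_add ω v v₁ v₂) (norm_star_sq ω v v₁ v₂)

/-- The collision term of the transported Maxwellian; gain and loss coincide. -/
def Kernel.Q (K : Kernel) (d : ℕ) (α β : ℝ) : TimeFun d :=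
  K.L (transMax d α β) (transMax d α β) (transMax d α β)

/-! ### Monotonicity and comparison -/

variable {K : Kernel} {f₁ f₂ f₃ g₁ g₂ g₃ : TimeFun d} {t : ℝ}

lemma Kernel.L_mono (h₁ : f₁ t ≤ᵐ[volume] g₁ t) (h₂ : f₂ t ≤ᵐ[volume] g₂ t)
    (h₃ : f₃ t ≤ᵐ[volume] g₃ t) : K.L f₁ f₂ f₃ t ≤ᵐ[volume] K.L g₁ g₂ g₃ t := by
  filter_upwards [h₁, ae_second h₂, ae_second h₃] with z hz h2 h3
  refine add_le_add ?_ ?_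
  · refine lintegral_mono_ae ?_
    filter_upwards [h2] with v₁ hv₁
    exact lintegral_mono fun ω => by gcongr
  · refine lintegral_mono_ae ?_
    filter_upwards [h2] with v₁ hv₁
    refine lintegral_mono_ae ?_
    filter_upwards [h3] with v₂ hv₂
    exact lintegral_mono fun ω => by gcongr

lemma Kernel.G_mono (h₁ : f₁ t ≤ᵐ[volume] g₁ t) (h₂ : f₂ t ≤ᵐ[volume] g₂ t)
    (h₃ : f₃ t ≤ᵐ[volume] g₃ t) : K.G f₁ f₂ f₃ t ≤ᵐ[volume] K.G g₁ g₂ g₃ t := by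
  filter_upwards [ae_post h₁, ae_post₁ h₂, ae_star h₁, ae_star₁ h₂, ae_star₂ h₃] with
    z a1 a2 b1 b2 b3
  refine add_le_add ?_ ?_
  · refine lintegral_mono_ae ?_
    filter_upwards [a1, a2] with v₁ a1 a2
    refine lintegral_mono_ae ?_
    filter_upwards [a1, a2] with ω a1 a2
    gcongr
  · refine lintegral_mono_ae ?_
    filter_upwards [b1, b2, b3] with v₁ b1 b2 b3
    refine lintegral_mono_ae ?_
    filter_upwards [b1, b2, b3] with v₂ b1 b2 b3
    refine lintegral_mono_ae ?_
    filter_upwards [b1, b2, b3] with ω b1 b2 b3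
    gcongr

lemma Kernel.L_congr (h₁ : f₁ t =ᵐ[volume] g₁ t) (h₂ : f₂ t =ᵐ[volume] g₂ t)
    (h₃ : f₃ t =ᵐ[volume] g₃ t) : K.L f₁ f₂ f₃ t =ᵐ[volume] K.L g₁ g₂ g₃ t :=
  (K.L_mono h₁.le h₂.le h₃.le).antisymm (K.L_mono h₁.symm.le h₂.symm.le h₃.symm.le)

lemma Kernel.G_congr (h₁ : f₁ t =ᵐ[volume] g₁ t) (h₂ : f₂ t =ᵐ[volume] g₂ t)
    (h₃ : f₃ t =ᵐ[volume] g₃ t) : K.G f₁ f₂ f₃ t =ᵐ[volume] K.G g₁ g₂ g₃ t :=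
  (K.G_mono h₁.le h₂.le h₃.le).antisymm (K.G_mono h₁.symm.le h₂.symm.le h₃.symm.le)

/-- One factor is replaced at a time: a₁a₂ → b₁a₂ → b₁b₂. This order explains why only `a₂` and `b₁`
need the a priori bound by `m`. -/
lemma mul_le_mul_add_of_le_add {a₁ a₂ b₁ b₂ w₁ w₂ m e : ℝ≥0∞} (h₁ : a₁ ≤ b₁ + e * w₁)
    (h₂ : a₂ ≤ b₂ + e * w₂) (h₂' : a₂ ≤ m * w₂) (h₁' : b₁ ≤ m * w₁) :
    a₁ * a₂ ≤ b₁ * b₂ + e * (2 * m) * (w₁ * w₂) := by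
  calc a₁ * a₂ ≤ (b₁ + e * w₁) * a₂ := by gcongr
    _ = b₁ * a₂ + e * w₁ * a₂ := add_mul _ _ _
    _ ≤ b₁ * (b₂ + e * w₂) + e * w₁ * (m * w₂) := by gcongr
    _ = b₁ * b₂ + (b₁ * (e * w₂) + e * w₁ * (m * w₂)) := by ring
    _ ≤ b₁ * b₂ + (m * w₁ * (e * w₂) + e * w₁ * (m * w₂)) := by gcongr
    _ = _ := by ring

lemma mul_mul_le_mul_mul_add_of_le_add {a₁ a₂ a₃ b₁ b₂ b₃ w₁ w₂ w₃ m e : ℝ≥0∞}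
    (h₁ : a₁ ≤ b₁ + e * w₁) (h₂ : a₂ ≤ b₂ + e * w₂) (h₃ : a₃ ≤ b₃ + e * w₃)
    (h₂' : a₂ ≤ m * w₂) (h₃' : a₃ ≤ m * w₃) (k₁ : b₁ ≤ m * w₁) (k₂ : b₂ ≤ m * w₂) :
    a₁ * a₂ * a₃ ≤ b₁ * b₂ * b₃ + e * (3 * m ^ 2) * (w₁ * w₂ * w₃) := by
  calc a₁ * a₂ * a₃ ≤ (b₁ * b₂ + e * (2 * m) * (w₁ * w₂)) * a₃ := by
        gcongr; exact mul_le_mul_add_of_le_add h₁ h₂ h₂' k₁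
    _ = b₁ * b₂ * a₃ + e * (2 * m) * (w₁ * w₂) * a₃ := add_mul _ _ _
    _ ≤ b₁ * b₂ * (b₃ + e * w₃) + e * (2 * m) * (w₁ * w₂) * (m * w₃) := by gcongr
    _ = b₁ * b₂ * b₃ + (b₁ * b₂ * (e * w₃) + e * (2 * m) * (w₁ * w₂) * (m * w₃)) := by ring
    _ ≤ b₁ * b₂ * b₃ + (m * w₁ * (m * w₂) * (e * w₃) + e * (2 * m) * (w₁ * w₂) * (m * w₃)) := by
        gcongr
    _ = _ := by ring

/-- Additivity of the lower integral needs measurability of one summand only. It is asked of the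
error term `B * C`, never of `F` or `A`. -/
lemma lintegral_two_le_of_le_add {X Y : Type*} [MeasurableSpace X] [MeasurableSpace Y]
    {μ : Measure X} {ν : Measure Y} [SFinite ν] {B F A C : X → Y → ℝ≥0∞} (c : ℝ≥0∞)
    (hC : Measurable fun p : X × Y => B p.1 p.2 * C p.1 p.2)
    (h : ∀ᵐ x ∂μ, ∀ᵐ y ∂ν, F x y ≤ A x y + c * C x y) :
    ∫⁻ x, ∫⁻ y, B x y * F x y ∂ν ∂μ ≤
      (∫⁻ x, ∫⁻ y, B x y * A x y ∂ν ∂μ) + c * ∫⁻ x, ∫⁻ y, B x y * C x y ∂ν ∂μ := by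
  have h1 : Measurable fun x => ∫⁻ y, B x y * C x y ∂ν := hC.lintegral_prod_right'
  have h2 : ∀ x, Measurable fun y => B x y * C x y := fun x => hC.comp measurable_prodMk_left
  rw [← lintegral_const_mul _ h1, ← lintegral_add_right _ (h1.const_mul c)]
  refine lintegral_mono_ae ?_
  filter_upwards [h] with x hx
  rw [← lintegral_const_mul _ (h2 x), ← lintegral_add_right _ ((h2 x).const_mul c)]
  refine lintegral_mono_ae ?_
  filter_upwards [hx] with y hy
  calc B x y * F x y ≤ B x y * (A x y + c * C x y) := by gcongr
    _ = _ := by ring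

lemma lintegral_three_le_of_le_add {X Y Z : Type*} [MeasurableSpace X] [MeasurableSpace Y]
    [MeasurableSpace Z] {μ : Measure X} {ν : Measure Y} {κ : Measure Z} [SFinite ν] [SFinite κ]
    {B F A C : X → Y → Z → ℝ≥0∞} (c : ℝ≥0∞)
    (hC : Measurable fun p : (X × Y) × Z => B p.1.1 p.1.2 p.2 * C p.1.1 p.1.2 p.2)
    (h : ∀ᵐ x ∂μ, ∀ᵐ y ∂ν, ∀ᵐ w ∂κ, F x y w ≤ A x y w + c * C x y w) :
    ∫⁻ x, ∫⁻ y, ∫⁻ w, B x y w * F x y w ∂κ ∂ν ∂μ ≤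
      (∫⁻ x, ∫⁻ y, ∫⁻ w, B x y w * A x y w ∂κ ∂ν ∂μ) +
        c * ∫⁻ x, ∫⁻ y, ∫⁻ w, B x y w * C x y w ∂κ ∂ν ∂μ := by
  have h0 : Measurable fun p : X × Y => ∫⁻ w, B p.1 p.2 w * C p.1 p.2 w ∂κ :=
    hC.lintegral_prod_right'
  have h1 : Measurable fun x => ∫⁻ y, ∫⁻ w, B x y w * C x y w ∂κ ∂ν := h0.lintegral_prod_right'
  rw [← lintegral_const_mul _ h1, ← lintegral_add_right _ (h1.const_mul c)]
  refine lintegral_mono_ae ?_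
  filter_upwards [h] with x hx
  have hm : Measurable fun p : Y × Z => ((x, p.1), p.2) := by fun_prop
  exact lintegral_two_le_of_le_add c (hC.comp hm) hx

lemma measurable_fix_two (t : ℝ) (z : Vec d × Vec d) :
    Measurable fun p : Vec d × Sph d => (((t, z), p.1), p.2) := by fun_prop

lemma measurable_fix_three (t : ℝ) (z : Vec d × Vec d) :
    Measurable fun p : (Vec d × Vec d) × Sph2 d => ((((t, z), p.1.1), p.1.2), p.2) := by fun_prop

variable {α β : ℝ} {m e : ℝ≥0∞}

/-- The Lipschitz estimate for the loss operator on a ball of `M_{α,β}`. -/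
lemma Kernel.L_le_add (hK : K.Admissible d)
    (h₁ : f₁ t ≤ᵐ[volume] fun z => g₁ t z + e * transMax d α β t z)
    (h₂ : f₂ t ≤ᵐ[volume] fun z => g₂ t z + e * transMax d α β t z)
    (h₃ : f₃ t ≤ᵐ[volume] fun z => g₃ t z + e * transMax d α β t z)
    (b₂ : f₂ t ≤ᵐ[volume] fun z => m * transMax d α β t z)
    (b₃ : f₃ t ≤ᵐ[volume] fun z => m * transMax d α β t z)
    (k₁ : g₁ t ≤ᵐ[volume] fun z => m * transMax d α β t z)
    (k₂ : g₂ t ≤ᵐ[volume] fun z => m * transMax d α β t z) :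
    K.L f₁ f₂ f₃ t ≤ᵐ[volume] fun z =>
      K.L g₁ g₂ g₃ t z + e * (2 * m + 3 * m ^ 2) * K.Q d α β t z := by
  have hW := measurable_transMax (d := d) α β
  filter_upwards [h₁, k₁, ae_second h₂, ae_second b₂, ae_second k₂, ae_second h₃, ae_second b₃]
    with z h1 k1 h2 b2 k2 h3 b3
  have m2 := (K.measurable_loss₂_integrand hK hW hW).comp (measurable_fix_two t z)
  have m3 := (K.measurable_loss₃_integrand hK hW hW hW).comp (measurable_fix_three t z)
  have e2 : K.L₂ f₁ f₂ t z ≤ K.L₂ g₁ g₂ t z +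
      e * (2 * m) * K.L₂ (transMax d α β) (transMax d α β) t z := by
    refine lintegral_two_le_of_le_add (e * (2 * m)) m2 ?_
    filter_upwards [h2, b2] with v₁ h2 b2
    exact ae_of_all _ fun ω => mul_le_mul_add_of_le_add h1 h2 b2 k1
  have e3 : K.L₃ f₁ f₂ f₃ t z ≤ K.L₃ g₁ g₂ g₃ t z +
      e * (3 * m ^ 2) * K.L₃ (transMax d α β) (transMax d α β) (transMax d α β) t z := by
    refine lintegral_three_le_of_le_add (e * (3 * m ^ 2)) m3 ?_
    filter_upwards [h2, b2, k2] with v₁ h2 b2 k2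
    filter_upwards [h3, b3] with v₂ h3 b3
    exact ae_of_all _ fun ω => mul_mul_le_mul_mul_add_of_le_add h1 h2 h3 b2 b3 k1 k2
  refine (add_le_add e2 e3).trans ?_
  simp only [Kernel.Q, Kernel.L, mul_add, add_mul]
  rw [add_add_add_comm]
  gcongr
  · exact le_self_add
  · exact le_add_self

/-- The Lipschitz estimate for the gain operator on a ball of `M_{α,β}`. -/
lemma Kernel.G_le_add (hK : K.Admissible d)
    (h₁ : f₁ t ≤ᵐ[volume] fun z => g₁ t z + e * transMax d α β t z)
    (h₂ : f₂ t ≤ᵐ[volume] fun z => g₂ t z + e * transMax d α β t z)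
    (h₃ : f₃ t ≤ᵐ[volume] fun z => g₃ t z + e * transMax d α β t z)
    (b₂ : f₂ t ≤ᵐ[volume] fun z => m * transMax d α β t z)
    (b₃ : f₃ t ≤ᵐ[volume] fun z => m * transMax d α β t z)
    (k₁ : g₁ t ≤ᵐ[volume] fun z => m * transMax d α β t z)
    (k₂ : g₂ t ≤ᵐ[volume] fun z => m * transMax d α β t z) :
    K.G f₁ f₂ f₃ t ≤ᵐ[volume] fun z =>
      K.G g₁ g₂ g₃ t z + e * (2 * m + 3 * m ^ 2) * K.Q d α β t z := by
  have hW := measurable_transMax (d := d) α β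
  filter_upwards [ae_post h₁, ae_post k₁, ae_post₁ h₂, ae_post₁ b₂, ae_star h₁, ae_star k₁,
    ae_star₁ h₂, ae_star₁ b₂, ae_star₁ k₂, ae_star₂ h₃, ae_star₂ b₃]
    with z p1 q1 p2 q2 s1 s1' s2 s2' s2'' s3 s3'
  have m2 := (K.measurable_loss₂_integrand hK hW hW).comp (measurable_fix_two t z)
  have m3 := (K.measurable_loss₃_integrand hK hW hW hW).comp (measurable_fix_three t z)
  have e2 : K.G₂ f₁ f₂ t z ≤ K.G₂ g₁ g₂ t z +
      e * (2 * m) * K.L₂ (transMax d α β) (transMax d α β) t z := by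
    refine lintegral_two_le_of_le_add (e * (2 * m)) m2 ?_
    filter_upwards [p1, q1, p2, q2] with v₁ p1 q1 p2 q2
    filter_upwards [p1, q1, p2, q2] with ω p1 q1 p2 q2
    have := mul_le_mul_add_of_le_add p1 p2 q2 q1
    -- The error carries W at the outgoing velocities. Conservation moves it to the incoming ones,
    -- so the error of the gain is measured by the loss of W.
    rwa [transMax_post] at this
  have e3 : K.G₃ f₁ f₂ f₃ t z ≤ K.G₃ g₁ g₂ g₃ t z +
      e * (3 * m ^ 2) * K.L₃ (transMax d α β) (transMax d α β) (transMax d α β) t z := by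
    refine lintegral_three_le_of_le_add (e * (3 * m ^ 2)) m3 ?_
    filter_upwards [s1, s1', s2, s2', s2'', s3, s3'] with v₁ s1 s1' s2 s2' s2'' s3 s3'
    filter_upwards [s1, s1', s2, s2', s2'', s3, s3'] with v₂ s1 s1' s2 s2' s2'' s3 s3'
    filter_upwards [s1, s1', s2, s2', s2'', s3, s3'] with ω s1 s1' s2 s2' s2'' s3 s3'
    have := mul_mul_le_mul_mul_add_of_le_add s1 s2 s3 s2' s3' s1' s2''
    rwa [transMax_star] at this
  refine (add_le_add e2 e3).trans ?_
  simp only [Kernel.Q, Kernel.L, Kernel.G, mul_add, add_mul]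
  rw [add_add_add_comm]
  gcongr
  · exact le_self_add
  · exact le_add_self

end Comparison

end

end BinaryTernary

namespace BinaryTernary

noncomputable section

/-! ### Gaussian and power integrals in Euclidean spaces -/

section Euclid

variable {E : Type*} [NormedAddCommGroup E] [InnerProductSpace ℝ E] [FiniteDimensional ℝ E]
  [MeasurableSpace E] [BorelSpace E]

open Module in
/-- The surface area of the unit sphere. -/
def sphereArea (E : Type*) [NormedAddCommGroup E] [InnerProductSpace ℝ E] [FiniteDimensional ℝ E]
    [MeasurableSpace E] [BorelSpace E] : ℝ :=
  finrank ℝ E * (volume : Measure E).real (Metric.ball 0 1)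

lemma sphereArea_nonneg : 0 ≤ sphereArea E := by unfold sphereArea; positivity

/-- In polar coordinates this is the integral of r^{n-1+s} over (0, 1), which converges because n +
s > 0. -/
lemma lintegral_ball_rpow_norm [Nontrivial E] {s : ℝ} (hs : -(Module.finrank ℝ E : ℝ) < s) :
    ∫⁻ u in Metric.ball (0 : E) 1, ENNReal.ofReal (‖u‖ ^ s) =
      ENNReal.ofReal (sphereArea E / (Module.finrank ℝ E + s)) := by
  set n := Module.finrank ℝ E with hn
  have hn0 : 0 < n := Module.finrank_pos
  have hcast : ((n - 1 : ℕ) : ℝ) = n - 1 := by rw [Nat.cast_sub hn0, Nat.cast_one]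
  have hpow : ∀ y ∈ Ioo (0 : ℝ) 1, y ^ (n - 1) * y ^ s = y ^ ((n : ℝ) - 1 + s) := fun y hy => by
    rw [← Real.rpow_natCast, hcast, ← Real.rpow_add hy.1]
  have hint : IntegrableOn (fun u : E => ‖u‖ ^ s) (Metric.ball 0 1) := by
    rw [integrableOn_fun_norm_addHaar volume (f := fun r => r ^ s)]
    simp only [smul_eq_mul]
    rw [← hn, integrableOn_congr_fun (g := fun y => y ^ ((n : ℝ) - 1 + s)) hpow measurableSet_Ioo,
      intervalIntegral.integrableOn_Ioo_rpow_iff zero_lt_one]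
    linarith
  rw [← ofReal_integral_eq_lintegral_ofReal hint (ae_of_all _ fun u => by positivity)]
  congr 1
  have e1 : ∫ u in Metric.ball (0 : E) 1, ‖u‖ ^ s =
      ∫ u : E, (Iio (1 : ℝ)).indicator (fun r => r ^ s) ‖u‖ := by
    rw [← integral_indicator measurableSet_ball]
    refine integral_congr_ae (ae_of_all _ fun u => ?_)
    simp [indicator]
  have e2 : ∫ y in Ioi (0 : ℝ), y ^ (n - 1) • (Iio (1 : ℝ)).indicator (fun r => r ^ s) y =
      ∫ y in (0 : ℝ)..1, y ^ ((n : ℝ) - 1 + s) := by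
    have : ∀ y : ℝ, y ^ (n - 1) • (Iio (1 : ℝ)).indicator (fun r => r ^ s) y =
        (Iio (1 : ℝ)).indicator (fun y => y ^ (n - 1) * y ^ s) y := fun y => by
      by_cases h : y < 1 <;> simp [h]
    simp_rw [this]
    rw [setIntegral_indicator measurableSet_Iio, Ioi_inter_Iio,
      setIntegral_congr_fun measurableSet_Ioo hpow, intervalIntegral.integral_of_le zero_le_one,
      integral_Ioc_eq_integral_Ioo]
  rw [e1, integral_fun_norm_addHaar, ← hn, e2, integral_rpow (Or.inl (by linarith))]
  rw [Real.zero_rpow (by linarith), Real.one_rpow, nsmul_eq_mul, smul_eq_mul, sphereArea, ← hn]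
  have : (n : ℝ) - 1 + s + 1 = n + s := by ring
  rw [this]; ring

lemma lintegral_gaussian {b : ℝ} (hb : 0 < b) :
    ∫⁻ w : E, ENNReal.ofReal (Real.exp (-b * ‖w‖ ^ 2)) =
      ENNReal.ofReal ((Real.pi / b) ^ (Module.finrank ℝ E / 2 : ℝ)) := by
  rw [← GaussianFourier.integral_rexp_neg_mul_sq_norm hb, ofReal_integral_eq_lintegral_ofReal]
  -- Integrability comes for free: a non-integrable function would have Bochner integral 0, while
  -- the known value is positive.
  · by_contra h
    have h1 := GaussianFourier.integral_rexp_neg_mul_sq_norm (V := E) hb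
    rw [integral_undef h] at h1
    have : 0 < (Real.pi / b) ^ (Module.finrank ℝ E / 2 : ℝ) := by positivity
    linarith
  · exact ae_of_all _ fun u => by positivity

/-- Within distance 1 of `p` the Gaussian is bounded by 1, and the power alone is integrated.
Farther away the power is at most 1 because s ≤ 0, and the Gaussian alone is integrated. The bound
does not depend on `p`. -/
lemma lintegral_rpow_mul_gaussian_le [Nontrivial E] {s b : ℝ}
    (hs : -(Module.finrank ℝ E : ℝ) < s) (hs0 : s ≤ 0) (hb : 0 < b) (p : E) :
    ∫⁻ w : E, ENNReal.ofReal (‖w - p‖ ^ s * Real.exp (-b * ‖w‖ ^ 2)) ≤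
      ENNReal.ofReal (sphereArea E / (Module.finrank ℝ E + s) +
        (Real.pi / b) ^ (Module.finrank ℝ E / 2 : ℝ)) := by
  have hA := sphereArea_nonneg (E := E)
  have hm : Measurable fun u : E => ENNReal.ofReal (‖u‖ ^ s) := by fun_prop
  rw [ENNReal.ofReal_add (div_nonneg hA (by linarith)) (by positivity), ← lintegral_gaussian hb,
    ← lintegral_ball_rpow_norm hs, ← lintegral_indicator measurableSet_ball,
    ← lintegral_sub_right_eq_self ((Metric.ball (0 : E) 1).indicator
      fun u => ENNReal.ofReal (‖u‖ ^ s)) p, ← lintegral_add_right _ (by fun_prop)]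
  refine lintegral_mono fun w => ?_
  by_cases hw : ‖w - p‖ < 1
  · refine le_add_right ?_
    rw [indicator_of_mem (by simpa using hw)]
    refine ENNReal.ofReal_le_ofReal (mul_le_of_le_one_right (Real.rpow_nonneg (norm_nonneg _) _) ?_)
    exact Real.exp_le_one_iff.2 (by nlinarith [sq_nonneg ‖w‖])
  · refine le_add_left (ENNReal.ofReal_le_ofReal (mul_le_of_le_one_left (Real.exp_nonneg _) ?_))
    exact Real.rpow_le_one_of_one_le_of_nonpos (not_lt.1 hw) hs0

omit [FiniteDimensional ℝ E] [MeasurableSpace E] [BorelSpace E] in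
-- The dispersive estimate: a particle with relative velocity `u` stays near the origin for a time
-- of order 1/|u|.
lemma lintegral_time_gaussian_le {α : ℝ} (hα : 0 < α) (X : E) {u : E} (hu : u ≠ 0) :
    ∫⁻ τ : ℝ, ENNReal.ofReal (Real.exp (-α * ‖X - τ • u‖ ^ 2)) ≤
      ENNReal.ofReal (Real.sqrt (Real.pi / α) / ‖u‖) := by
  have hu' : 0 < ‖u‖ := norm_pos_iff.2 hu
  have hb : 0 < α * ‖u‖ ^ 2 := by positivity
  -- The time of closest approach of τ ↦ X - τu to the origin. Discarding the minimal distance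
  -- leaves |u|²(τ - c)².
  set c := ⟪X, u⟫ / ‖u‖ ^ 2 with hc
  have hle : ∀ τ : ℝ, Real.exp (-α * ‖X - τ • u‖ ^ 2) ≤
      Real.exp (-(α * ‖u‖ ^ 2) * (τ - c) ^ 2) := by
    intro τ
    refine Real.exp_le_exp.2 ?_
    have h1 : ‖u‖ ^ 2 * (τ - c) ^ 2 ≤ ‖X - τ • u‖ ^ 2 := by
      rw [norm_sub_sq_real, norm_smul, inner_smul_right, mul_pow, Real.norm_eq_abs, sq_abs, hc]
      have h2 : ⟪X, u⟫ ^ 2 ≤ ‖X‖ ^ 2 * ‖u‖ ^ 2 := by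
        have := abs_real_inner_le_norm X u
        rw [← mul_pow]
        exact sq_le_sq.2 (by rwa [abs_of_nonneg (by positivity : 0 ≤ ‖X‖ * ‖u‖)])
      have h3 : ⟪X, u⟫ ^ 2 / ‖u‖ ^ 2 ≤ ‖X‖ ^ 2 := (div_le_iff₀ (by positivity)).2 h2
      have h4 : ‖u‖ ^ 2 * (τ - ⟪X, u⟫ / ‖u‖ ^ 2) ^ 2 =
          τ ^ 2 * ‖u‖ ^ 2 - 2 * (τ * ⟪X, u⟫) + ⟪X, u⟫ ^ 2 / ‖u‖ ^ 2 := by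
        field_simp
        ring
      rw [h4]; linarith
    nlinarith
  calc ∫⁻ τ : ℝ, ENNReal.ofReal (Real.exp (-α * ‖X - τ • u‖ ^ 2))
      ≤ ∫⁻ τ : ℝ, ENNReal.ofReal (Real.exp (-(α * ‖u‖ ^ 2) * (τ - c) ^ 2)) :=
        lintegral_mono fun τ => ENNReal.ofReal_le_ofReal (hle τ)
    _ = ∫⁻ τ : ℝ, ENNReal.ofReal (Real.exp (-(α * ‖u‖ ^ 2) * τ ^ 2)) :=
        lintegral_sub_right_eq_self
          (fun τ => ENNReal.ofReal (Real.exp (-(α * ‖u‖ ^ 2) * τ ^ 2))) c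
    _ = ENNReal.ofReal (Real.sqrt (Real.pi / (α * ‖u‖ ^ 2))) := by
        rw [← integral_gaussian, ofReal_integral_eq_lintegral_ofReal
          (integrable_exp_neg_mul_sq hb) (ae_of_all _ fun u => by positivity)]
    _ = _ := by
        rw [← div_div, Real.sqrt_div (by positivity), Real.sqrt_sq hu'.le]
    _ ≤ _ := le_rfl

/-- A collision frequency with a kernel `b`, along the free transport. -/
def freq (b : E → ℝ≥0∞) (α β τ : ℝ) (X p : E) : ℝ≥0∞ :=
  ∫⁻ w : E, b (w - p) * ENNReal.ofReal (Real.exp (-α * ‖X - τ • (w - p)‖ ^ 2 - β * ‖w‖ ^ 2))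

variable [Nontrivial E] {b : E → ℝ≥0∞} {N : ℝ≥0∞} {c s : ℝ}

/-- By Tonelli the time integral is taken inside, where it yields 1/|w - p| and cancels the factor
‖u‖ split off in `hb`. The remaining power `s` is an integrable singularity against the Gaussian in
`w`. -/
lemma lintegral_freq_le (hbm : Measurable b) (hc : 0 ≤ c)
    (hs : -(Module.finrank ℝ E : ℝ) < s) (hs0 : s ≤ 0)
    (hb : ∀ u, u ≠ 0 → b u ≤ N * ENNReal.ofReal (c * ‖u‖ ^ s * ‖u‖)) {α β : ℝ} (hα : 0 < α)
    (hβ : 0 < β) (X p : E) :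
    ∫⁻ τ : ℝ, freq b α β τ X p ≤ N * ENNReal.ofReal (c * Real.sqrt (Real.pi / α) *
      (sphereArea E / (Module.finrank ℝ E + s) +
        (Real.pi / β) ^ (Module.finrank ℝ E / 2 : ℝ))) := by
  have hm : Measurable fun q : ℝ × E => b (q.2 - p) * ENNReal.ofReal
      (Real.exp (-α * ‖X - q.1 • (q.2 - p)‖ ^ 2 - β * ‖q.2‖ ^ 2)) := by fun_prop
  unfold freq
  rw [lintegral_lintegral_swap hm.aemeasurable]
  have hne : ∀ᵐ w : E, w ≠ p := by simp [ae_iff]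
  have hpt : ∀ᵐ w : E, ∫⁻ τ : ℝ, b (w - p) * ENNReal.ofReal
      (Real.exp (-α * ‖X - τ • (w - p)‖ ^ 2 - β * ‖w‖ ^ 2)) ≤
      N * ENNReal.ofReal (c * Real.sqrt (Real.pi / α)) *
        ENNReal.ofReal (‖w - p‖ ^ s * Real.exp (-β * ‖w‖ ^ 2)) := by
    filter_upwards [hne] with w hw
    have hw0 : w - p ≠ 0 := sub_ne_zero.2 hw
    have hw' : 0 < ‖w - p‖ := norm_pos_iff.2 hw0
    have e : ∀ τ : ℝ, ENNReal.ofReal (Real.exp (-α * ‖X - τ • (w - p)‖ ^ 2 - β * ‖w‖ ^ 2)) =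
        ENNReal.ofReal (Real.exp (-α * ‖X - τ • (w - p)‖ ^ 2)) *
          ENNReal.ofReal (Real.exp (-β * ‖w‖ ^ 2)) := fun τ => by
      rw [← ENNReal.ofReal_mul (by positivity), ← Real.exp_add]; congr 2; ring
    simp_rw [e]
    rw [lintegral_const_mul _ (by fun_prop), lintegral_mul_const _ (by fun_prop)]
    calc _ ≤ N * ENNReal.ofReal (c * ‖w - p‖ ^ s * ‖w - p‖) *
          (ENNReal.ofReal (Real.sqrt (Real.pi / α) / ‖w - p‖) *
            ENNReal.ofReal (Real.exp (-β * ‖w‖ ^ 2))) := by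
          gcongr
          · exact hb _ hw0
          · exact lintegral_time_gaussian_le hα X hw0
      _ = _ := by
          rw [mul_assoc N, mul_assoc N, ← ENNReal.ofReal_mul (by positivity),
            ← ENNReal.ofReal_mul (by positivity), ← ENNReal.ofReal_mul (by positivity)]
          congr 2
          field_simp
  refine (lintegral_mono_ae hpt).trans ?_
  rw [lintegral_const_mul _ (by fun_prop), mul_assoc]
  gcongr
  rw [ENNReal.ofReal_mul (q := sphereArea E / _ + _) (by positivity)]
  gcongr
  exact lintegral_rpow_mul_gaussian_le hs hs0 hβ p

/-- At a single time there is no dispersive gain, so the factor |w - p| stays. It is bounded by (1 +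
|p|)(1 + |w|), and half of the Gaussian absorbs 1 + |w|; this is the source of the linear growth in
`p`. -/
lemma exists_freq_le (hN : N ≠ ∞) (hc : 0 ≤ c)
    (hs : -(Module.finrank ℝ E : ℝ) < s) (hs0 : s ≤ 0)
    (hb : ∀ u, u ≠ 0 → b u ≤ N * ENNReal.ofReal (c * ‖u‖ ^ s * ‖u‖)) {α β : ℝ} (hα : 0 < α)
    (hβ : 0 < β) :
    ∃ C : ℝ≥0∞, C ≠ ∞ ∧ ∀ τ X p, freq b α β τ X p ≤ C * ENNReal.ofReal (1 + ‖p‖) := by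
  refine ⟨N * ENNReal.ofReal (c * (2 + 2 / β)) * ENNReal.ofReal
    (sphereArea E / (Module.finrank ℝ E + s) +
      (Real.pi / (β / 2)) ^ (Module.finrank ℝ E / 2 : ℝ)), by finiteness, fun τ X p => ?_⟩
  have hne : ∀ᵐ w : E, w ≠ p := by simp [ae_iff]
  have hpt : ∀ᵐ w : E, b (w - p) * ENNReal.ofReal
      (Real.exp (-α * ‖X - τ • (w - p)‖ ^ 2 - β * ‖w‖ ^ 2)) ≤
      N * ENNReal.ofReal (c * (2 + 2 / β)) * ENNReal.ofReal (1 + ‖p‖) *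
        ENNReal.ofReal (‖w - p‖ ^ s * Real.exp (-(β / 2) * ‖w‖ ^ 2)) := by
    filter_upwards [hne] with w hw
    have hw0 : w - p ≠ 0 := sub_ne_zero.2 hw
    refine (mul_le_mul_left (hb _ hw0) _).trans ?_
    rw [mul_assoc N, mul_assoc N, mul_assoc N, ← ENNReal.ofReal_mul (by positivity),
      ← ENNReal.ofReal_mul (by positivity), ← ENNReal.ofReal_mul (by positivity)]
    gcongr N * ENNReal.ofReal ?_
    have h1 : Real.exp (-α * ‖X - τ • (w - p)‖ ^ 2 - β * ‖w‖ ^ 2) ≤ Real.exp (-β * ‖w‖ ^ 2) :=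
      Real.exp_le_exp.2 (by nlinarith [mul_nonneg hα.le (sq_nonneg ‖X - τ • (w - p)‖)])
    have h2 : Real.exp (-β * ‖w‖ ^ 2) =
        Real.exp (-(β / 2) * ‖w‖ ^ 2) * Real.exp (-(β / 2) * ‖w‖ ^ 2) := by
      rw [← Real.exp_add]; congr 1; ring
    -- With e^a ≥ 1 + a it suffices that 1 + r ≤ (2 + 2/β)(1 + βr²/2), whose right side contains 2 +
    -- r².
    have h3 : (1 + ‖w‖) * Real.exp (-(β / 2) * ‖w‖ ^ 2) ≤ 2 + 2 / β := by
      have h4 : 1 + β / 2 * ‖w‖ ^ 2 ≤ Real.exp (β / 2 * ‖w‖ ^ 2) := by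
        have := Real.add_one_le_exp (β / 2 * ‖w‖ ^ 2); linarith
      rw [neg_mul, Real.exp_neg, ← div_eq_mul_inv, div_le_iff₀ (Real.exp_pos _)]
      refine le_trans ?_ (mul_le_mul_of_nonneg_left h4 (by positivity))
      have : (2 + 2 / β) * (1 + β / 2 * ‖w‖ ^ 2) = 2 + 2 / β + β * ‖w‖ ^ 2 + ‖w‖ ^ 2 := by
        field_simp; ring
      rw [this]
      have h5 : 0 ≤ 2 / β := by positivity
      have h6 : 0 ≤ β * ‖w‖ ^ 2 := by positivity
      nlinarith [sq_nonneg (‖w‖ - 1)]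
    have h5 : ‖w - p‖ ≤ (1 + ‖p‖) * (1 + ‖w‖) := by
      have := norm_sub_le w p
      nlinarith [norm_nonneg w, norm_nonneg p, mul_nonneg (norm_nonneg w) (norm_nonneg p)]
    calc c * ‖w - p‖ ^ s * ‖w - p‖ *
          Real.exp (-α * ‖X - τ • (w - p)‖ ^ 2 - β * ‖w‖ ^ 2)
        ≤ c * ‖w - p‖ ^ s * ((1 + ‖p‖) * (1 + ‖w‖)) *
          (Real.exp (-(β / 2) * ‖w‖ ^ 2) * Real.exp (-(β / 2) * ‖w‖ ^ 2)) := by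
          rw [← h2]; gcongr
      _ = c * ‖w - p‖ ^ s * (1 + ‖p‖) * ((1 + ‖w‖) * Real.exp (-(β / 2) * ‖w‖ ^ 2)) *
          Real.exp (-(β / 2) * ‖w‖ ^ 2) := by ring
      _ ≤ c * ‖w - p‖ ^ s * (1 + ‖p‖) * (2 + 2 / β) * Real.exp (-(β / 2) * ‖w‖ ^ 2) := by
          gcongr
      _ = _ := by ring
  refine (lintegral_mono_ae hpt).trans ?_
  rw [lintegral_const_mul _ (by fun_prop), mul_right_comm]
  gcongr
  exact lintegral_rpow_mul_gaussian_le hs hs0 (half_pos hβ) p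

end Euclid

end

end BinaryTernary

namespace BinaryTernary

noncomputable section

/-! ### Bounds for the collision frequency -/

section Frequency

variable {d : ℕ} {K : Kernel}

/-- The integral of the binary cross-section over the sphere. -/
def Kernel.tot₂ (K : Kernel) (u : Vec d) : ℝ≥0∞ := ∫⁻ ω, K.B₂ u ω ∂(surf d)

/-- The integral of the ternary cross-section over the sphere. -/
def Kernel.tot₃ (K : Kernel) (u : Vec2 d) : ℝ≥0∞ := ∫⁻ ω, K.B₃ u ω ∂(surf2 d)

lemma Kernel.measurable_tot₂ (hK : K.Admissible d) :
    Measurable (K.tot₂ : Vec d → ℝ≥0∞) := by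
  have := (K.measurable_B₂ hK).lintegral_prod_right' (ν := surf d)
  exact this

lemma Kernel.measurable_tot₃ (hK : K.Admissible d) :
    Measurable (K.tot₃ : Vec2 d → ℝ≥0∞) := by
  have := (K.measurable_B₃ hK).lintegral_prod_right' (ν := surf2 d)
  exact this

lemma Kernel.measurable_B₂_right (hK : K.Admissible d) (u : Vec d) :
    Measurable fun ω : Sph d => K.B₂ u ω := by
  have := (K.measurable_B₂ hK).comp (measurable_prodMk_left (x := u))
  exact this

lemma Kernel.measurable_B₃_right (hK : K.Admissible d) (u : Vec2 d) :
    Measurable fun ω : Sph2 d => K.B₃ u ω := by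
  have := (K.measurable_B₃ hK).comp (measurable_prodMk_left (x := u))
  exact this

lemma one_le_sqrt_three : (1 : ℝ) ≤ Real.sqrt 3 := Real.one_le_sqrt.2 (by norm_num)

/-- The power ‖u‖^γ₂ is split as ‖u‖^(γ₂-1) times ‖u‖, the form that `lintegral_freq_le` expects.
The factor √3 is a loss here and only makes the constant the same as in the ternary case. -/
lemma Kernel.tot₂_le (hK : K.Admissible d) {u : Vec d} (hu : u ≠ 0) :
    K.tot₂ u ≤ K.norm₂ d * ENNReal.ofReal (Real.sqrt 3 * ‖u‖ ^ (K.γ₂ - 1) * ‖u‖) := by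
  have hu' : 0 < ‖u‖ := norm_pos_iff.2 hu
  have hb := hK.measurable₂
  have h1 : K.tot₂ u = ENNReal.ofReal (‖u‖ ^ K.γ₂) *
      ∫⁻ ω : Sph d, ENNReal.ofReal (K.b₂ ⟪‖u‖⁻¹ • u, (ω : Vec d)⟫) ∂(surf d) := by
    rw [← lintegral_const_mul _ (by fun_prop)]
    exact lintegral_congr fun ω => ENNReal.ofReal_mul (by positivity)
  have h2 : ∫⁻ ω : Sph d, ENNReal.ofReal (K.b₂ ⟪‖u‖⁻¹ • u, (ω : Vec d)⟫) ∂(surf d) ≤ K.norm₂ d :=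
    le_iSup (fun ν : Sph d => ∫⁻ ω, ENNReal.ofReal (K.b₂ ⟪(ν : Vec d), (ω : Vec d)⟫) ∂(surf d))
      ⟨‖u‖⁻¹ • u, by simp [norm_smul, hu'.ne']⟩
  rw [h1, mul_comm]
  gcongr
  rw [mul_assoc, ← Real.rpow_add_one hu'.ne', sub_add_cancel]
  exact le_mul_of_one_le_left (by positivity) one_le_sqrt_three

lemma sq_magTilde (u : Vec2 d) :
    magTilde u ^ 2 = ‖u.fst‖ ^ 2 + ‖u.snd‖ ^ 2 + ‖u.fst - u.snd‖ ^ 2 :=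
  Real.sq_sqrt (by positivity)

lemma norm_le_magTilde (u : Vec2 d) : ‖u‖ ≤ magTilde u := by
  refine Real.le_sqrt_of_sq_le ?_
  rw [WithLp.prod_norm_sq_eq_of_L2]
  linarith [sq_nonneg ‖u.fst - u.snd‖]

lemma magTilde_le (u : Vec2 d) : magTilde u ≤ Real.sqrt 3 * ‖u‖ := by
  rw [← Real.sqrt_sq (norm_nonneg u), ← Real.sqrt_mul (by norm_num)]
  refine Real.sqrt_le_sqrt ?_
  rw [WithLp.prod_norm_sq_eq_of_L2]
  have := norm_sub_le u.fst u.snd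
  nlinarith [norm_nonneg (u.fst - u.snd), sq_nonneg (‖u.fst‖ - ‖u.snd‖)]

/-- The norms are comparable, ‖u‖ ≤ |ũ| ≤ √3‖u‖. The lower bound serves the power γ₃ - 1, which is
not positive, and the upper bound serves the one factor |ũ| that remains. -/
lemma Kernel.tot₃_le (hK : K.Admissible d) {u : Vec2 d} (hu : u ≠ 0) :
    K.tot₃ u ≤ K.norm₃ d * ENNReal.ofReal (Real.sqrt 3 * ‖u‖ ^ (K.γ₃ - 1) * ‖u‖) := by
  have hu' : 0 < ‖u‖ := norm_pos_iff.2 hu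
  have hm : 0 < magTilde u := hu'.trans_le (norm_le_magTilde u)
  have hb := hK.measurable₃
  have hmeas : Measurable fun ω : Sph2 d => Function.uncurry K.b₃
      (⟪(magTilde u)⁻¹ • u, (ω : Vec2 d)⟫, ⟪(ω : Vec2 d).fst, (ω : Vec2 d).snd⟫) := by
    fun_prop
  have h1 : K.tot₃ u = ENNReal.ofReal (magTilde u ^ K.γ₃) *
      ∫⁻ ω : Sph2 d, ENNReal.ofReal (K.b₃ ⟪(magTilde u)⁻¹ • u, (ω : Vec2 d)⟫
        ⟪(ω : Vec2 d).fst, (ω : Vec2 d).snd⟫) ∂(surf2 d) := by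
    refine Eq.trans ?_ (lintegral_const_mul _ hmeas.ennreal_ofReal)
    exact lintegral_congr fun ω => ENNReal.ofReal_mul (by positivity)
  have hel : (magTilde u)⁻¹ • u ∈ ellipsoid d := by
    have e : ∀ a : Vec d, ‖(magTilde u)⁻¹ • a‖ ^ 2 = (magTilde u ^ 2)⁻¹ * ‖a‖ ^ 2 := fun a => by
      rw [norm_smul, mul_pow, Real.norm_eq_abs, sq_abs, inv_pow]
    simp only [ellipsoid, Set.mem_ofPred_eq, WithLp.smul_fst, WithLp.smul_snd]
    rw [← smul_sub, e, e, e, ← mul_add, ← mul_add, ← sq_magTilde, inv_mul_cancel₀ (by positivity)]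
  have h2 : ∫⁻ ω : Sph2 d, ENNReal.ofReal (K.b₃ ⟪(magTilde u)⁻¹ • u, (ω : Vec2 d)⟫
        ⟪(ω : Vec2 d).fst, (ω : Vec2 d).snd⟫) ∂(surf2 d) ≤ K.norm₃ d :=
    le_iSup (fun ν : ellipsoid d => ∫⁻ ω,
      ENNReal.ofReal (K.b₃ ⟪(ν : Vec2 d), (ω : Vec2 d)⟫ ⟪(ω : Vec2 d).fst, (ω : Vec2 d).snd⟫)
      ∂(surf2 d)) ⟨_, hel⟩
  rw [h1, mul_comm]
  gcongr
  have h3 : magTilde u ^ K.γ₃ = magTilde u ^ (K.γ₃ - 1) * magTilde u := by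
    rw [← Real.rpow_add_one hm.ne', sub_add_cancel]
  rw [h3]
  calc magTilde u ^ (K.γ₃ - 1) * magTilde u ≤ ‖u‖ ^ (K.γ₃ - 1) * (Real.sqrt 3 * ‖u‖) := by
        gcongr ?_ * ?_
        · exact Real.rpow_le_rpow_of_nonpos hu' (norm_le_magTilde u) (by linarith [hK.γ₃_le])
        · exact magTilde_le u
    _ = _ := by ring

/-! ### Time integral and growth of the frequency of the transported Maxwellian -/

/-- The diagonal of `ℝ^{2d}`. -/
def diag (x : Vec d) : Vec2 d := WithLp.toLp 2 (x, x)

lemma norm_diag_le (x : Vec d) : ‖diag x‖ ≤ 2 * ‖x‖ := by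
  refine (sq_le_sq₀ (norm_nonneg _) (by positivity)).1 ?_
  have : ‖diag x‖ ^ 2 = ‖x‖ ^ 2 + ‖x‖ ^ 2 := WithLp.prod_norm_sq_eq_of_L2 _
  rw [this]
  nlinarith [sq_nonneg ‖x‖]

/-- At x + τv the Maxwellian W has Gaussian argument x - τ(w - v). The product of two such Gaussians
is one Gaussian on ℝ^{2d}, centred by the diagonal points (x, x) and (v, v). The ternary frequency
is thus a `freq` on ℝ^{2d}, and a single estimate covers both collision types. -/
lemma Kernel.sharp_R_transMax (hK : K.Admissible d) (α β τ : ℝ) (z : Vec d × Vec d) :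
    sharp (K.R (transMax d α β)) τ z = freq K.tot₂ α β τ z.1 z.2 +
      freq K.tot₃ α β τ (diag z.1) (diag z.2) := by
  obtain ⟨x, v⟩ := z
  have hW : ∀ w : Vec d, transMax d α β τ (x + τ • v, w) =
      ENNReal.ofReal (Real.exp (-α * ‖x - τ • (w - v)‖ ^ 2 - β * ‖w‖ ^ 2)) := fun w => by
    simp only [transMax, ofStationarySharp, maxwellian]
    have : x + τ • v - τ • w = x - τ • (w - v) := by module
    rw [this]
  simp only [sharp, Kernel.R, Kernel.L, Kernel.L₂, Kernel.L₃]
  congr 1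
  · simp only [one_mul, hW]
    refine lintegral_congr fun w => ?_
    rw [lintegral_mul_const]
    · rfl
    · exact K.measurable_B₂_right hK (w - v)
  · have hm : Measurable fun w : Vec2 d => K.tot₃ (w - diag v) * ENNReal.ofReal
        (Real.exp (-α * ‖diag x - τ • (w - diag v)‖ ^ 2 - β * ‖w‖ ^ 2)) := by
      have := K.measurable_tot₃ hK
      fun_prop
    have hvp := WithLp.volume_preserving_toLp (U := Vec d) (V := Vec d)
    rw [freq, ← hvp.lintegral_comp hm, Measure.volume_eq_prod]
    refine Eq.trans ?_ (lintegral_prod _ (hm.comp hvp.measurable).aemeasurable).symm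
    refine lintegral_congr fun w₁ => lintegral_congr fun w₂ => ?_
    simp only [one_mul, hW]
    rw [lintegral_mul_const _ (K.measurable_B₃_right hK _), ← ENNReal.ofReal_mul (by positivity), ← Real.exp_add]
    have e1 : (WithLp.toLp 2 (w₁, w₂) : Vec2 d) - diag v = WithLp.toLp 2 (w₁ - v, w₂ - v) := rfl
    have e2 : ‖diag x - τ • (WithLp.toLp 2 (w₁ - v, w₂ - v) : Vec2 d)‖ ^ 2 =
        ‖x - τ • (w₁ - v)‖ ^ 2 + ‖x - τ • (w₂ - v)‖ ^ 2 := WithLp.prod_norm_sq_eq_of_L2 _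
    have e3 : ‖(WithLp.toLp 2 (w₁, w₂) : Vec2 d)‖ ^ 2 = ‖w₁‖ ^ 2 + ‖w₂‖ ^ 2 :=
      WithLp.prod_norm_sq_eq_of_L2 _
    simp only [Function.comp_apply]
    rw [e1, e2, e3, Kernel.tot₃]
    congr 3
    ring

lemma finrank_vec2 : Module.finrank ℝ (Vec2 d) = 2 * d := by
  rw [(WithLp.linearEquiv 2 ℝ (Vec d × Vec d)).finrank_eq, Module.finrank_prod,
    finrank_euclideanSpace_fin, two_mul]

lemma nontrivial_vec (hd : 2 ≤ d) : Nontrivial (Vec d) :=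
  Module.nontrivial_of_finrank_pos (R := ℝ) (by rw [finrank_euclideanSpace_fin]; omega)

lemma nontrivial_vec2 (hd : 2 ≤ d) : Nontrivial (Vec2 d) :=
  Module.nontrivial_of_finrank_pos (R := ℝ) (by rw [finrank_vec2]; omega)

/-- A dimensional constant that suits the estimate of the collision frequency. -/
def dimConst (d : ℕ) : ℝ := Real.sqrt 3 * Real.sqrt Real.pi *
  (1 + sphereArea (Vec d) + sphereArea (Vec2 d) + Real.pi ^ ((d : ℝ) / 2) + Real.pi ^ (d : ℝ))

lemma dimConst_pos (d : ℕ) : 0 < dimConst d := by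
  have h1 := sphereArea_nonneg (E := Vec d)
  have h2 := sphereArea_nonneg (E := Vec2 d)
  have := Real.pi_pos
  unfold dimConst; positivity

/-- `lintegral_freq_le` is used on ℝ^d with exponent γ₂ - 1 and on ℝ^{2d} with exponent γ₃ - 1. The
two bounds add up to K_β/√α, uniformly in (x, v). -/
lemma Kernel.lintegral_sharp_R_transMax_le (hd : 2 ≤ d) (hK : K.Admissible d) {α β : ℝ}
    (hα : 0 < α) (hβ : 0 < β) (z : Vec d × Vec d) :
    ∫⁻ τ : ℝ, sharp (K.R (transMax d α β)) τ z ≤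
      ENNReal.ofReal (K.Kconst d (dimConst d) β / Real.sqrt α) := by
  have := nontrivial_vec hd
  have := nontrivial_vec2 hd
  have hA1 := sphereArea_nonneg (E := Vec d)
  have hA2 := sphereArea_nonneg (E := Vec2 d)
  have g2 := hK.γ₂_gt
  have g3 := hK.γ₃_gt
  have f2 : (Module.finrank ℝ (Vec d) : ℝ) = d := by rw [finrank_euclideanSpace_fin]
  have f3 : (Module.finrank ℝ (Vec2 d) : ℝ) = 2 * d := by rw [finrank_vec2]; push_cast; ring
  have hpi := Real.pi_pos
  have i2 := lintegral_freq_le (N := K.norm₂ d) (c := Real.sqrt 3) (s := K.γ₂ - 1)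
    (K.measurable_tot₂ hK) (by positivity)
    (by rw [f2]; linarith) (by linarith [hK.γ₂_le]) (fun u hu => K.tot₂_le hK hu) hα hβ z.1 z.2
  have i3 := lintegral_freq_le (N := K.norm₃ d) (c := Real.sqrt 3) (s := K.γ₃ - 1)
    (K.measurable_tot₃ hK) (by positivity)
    (by rw [f3]; linarith) (by linarith [hK.γ₃_le]) (fun u hu => K.tot₃_le hK hu) hα hβ
    (diag z.1) (diag z.2)
  simp_rw [K.sharp_R_transMax hK]
  have hmeas : Measurable fun τ : ℝ => freq (E := Vec d) K.tot₂ α β τ z.1 z.2 := by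
    have hm : Measurable fun q : ℝ × Vec d => K.tot₂ (q.2 - z.2) * ENNReal.ofReal
        (Real.exp (-α * ‖z.1 - q.1 • (q.2 - z.2)‖ ^ 2 - β * ‖q.2‖ ^ 2)) := by
      have := K.measurable_tot₂ hK
      fun_prop
    exact hm.lintegral_prod_right'
  rw [lintegral_add_left hmeas]
  refine (add_le_add i2 i3).trans ?_
  rw [← ENNReal.ofReal_toReal hK.norm₂_lt.ne, ← ENNReal.ofReal_toReal hK.norm₃_lt.ne,
    ← ENNReal.ofReal_mul ENNReal.toReal_nonneg, ← ENNReal.ofReal_mul ENNReal.toReal_nonneg, f2, f3]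
  have p2 : 0 < (d : ℝ) + K.γ₂ - 1 := by linarith
  have p3 : 0 < 2 * (d : ℝ) + K.γ₃ - 1 := by linarith
  rw [← add_sub_assoc, ← add_sub_assoc, ← ENNReal.ofReal_add (by positivity) (by positivity)]
  refine ENNReal.ofReal_le_ofReal ?_
  rw [le_div_iff₀ (Real.sqrt_pos.2 hα), Kernel.Kconst]
  have hpa : Real.sqrt (Real.pi / α) = Real.sqrt Real.pi / Real.sqrt α := Real.sqrt_div' _ hα.le
  have hs : 0 < Real.sqrt α := Real.sqrt_pos.2 hα
  set a := Real.sqrt 3 * Real.sqrt Real.pi with ha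
  have ha0 : 0 ≤ a := by positivity
  set S := 1 + sphereArea (Vec d) + sphereArea (Vec2 d) + Real.pi ^ ((d : ℝ) / 2) +
    Real.pi ^ (d : ℝ) with hS
  have q1 : 0 ≤ Real.pi ^ ((d : ℝ) / 2) := by positivity
  have q2 : 0 ≤ Real.pi ^ (d : ℝ) := by positivity
  have b2 : sphereArea (Vec d) / (d + K.γ₂ - 1) + (Real.pi / β) ^ ((d : ℝ) / 2) ≤
      S * (β ^ (-(d : ℝ) / 2) + 1 / (d + K.γ₂ - 1)) := by
    rw [Real.div_rpow hpi.le hβ.le, neg_div, Real.rpow_neg hβ.le, mul_add, add_comm, mul_one_div,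
      div_eq_mul_inv]
    gcongr <;> linarith
  have b3 : sphereArea (Vec2 d) / (2 * d + K.γ₃ - 1) + (Real.pi / β) ^ (2 * (d : ℝ) / 2) ≤
      S * (β ^ (-(d : ℝ)) + 1 / (2 * d + K.γ₃ - 1)) := by
    rw [mul_div_cancel_left₀ _ (two_ne_zero' ℝ), Real.div_rpow hpi.le hβ.le, Real.rpow_neg hβ.le,
      mul_add, add_comm, mul_one_div, div_eq_mul_inv]
    gcongr <;> linarith
  have hD : dimConst d = a * S := rfl
  rw [hD, hpa]
  calc _ = a * ((K.norm₂ d).toReal * (sphereArea (Vec d) / (d + K.γ₂ - 1) +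
        (Real.pi / β) ^ ((d : ℝ) / 2)) + (K.norm₃ d).toReal * (sphereArea (Vec2 d) /
        (2 * d + K.γ₃ - 1) + (Real.pi / β) ^ (2 * (d : ℝ) / 2))) := by
        rw [ha]; field_simp
    _ ≤ a * ((K.norm₂ d).toReal * (S * (β ^ (-(d : ℝ) / 2) + 1 / (d + K.γ₂ - 1))) +
        (K.norm₃ d).toReal * (S * (β ^ (-(d : ℝ)) + 1 / (2 * d + K.γ₃ - 1)))) := by gcongr
    _ = _ := by ring

/-- A bound at each fixed time. It makes the collision terms integrable in (x, v), and it bounds the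
frequency on the sets |v| ≤ N. -/
lemma Kernel.exists_sharp_R_transMax_le (hd : 2 ≤ d) (hK : K.Admissible d) {α β : ℝ}
    (hα : 0 < α) (hβ : 0 < β) :
    ∃ C : ℝ≥0∞, C ≠ ∞ ∧ ∀ (τ : ℝ) (z : Vec d × Vec d),
      sharp (K.R (transMax d α β)) τ z ≤ C * ENNReal.ofReal (1 + ‖z.2‖) := by
  have := nontrivial_vec hd
  have := nontrivial_vec2 hd
  have g2 := hK.γ₂_gt
  have g3 := hK.γ₃_gt
  have f2 : (Module.finrank ℝ (Vec d) : ℝ) = d := by rw [finrank_euclideanSpace_fin]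
  have f3 : (Module.finrank ℝ (Vec2 d) : ℝ) = 2 * d := by rw [finrank_vec2]; push_cast; ring
  obtain ⟨C₂, hC₂, h₂⟩ := exists_freq_le (E := Vec d) (N := K.norm₂ d) (c := Real.sqrt 3)
    (s := K.γ₂ - 1) hK.norm₂_lt.ne (by positivity)
    (by rw [f2]; linarith) (by linarith [hK.γ₂_le]) (fun u hu => K.tot₂_le hK hu) hα hβ
  obtain ⟨C₃, hC₃, h₃⟩ := exists_freq_le (E := Vec2 d) (N := K.norm₃ d) (c := Real.sqrt 3)
    (s := K.γ₃ - 1) hK.norm₃_lt.ne (by positivity)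
    (by rw [f3]; linarith) (by linarith [hK.γ₃_le]) (fun u hu => K.tot₃_le hK hu) hα hβ
  refine ⟨C₂ + C₃ * 2, by finiteness, fun τ z => ?_⟩
  rw [K.sharp_R_transMax hK, add_mul, mul_assoc C₃]
  refine add_le_add (h₂ _ _ _) ((h₃ _ _ _).trans ?_)
  gcongr
  refine le_of_le_of_eq (b := ENNReal.ofReal (2 * (1 + ‖z.2‖))) (ENNReal.ofReal_le_ofReal ?_)
    (by rw [ENNReal.ofReal_mul (by norm_num), ENNReal.ofReal_ofNat])
  linarith [norm_diag_le z.2]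

end Frequency

end

end BinaryTernary

namespace BinaryTernary

noncomputable section

/-! ### The exponential of a non-negative extended number -/

section Exponential

/-- The function `e^{-a}` of `a ∈ [0, ∞]`. -/
def expNeg (a : ℝ≥0∞) : ℝ≥0∞ := if a = ∞ then 0 else ENNReal.ofReal (Real.exp (-a.toReal))

lemma expNeg_of_ne_top {a : ℝ≥0∞} (h : a ≠ ∞) : expNeg a = ENNReal.ofReal (Real.exp (-a.toReal)) :=
  if_neg h

lemma measurable_expNeg : Measurable expNeg :=
  Measurable.ite (measurableSet_singleton ∞) measurable_const (by fun_prop)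

lemma expNeg_zero : expNeg 0 = 1 := by simp [expNeg]

lemma expNeg_anti : Antitone expNeg := by
  intro a b hab
  by_cases hb : b = ∞
  · simp [expNeg, hb]
  · have ha : a ≠ ∞ := (hab.trans_lt (lt_top_iff_ne_top.2 hb)).ne
    rw [expNeg_of_ne_top ha, expNeg_of_ne_top hb]
    exact ENNReal.ofReal_le_ofReal (Real.exp_le_exp.2 (neg_le_neg (ENNReal.toReal_mono hb hab)))

lemma expNeg_le_one (a : ℝ≥0∞) : expNeg a ≤ 1 := expNeg_zero ▸ expNeg_anti zero_le

/-- The exponential e^{-x} is 1-Lipschitz on [0, ∞), so composition with it preserves absolute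
continuity of a non-negative function. -/
lemma abs_exp_neg_sub_le {x y : ℝ} (hx : 0 ≤ x) (hy : 0 ≤ y) :
    |Real.exp (-x) - Real.exp (-y)| ≤ |x - y| := by
  wlog h : x ≤ y generalizing x y
  · rw [abs_sub_comm, abs_sub_comm x]; exact this hy hx (le_of_not_ge h)
  have h1 : Real.exp (-y) ≤ Real.exp (-x) := Real.exp_le_exp.2 (by linarith)
  rw [abs_of_nonneg (by linarith), abs_sub_comm, abs_of_nonneg (by linarith)]
  have h2 : Real.exp (-y) = Real.exp (-x) * Real.exp (-(y - x)) := by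
    rw [← Real.exp_add]; congr 1; ring
  have h3 := Real.add_one_le_exp (-(y - x))
  have h4 : Real.exp (-x) ≤ 1 := Real.exp_le_one_iff.2 (by linarith)
  nlinarith [Real.exp_pos (-x), Real.exp_pos (-(y - x))]

/-- Since `r` is only integrable, the exponential of its primitive is only absolutely continuous.
Its derivative is found almost everywhere by Lebesgue differentiation, and the fundamental theorem
for absolutely continuous functions concludes. -/
lemma integral_mul_exp_neg_primitive {r : ℝ → ℝ} {s t : ℝ} (hst : s ≤ t)
    (hr : IntervalIntegrable r volume s t) (hr0 : ∀ x, 0 ≤ r x) :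
    ∫ x in s..t, r x * Real.exp (-∫ y in s..x, r y) = 1 - Real.exp (-∫ y in s..t, r y) := by
  set F : ℝ → ℝ := fun x => ∫ y in s..x, r y with hF
  have hF0 : ∀ x ∈ uIcc s t, 0 ≤ F x := fun x hx => by
    rw [uIcc_of_le hst] at hx
    exact intervalIntegral.integral_nonneg hx.1 fun y _ => hr0 y
  have hFac : AbsolutelyContinuousOnInterval F s t :=
    hr.absolutelyContinuousOnInterval_intervalIntegral left_mem_uIcc
  have hHac : AbsolutelyContinuousOnInterval (fun x => Real.exp (-F x)) s t := by
    rw [absolutelyContinuousOnInterval_iff] at hFac ⊢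
    intro ε hε
    obtain ⟨δ, hδ, h⟩ := hFac ε hε
    refine ⟨δ, hδ, fun I hI hlt => lt_of_le_of_lt (Finset.sum_le_sum fun i hi => ?_) (h I hI hlt)⟩
    have hmem := hI.1 i hi
    exact abs_exp_neg_sub_le (hF0 _ hmem.1) (hF0 _ hmem.2)
  have hd : ∀ᵐ x, x ∈ uIcc s t → deriv (fun x => Real.exp (-F x)) x = -(r x * Real.exp (-F x)) := by
    filter_upwards [hr.ae_hasDerivAt_integral] with x hx hxst
    have h1 : HasDerivAt (fun x => Real.exp (-F x)) (Real.exp (-F x) * -r x) x :=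
      (hx hxst s left_mem_uIcc).neg.exp
    rw [h1.deriv]; ring
  have h2 := hHac.integral_deriv_eq_sub
  rw [intervalIntegral.integral_congr_ae (g := fun x => -(r x * Real.exp (-F x)))
    (by filter_upwards [hd] with x hx hx' using hx (uIoc_subset_uIcc hx')),
    intervalIntegral.integral_neg] at h2
  have h3 : F s = 0 := by simp [hF]
  simp only [h3, neg_zero, Real.exp_zero] at h2
  linarith

/-- The fundamental theorem of calculus for `e^{-∫R}`. -/
lemma expNeg_add_lintegral {R : ℝ → ℝ≥0∞} (hR : Measurable R) {s t : ℝ} (hst : s ≤ t)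
    (hfin : ∫⁻ σ in Ioc s t, R σ ≠ ∞) :
    expNeg (∫⁻ σ in Ioc s t, R σ) + ∫⁻ σ in Ioc s t, R σ * expNeg (∫⁻ ρ in Ioc s σ, R ρ) = 1 := by
  have hint : IntegrableOn (fun σ => (R σ).toReal) (Ioc s t) :=
    integrable_toReal_of_lintegral_ne_top hR.aemeasurable hfin
  have hii : IntervalIntegrable (fun σ => (R σ).toReal) volume s t :=
    (intervalIntegrable_iff_integrableOn_Ioc_of_le hst).2 hint
  have hlt : ∀ᵐ σ ∂(volume.restrict (Ioc s t)), R σ < ∞ := ae_lt_top hR hfin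
  have hprim : ∀ x ∈ Icc s t, (∫⁻ ρ in Ioc s x, R ρ).toReal = ∫ y in s..x, (R y).toReal ∧
      ∫⁻ ρ in Ioc s x, R ρ ≠ ∞ := fun x hx => by
    have hsub : Ioc s x ⊆ Ioc s t := Ioc_subset_Ioc_right hx.2
    refine ⟨?_, ((lintegral_mono_set hsub).trans_lt hfin.lt_top).ne⟩
    rw [intervalIntegral.integral_of_le hx.1, integral_toReal hR.aemeasurable
      (ae_restrict_of_ae_restrict_of_subset hsub hlt)]
  have hI := integral_mul_exp_neg_primitive hst hii fun x => ENNReal.toReal_nonneg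
  have hexp0 : ∀ x ∈ Icc s t, Real.exp (-∫ y in s..x, (R y).toReal) ≤ 1 := fun x hx => by
    refine Real.exp_le_one_iff.2 (neg_nonpos.2 ?_)
    exact intervalIntegral.integral_nonneg hx.1 fun y _ => ENNReal.toReal_nonneg
  have hm : AEStronglyMeasurable (fun x => Real.exp (-∫ y in s..x, (R y).toReal))
      (volume.restrict (Ioc s t)) := by
    refine ContinuousOn.aestronglyMeasurable (ContinuousOn.mono ?_ Ioc_subset_Icc_self)
      measurableSet_Ioc
    refine Real.continuous_exp.comp_continuousOn (ContinuousOn.neg ?_)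
    have := intervalIntegral.continuousOn_primitive_interval (a := s) (b := t)
      (f := fun σ => (R σ).toReal) (μ := volume) (by
        rw [uIcc_of_le hst, integrableOn_Icc_iff_integrableOn_Ioc]; exact hint)
    rwa [uIcc_of_le hst] at this
  have hint2 : IntegrableOn (fun x => (R x).toReal * Real.exp (-∫ y in s..x, (R y).toReal))
      (Ioc s t) := by
    refine hint.mul_bdd (c := 1) hm ?_
    filter_upwards [ae_restrict_mem measurableSet_Ioc] with x hx
    rw [Real.norm_of_nonneg (Real.exp_nonneg _)]
    exact hexp0 x (Ioc_subset_Icc_self hx)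
  have e1 : ∫⁻ σ in Ioc s t, R σ * expNeg (∫⁻ ρ in Ioc s σ, R ρ) =
      ENNReal.ofReal (∫ x in s..t, (R x).toReal * Real.exp (-∫ y in s..x, (R y).toReal)) := by
    rw [intervalIntegral.integral_of_le hst, ofReal_integral_eq_lintegral_ofReal hint2
      (ae_of_all _ fun x => mul_nonneg ENNReal.toReal_nonneg (Real.exp_nonneg _))]
    refine lintegral_congr_ae ?_
    filter_upwards [hlt, ae_restrict_mem measurableSet_Ioc] with x hx hxm
    obtain ⟨h1, h2⟩ := hprim x (Ioc_subset_Icc_self hxm)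
    rw [expNeg_of_ne_top h2, h1, ENNReal.ofReal_mul ENNReal.toReal_nonneg,
      ENNReal.ofReal_toReal hx.ne]
  obtain ⟨h1, h2⟩ := hprim t (right_mem_Icc.2 hst)
  rw [e1, hI, expNeg_of_ne_top h2, h1, ← ENNReal.ofReal_add (Real.exp_nonneg _)
    (by linarith [hexp0 t (right_mem_Icc.2 hst)])]
  simp

lemma measurable_setLIntegral_Ioc {X : Type*} [MeasurableSpace X] {A : X × ℝ → ℝ≥0∞}
    (hA : Measurable A) {a b : X → ℝ} (ha : Measurable a) (hb : Measurable b) :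
    Measurable fun x => ∫⁻ σ in Ioc (a x) (b x), A (x, σ) := by
  have hs : MeasurableSet {p : X × ℝ | p.2 ∈ Ioc (a p.1) (b p.1)} :=
    (measurableSet_lt (ha.comp measurable_fst) measurable_snd).inter
      (measurableSet_le measurable_snd (hb.comp measurable_fst))
  have h1 := (hA.indicator hs).lintegral_prod_right' (ν := (volume : Measure ℝ))
  convert h1 using 2 with x
  rw [← lintegral_indicator measurableSet_Ioc]
  rfl

end Exponential

/-! ### Solutions of the scalar linear equation -/

section Scalar

/-- The solution of `f' + R f = h`, `f(0) = f₀`. -/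
def linSol (f₀ : ℝ≥0∞) (R h : ℝ → ℝ≥0∞) (t : ℝ) : ℝ≥0∞ :=
  f₀ * expNeg (∫⁻ σ in Ioc 0 t, R σ) +
    ∫⁻ τ in Ioc 0 t, h τ * expNeg (∫⁻ σ in Ioc τ t, R σ)

lemma linSol_le (f₀ : ℝ≥0∞) (R h : ℝ → ℝ≥0∞) (t : ℝ) :
    linSol f₀ R h t ≤ f₀ + ∫⁻ τ in Ioc 0 t, h τ := by
  refine add_le_add (mul_le_of_le_one_right' (expNeg_le_one _)) (lintegral_mono fun τ => ?_)
  exact mul_le_of_le_one_right' (expNeg_le_one _)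

/-- A smaller frequency enlarges both exponentials and a larger source enlarges the integrand. All
monotonicity of the iteration comes from here. -/
lemma linSol_mono {f₀ : ℝ≥0∞} {R R' h h' : ℝ → ℝ≥0∞} {t : ℝ}
    (hR : ∀ᵐ τ ∂(volume.restrict (Ioc 0 t)), R' τ ≤ R τ)
    (hh : ∀ᵐ τ ∂(volume.restrict (Ioc 0 t)), h τ ≤ h' τ) :
    linSol f₀ R h t ≤ linSol f₀ R' h' t := by
  refine add_le_add ?_ (lintegral_mono_ae ?_)
  · gcongr
    exact expNeg_anti (lintegral_mono_ae hR)
  · filter_upwards [hh, ae_restrict_mem measurableSet_Ioc] with τ hτ hτm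
    gcongr
    exact expNeg_anti (lintegral_mono_ae
      (ae_restrict_of_ae_restrict_of_subset (Ioc_subset_Ioc_left hτm.1.le) hR))

lemma measurable_linSol {X : Type*} [MeasurableSpace X] {f₀ : X → ℝ≥0∞} (hf₀ : Measurable f₀)
    {R h : ℝ → X → ℝ≥0∞} (hR : Measurable (Function.uncurry R))
    (hh : Measurable (Function.uncurry h)) :
    Measurable fun p : ℝ × X => linSol (f₀ p.2) (fun σ => R σ p.2) (fun σ => h σ p.2) p.1 := by
  have m1 : Measurable fun q : (ℝ × X) × ℝ => Function.uncurry R (q.2, q.1.2) := by fun_prop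
  have m2 : Measurable fun q : ((ℝ × X) × ℝ) × ℝ => Function.uncurry R (q.2, q.1.1.2) := by
    fun_prop
  have m3 : Measurable fun q : (ℝ × X) × ℝ => Function.uncurry h (q.2, q.1.2) := by fun_prop
  have a1 : Measurable fun p : ℝ × X => ∫⁻ σ in Ioc 0 p.1, R σ p.2 :=
    measurable_setLIntegral_Ioc m1 measurable_const measurable_fst
  have a2 : Measurable fun q : (ℝ × X) × ℝ => ∫⁻ σ in Ioc q.2 q.1.1, R σ q.1.2 :=
    measurable_setLIntegral_Ioc m2 measurable_snd (measurable_fst.comp measurable_fst)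
  have a3 : Measurable fun q : (ℝ × X) × ℝ =>
      h q.2 q.1.2 * expNeg (∫⁻ σ in Ioc q.2 q.1.1, R σ q.1.2) :=
    m3.mul (measurable_expNeg.comp a2)
  exact ((hf₀.comp measurable_snd).mul (measurable_expNeg.comp a1)).add
    (measurable_setLIntegral_Ioc a3 measurable_const measurable_fst)

/-- Tonelli on the triangle τ ≤ σ ≤ t exchanges the order in ∫ f R. Then e^{-∫R} + ∫ R e^{-∫R} = 1
is used on [0, t] for the initial datum and on [τ, t] for the source at time τ. Nothing is
subtracted, so the source need not be integrable. -/
lemma linSol_add_lintegral {f₀ : ℝ≥0∞} {R h : ℝ → ℝ≥0∞} (hR : Measurable R) (hh : Measurable h)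
    {t : ℝ} (ht : 0 ≤ t) (hfin : ∫⁻ σ in Ioc 0 t, R σ ≠ ∞) :
    linSol f₀ R h t + ∫⁻ σ in Ioc 0 t, linSol f₀ R h σ * R σ = f₀ + ∫⁻ τ in Ioc 0 t, h τ := by
  have mE : Measurable fun q : ℝ × ℝ => expNeg (∫⁻ ρ in Ioc q.1 q.2, R ρ) := by
    have m1 : Measurable fun q : (ℝ × ℝ) × ℝ => R q.2 := by fun_prop
    exact measurable_expNeg.comp
      (measurable_setLIntegral_Ioc m1 measurable_fst measurable_snd)
  have mE0 : Measurable fun σ : ℝ => expNeg (∫⁻ ρ in Ioc 0 σ, R ρ) :=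
    mE.comp (measurable_prodMk_left (x := (0 : ℝ)))
  have mΨ : Measurable fun q : ℝ × ℝ => {q : ℝ × ℝ | q.2 ≤ q.1}.indicator
      (fun q => R q.1 * (h q.2 * expNeg (∫⁻ ρ in Ioc q.2 q.1, R ρ))) q := by
    refine Measurable.indicator ?_ (measurableSet_le measurable_snd measurable_fst)
    have := mE.comp measurable_swap
    exact (hR.comp measurable_fst).mul ((hh.comp measurable_snd).mul this)
  have e1 : ∫⁻ σ in Ioc 0 t, linSol f₀ R h σ * R σ =
      f₀ * (∫⁻ σ in Ioc 0 t, R σ * expNeg (∫⁻ ρ in Ioc 0 σ, R ρ)) +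
        ∫⁻ τ in Ioc 0 t, h τ * ∫⁻ σ in Ioc τ t, R σ * expNeg (∫⁻ ρ in Ioc τ σ, R ρ) := by
    have s1 : ∀ σ ∈ Ioc 0 t, linSol f₀ R h σ * R σ =
        f₀ * (R σ * expNeg (∫⁻ ρ in Ioc 0 σ, R ρ)) + ∫⁻ τ in Ioc 0 t,
          {q : ℝ × ℝ | q.2 ≤ q.1}.indicator
            (fun q => R q.1 * (h q.2 * expNeg (∫⁻ ρ in Ioc q.2 q.1, R ρ))) (σ, τ) := by
      intro σ hσ
      have : ∀ τ, {q : ℝ × ℝ | q.2 ≤ q.1}.indicator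
            (fun q => R q.1 * (h q.2 * expNeg (∫⁻ ρ in Ioc q.2 q.1, R ρ))) (σ, τ) =
          (Iic σ).indicator (fun τ => R σ * (h τ * expNeg (∫⁻ ρ in Ioc τ σ, R ρ))) τ :=
        fun τ => rfl
      simp_rw [this]
      rw [setLIntegral_indicator measurableSet_Iic, inter_comm, Ioc_inter_Iic, min_eq_right hσ.2,
        lintegral_const_mul]
      · rw [linSol]; ring
      · exact hh.mul (mE.comp (measurable_prodMk_right (y := σ)))
    have hA' : Measurable fun σ => R σ * expNeg (∫⁻ ρ in Ioc 0 σ, R ρ) := hR.mul mE0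
    have hA : Measurable fun σ => f₀ * (R σ * expNeg (∫⁻ ρ in Ioc 0 σ, R ρ)) := hA'.const_mul f₀
    rw [setLIntegral_congr_fun measurableSet_Ioc s1, lintegral_add_left hA,
      lintegral_const_mul _ hA',
      lintegral_lintegral_swap mΨ.aemeasurable]
    congr 1
    refine setLIntegral_congr_fun measurableSet_Ioc fun τ hτ => ?_
    have : ∀ σ, {q : ℝ × ℝ | q.2 ≤ q.1}.indicator
            (fun q => R q.1 * (h q.2 * expNeg (∫⁻ ρ in Ioc q.2 q.1, R ρ))) (σ, τ) =
          (Ici τ).indicator (fun σ => h τ * (R σ * expNeg (∫⁻ ρ in Ioc τ σ, R ρ))) σ := by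
      intro σ
      by_cases hσ : τ ≤ σ
      · rw [indicator_of_mem (show (σ, τ) ∈ {q : ℝ × ℝ | q.2 ≤ q.1} from hσ),
          indicator_of_mem (mem_Ici.2 hσ)]
        ring
      · rw [indicator_of_notMem (show (σ, τ) ∉ {q : ℝ × ℝ | q.2 ≤ q.1} from hσ),
          indicator_of_notMem (by simpa using hσ)]
    simp_rw [this]
    rw [setLIntegral_indicator measurableSet_Ici]
    have hI : Ici τ ∩ Ioc 0 t = Icc τ t := by
      ext x; exact ⟨fun h => ⟨h.1, h.2.2⟩, fun h => ⟨h.1, hτ.1.trans_le h.1, h.2⟩⟩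
    rw [hI, ← restrict_Ioc_eq_restrict_Icc, lintegral_const_mul]
    exact hR.mul (mE.comp (measurable_prodMk_left (x := τ)))
  have e2 : (∫⁻ τ in Ioc 0 t, h τ * expNeg (∫⁻ σ in Ioc τ t, R σ)) +
      ∫⁻ τ in Ioc 0 t, h τ * ∫⁻ σ in Ioc τ t, R σ * expNeg (∫⁻ ρ in Ioc τ σ, R ρ) =
      ∫⁻ τ in Ioc 0 t, h τ := by
    have hB : Measurable fun τ => h τ * expNeg (∫⁻ σ in Ioc τ t, R σ) :=
      hh.mul (mE.comp (measurable_prodMk_right (y := t)))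
    rw [← lintegral_add_left hB]
    refine setLIntegral_congr_fun measurableSet_Ioc fun τ hτ => ?_
    have := expNeg_add_lintegral hR hτ.2
      ((lintegral_mono_set (Ioc_subset_Ioc_left hτ.1.le)).trans_lt hfin.lt_top).ne
    rw [← mul_add, this, mul_one]
  rw [e1, linSol, add_add_add_comm, e2, ← mul_add, expNeg_add_lintegral hR ht hfin, mul_one]

end Scalar

end

end BinaryTernary

namespace BinaryTernary

noncomputable section

variable {d : ℕ} {T : ℝ≥0∞} {K : Kernel} {α β : ℝ}

/-! ### Transport and almost everywhere relations -/

section Transport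

lemma ae_sharp_iff (t : ℝ) {P : Vec d × Vec d → Prop} :
    (∀ᵐ z : Vec d × Vec d, P (z.1 + t • z.2, z.2)) ↔ ∀ᵐ z : Vec d × Vec d, P z := by
  refine ⟨fun h => ?_, ae_shear t⟩
  simpa using ae_shear (-t) h

lemma sharp_le_iff {f g : TimeFun d} {t : ℝ} :
    sharp f t ≤ᵐ[volume] sharp g t ↔ f t ≤ᵐ[volume] g t :=
  ae_sharp_iff t (P := fun z => f t z ≤ g t z)

lemma sharp_eq_iff {f g : TimeFun d} {t : ℝ} :
    sharp f t =ᵐ[volume] sharp g t ↔ f t =ᵐ[volume] g t :=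
  ae_sharp_iff t (P := fun z => f t z = g t z)

lemma sharp_transMax_apply (t : ℝ) (z : Vec d × Vec d) :
    sharp (transMax d α β) t z = maxwellian α β z := congrFun (sharp_transMax α β t) z

lemma sharp_le_maxwellian_iff {f : TimeFun d} {t : ℝ} {c : ℝ≥0∞} :
    (sharp f t ≤ᵐ[volume] fun z => c * maxwellian α β z) ↔
      f t ≤ᵐ[volume] fun z => c * transMax d α β t z := by
  have := sharp_le_iff (f := f) (g := fun t z => c * transMax d α β t z) (t := t)
  rw [← this]
  have e : sharp (fun t z => c * transMax d α β t z) t = fun z => c * maxwellian α β z := by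
    funext z
    rw [← sharp_transMax_apply (α := α) (β := β) t z]; rfl
  rw [e]

lemma sharp_le_add_maxwellian_iff {f g : TimeFun d} {t : ℝ} {c : ℝ≥0∞} :
    (sharp f t ≤ᵐ[volume] fun z => sharp g t z + c * maxwellian α β z) ↔
      f t ≤ᵐ[volume] fun z => g t z + c * transMax d α β t z := by
  have := sharp_le_iff (f := f) (g := fun t z => g t z + c * transMax d α β t z) (t := t)
  rw [← this]
  have e : sharp (fun t z => g t z + c * transMax d α β t z) t =
      fun z => sharp g t z + c * maxwellian α β z := by
    funext z
    rw [← sharp_transMax_apply (α := α) (β := β) t z]; rfl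
  rw [e]

lemma normM_le_iff {f : Phase d} {c : ℝ≥0∞} :
    normM α β f ≤ c ↔ f ≤ᵐ[volume] fun z => c * maxwellian α β z := by
  have h : ∀ z, f z / maxwellian α β z ≤ c ↔ f z ≤ c * maxwellian α β z := fun z =>
    ENNReal.div_le_iff (maxwellian_pos α β z) (maxwellian_ne_top α β z)
  constructor
  · intro hc
    filter_upwards [ENNReal.ae_le_essSup fun z => f z / maxwellian α β z] with z hz
    exact (h z).1 (hz.trans hc)
  · intro hc
    refine essSup_le_of_ae_le c ?_
    filter_upwards [hc] with z hz using (h z).2 hz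

lemma le_normM_mul (f : Phase d) : f ≤ᵐ[volume] fun z => normM α β f * maxwellian α β z :=
  normM_le_iff.1 le_rfl

lemma measurable_sharp {f : TimeFun d} (hf : Measurable (Function.uncurry f)) :
    Measurable (Function.uncurry (sharp f)) :=
  hf.comp (g := Function.uncurry f) (f := fun p : ℝ × Vec d × Vec d =>
    (p.1, (p.2.1 + p.1 • p.2.2, p.2.2))) (by fun_prop)

lemma measurable_sharp_apply {f : TimeFun d} {t : ℝ} (hf : Measurable (f t)) :
    Measurable (sharp f t) :=
  hf.comp (f := fun z : Vec d × Vec d => (z.1 + t • z.2, z.2)) (by fun_prop)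

/-- The exceptional null set of (x, v) may depend on the time. Joint measurability allows the order
of "almost every" to be exchanged, so that scalar arguments run along a fixed characteristic. -/
lemma ae_ae_time {P : ℝ → Vec d × Vec d → Prop} (hP : MeasurableSet {p : ℝ × Vec d × Vec d | P p.1 p.2})
    {s : Set ℝ} (hs : MeasurableSet s) (h : ∀ τ ∈ s, ∀ᵐ z, P τ z) :
    ∀ᵐ z, ∀ᵐ τ ∂(volume.restrict s), P τ z := by
  rw [← Measure.ae_ae_comm hP]
  filter_upwards [ae_restrict_mem hs] with τ hτ using h τ hτ

lemma ae_ae_time_le {A B : TimeFun d} (hA : Measurable (Function.uncurry A))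
    (hB : Measurable (Function.uncurry B)) {s : Set ℝ} (hs : MeasurableSet s)
    (h : ∀ τ ∈ s, A τ ≤ᵐ[volume] B τ) : ∀ᵐ z, ∀ᵐ τ ∂(volume.restrict s), A τ z ≤ B τ z :=
  ae_ae_time (measurableSet_le hA hB) hs h

lemma lintegral_time_swap {A : TimeFun d} (hA : Measurable (Function.uncurry A)) (t : ℝ)
    (S : Set (Vec d × Vec d)) :
    ∫⁻ τ in Ioc 0 t, ∫⁻ z in S, A τ z = ∫⁻ z in S, ∫⁻ τ in Ioc 0 t, A τ z :=
  lintegral_lintegral_swap hA.aemeasurable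

lemma Ioc_subset_timeSet {t : ℝ} (ht : t ∈ timeSet T) : Ioc 0 t ⊆ timeSet T :=
  Ioc_subset_Icc_self.trans (Icc_subset_timeSet ht)

end Transport

/-! ### Bounds of the operators on a ball of `M_{α,β}` -/

section Bounds

variable {f₁ f₂ f₃ g : TimeFun d} {t : ℝ} {m : ℝ≥0∞}

lemma Kernel.L_zero (t : ℝ) (z : Vec d × Vec d) : K.L 0 0 0 t z = 0 := by
  simp [Kernel.L, Kernel.L₂, Kernel.L₃]

lemma Kernel.G_zero (t : ℝ) (z : Vec d × Vec d) : K.G 0 0 0 t z = 0 := by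
  simp [Kernel.G, Kernel.G₂, Kernel.G₃]

/-- The Lipschitz constant `2m + 3m²` of the collision operators on the ball of radius `m`. -/
def lip (m : ℝ≥0∞) : ℝ≥0∞ := 2 * m + 3 * m ^ 2

lemma lip_ne_top (hm : m ≠ ∞) : lip m ≠ ∞ := by unfold lip; finiteness

lemma Kernel.L_le (hK : K.Admissible d) (h₁ : f₁ t ≤ᵐ[volume] fun z => m * transMax d α β t z)
    (h₂ : f₂ t ≤ᵐ[volume] fun z => m * transMax d α β t z)
    (h₃ : f₃ t ≤ᵐ[volume] fun z => m * transMax d α β t z) :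
    K.L f₁ f₂ f₃ t ≤ᵐ[volume] fun z => m * lip m * K.Q d α β t z := by
  have hz : ∀ᵐ z : Vec d × Vec d, (0 : TimeFun d) t z ≤ m * transMax d α β t z :=
    ae_of_all _ fun z => zero_le
  -- The Lipschitz estimate against the zero function, with e = m; the resulting factor m(2m + 3m²)
  -- is not sharp but suffices.
  have := K.L_le_add (g₁ := 0) (g₂ := 0) (g₃ := 0) (e := m) hK
    (by simpa using h₁) (by simpa using h₂) (by simpa using h₃) h₂ h₃ hz hz
  filter_upwards [this] with z hz
  rwa [Kernel.L_zero, zero_add] at hz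

lemma Kernel.G_le (hK : K.Admissible d) (h₁ : f₁ t ≤ᵐ[volume] fun z => m * transMax d α β t z)
    (h₂ : f₂ t ≤ᵐ[volume] fun z => m * transMax d α β t z)
    (h₃ : f₃ t ≤ᵐ[volume] fun z => m * transMax d α β t z) :
    K.G f₁ f₂ f₃ t ≤ᵐ[volume] fun z => m * lip m * K.Q d α β t z := by
  have hz : ∀ᵐ z : Vec d × Vec d, (0 : TimeFun d) t z ≤ m * transMax d α β t z :=
    ae_of_all _ fun z => zero_le
  have := K.G_le_add (g₁ := 0) (g₂ := 0) (g₃ := 0) (e := m) hK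
    (by simpa using h₁) (by simpa using h₂) (by simpa using h₃) h₂ h₃ hz hz
  filter_upwards [this] with z hz
  rwa [Kernel.G_zero, zero_add] at hz

lemma Kernel.R_le (hK : K.Admissible d) (h : g t ≤ᵐ[volume] fun z => m * transMax d α β t z) :
    K.R g t ≤ᵐ[volume] fun z => (m + m ^ 2) * K.R (transMax d α β) t z := by
  have hW := measurable_transMax (d := d) α β
  have h1 : Measurable (Function.uncurry (fun _ _ => 1 : TimeFun d)) := measurable_const
  filter_upwards [ae_second h] with z hz
  have m2 := (K.measurable_loss₂_integrand hK h1 hW).comp (measurable_fix_two t z)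
  have m3 := (K.measurable_loss₃_integrand hK h1 hW hW).comp (measurable_fix_three t z)
  have e2 : K.L₂ (fun _ _ => 1) g t z ≤ m * K.L₂ (fun _ _ => 1) (transMax d α β) t z := by
    have := lintegral_two_le_of_le_add (μ := volume) (ν := surf d) (A := 0)
      (B := fun v₁ ω => K.B₂ (v₁ - z.2) ω)
      (F := fun v₁ _ => 1 * g t (z.1, v₁)) (C := fun v₁ _ => 1 * transMax d α β t (z.1, v₁)) m m2 (by
        filter_upwards [hz] with v₁ hv
        refine ae_of_all _ fun ω => ?_
        simpa using hv)
    simpa [Kernel.L₂] using this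
  have e3 : K.L₃ (fun _ _ => 1) g g t z ≤
      m ^ 2 * K.L₃ (fun _ _ => 1) (transMax d α β) (transMax d α β) t z := by
    have := lintegral_three_le_of_le_add (μ := volume) (ν := volume) (κ := surf2 d) (A := 0)
      (B := fun v₁ v₂ ω => K.B₃ (WithLp.toLp 2 (v₁ - z.2, v₂ - z.2)) ω)
      (F := fun v₁ v₂ _ => 1 * g t (z.1, v₁) * g t (z.1, v₂))
      (C := fun v₁ v₂ _ => 1 * transMax d α β t (z.1, v₁) * transMax d α β t (z.1, v₂))
      (m ^ 2) m3 (by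
        filter_upwards [hz] with v₁ hv
        filter_upwards [hz] with v₂ hv'
        refine ae_of_all _ fun ω => ?_
        have := mul_le_mul' hv hv'
        simp only [one_mul, Pi.zero_apply, zero_add]
        refine this.trans (le_of_eq ?_)
        ring)
    simpa [Kernel.L₃] using this
  refine (add_le_add e2 e3).trans ?_
  rw [Kernel.R, Kernel.L, add_mul, mul_add, mul_add]
  gcongr
  · exact le_self_add
  · exact le_add_self

lemma Kernel.R_mono {g g' : TimeFun d} (h : g t ≤ᵐ[volume] g' t) :
    K.R g t ≤ᵐ[volume] K.R g' t := K.L_mono (ae_of_all _ fun _ => le_rfl) h h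

/-- The bound for the time integral of the collision frequency. -/
def Kernel.freqBound (K : Kernel) (d : ℕ) (α β : ℝ) : ℝ≥0∞ :=
  ENNReal.ofReal (K.Kconst d (dimConst d) β / Real.sqrt α)

lemma Kernel.freqBound_ne_top : K.freqBound d α β ≠ ∞ := ENNReal.ofReal_ne_top

lemma Kernel.sharp_Q (hK : K.Admissible d) (t : ℝ) (z : Vec d × Vec d) :
    sharp (K.Q d α β) t z = maxwellian α β z * sharp (K.R (transMax d α β)) t z := by
  rw [← sharp_transMax_apply (α := α) (β := β) t z]
  exact K.L_eq_mul_R hK _ (measurable_transMax α β).of_uncurry_left _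

lemma Kernel.measurable_Q (hK : K.Admissible d) : Measurable (Function.uncurry (K.Q d α β)) :=
  K.measurable_L hK (measurable_transMax α β) (measurable_transMax α β) (measurable_transMax α β)

/-- Along a characteristic W^# = M is constant in time, so only the frequency is integrated. -/
lemma Kernel.lintegral_sharp_Q_le (hd : 2 ≤ d) (hK : K.Admissible d) (hα : 0 < α) (hβ : 0 < β)
    (t : ℝ) (z : Vec d × Vec d) :
    ∫⁻ τ in Ioc 0 t, sharp (K.Q d α β) τ z ≤ K.freqBound d α β * maxwellian α β z := by
  simp_rw [K.sharp_Q hK]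
  rw [lintegral_const_mul', mul_comm]
  · gcongr
    exact (setLIntegral_le_lintegral _ _).trans (K.lintegral_sharp_R_transMax_le hd hK hα hβ z)
  · exact maxwellian_ne_top _ _ _

lemma maxwellian_eq_mul (α β : ℝ) (z : Vec d × Vec d) : maxwellian α β z =
    ENNReal.ofReal (Real.exp (-α * ‖z.1‖ ^ 2)) * ENNReal.ofReal (Real.exp (-β * ‖z.2‖ ^ 2)) := by
  rw [maxwellian, ← ENNReal.ofReal_mul (Real.exp_nonneg _), ← Real.exp_add]
  congr 2; ring

lemma memL1_maxwellian (hα : 0 < α) (hβ : 0 < β) : MemL1 (maxwellian α β : Phase d) := by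
  refine ⟨measurable_maxwellian α β, ?_⟩
  simp_rw [maxwellian_eq_mul α β]
  have h1 : Measurable fun x : Vec d => ENNReal.ofReal (Real.exp (-α * ‖x‖ ^ 2)) := by fun_prop
  have h2 : Measurable fun x : Vec d => ENNReal.ofReal (Real.exp (-β * ‖x‖ ^ 2)) := by fun_prop
  rw [Measure.volume_eq_prod, lintegral_prod_mul h1.aemeasurable h2.aemeasurable,
    lintegral_gaussian hα, lintegral_gaussian hβ]
  finiteness

/-- Half of the decay in velocity is spent on the linear growth of the frequency. -/
lemma maxwellian_mul_le (hβ : 0 < β) (z : Vec d × Vec d) :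
    maxwellian α β z * ENNReal.ofReal (1 + ‖z.2‖) ≤
      ENNReal.ofReal (2 + 2 / β) * maxwellian α (β / 2) z := by
  rw [maxwellian, maxwellian, ← ENNReal.ofReal_mul (Real.exp_nonneg _),
    ← ENNReal.ofReal_mul (by positivity)]
  refine ENNReal.ofReal_le_ofReal ?_
  set r := ‖z.2‖
  have hr : 0 ≤ r := norm_nonneg _
  have e : Real.exp (-α * ‖z.1‖ ^ 2 - β * r ^ 2) =
      Real.exp (-α * ‖z.1‖ ^ 2 - β / 2 * r ^ 2) * Real.exp (-(β / 2 * r ^ 2)) := by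
    rw [← Real.exp_add]; congr 1; ring
  rw [e, mul_assoc, mul_comm (2 + 2 / β)]
  refine mul_le_mul_of_nonneg_left ?_ (Real.exp_nonneg _)
  have h1 := Real.add_one_le_exp (β / 2 * r ^ 2)
  rw [Real.exp_neg, inv_mul_le_iff₀ (Real.exp_pos _)]
  have h2 : 1 + r ≤ (β / 2 * r ^ 2 + 1) * (2 + 2 / β) := by
    have : (β / 2 * r ^ 2 + 1) * (2 + 2 / β) = r ^ 2 + 2 + β * r ^ 2 + 2 / β := by
      field_simp; ring
    rw [this]
    have : 0 ≤ β * r ^ 2 + 2 / β := by positivity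
    nlinarith [sq_nonneg (r - 1)]
  exact h2.trans (mul_le_mul_of_nonneg_right h1 (by positivity))

lemma Kernel.exists_lintegral_sharp_Q_le (hd : 2 ≤ d) (hK : K.Admissible d) (hα : 0 < α)
    (hβ : 0 < β) : ∃ C : ℝ≥0∞, C ≠ ∞ ∧ ∀ t, ∫⁻ z, sharp (K.Q d α β) t z ≤ C := by
  obtain ⟨C, hC, h⟩ := K.exists_sharp_R_transMax_le hd hK hα hβ
  have hM := memL1_maxwellian (d := d) hα (half_pos hβ)
  refine ⟨C * (ENNReal.ofReal (2 + 2 / β) * ∫⁻ z : Vec d × Vec d, maxwellian α (β / 2) z),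
    ENNReal.mul_ne_top hC (ENNReal.mul_ne_top ENNReal.ofReal_ne_top hM.2), fun t => ?_⟩
  rw [← lintegral_const_mul _ hM.1, ← lintegral_const_mul _ (hM.1.const_mul _)]
  refine lintegral_mono fun z => ?_
  rw [K.sharp_Q hK]
  calc _ ≤ maxwellian α β z * (C * ENNReal.ofReal (1 + ‖z.2‖)) := by gcongr; exact h t z
    _ = C * (maxwellian α β z * ENNReal.ofReal (1 + ‖z.2‖)) := by ring
    _ ≤ _ := mul_le_mul_right (maxwellian_mul_le hβ z) C

lemma memL1_of_le_maxwellian (hα : 0 < α) (hβ : 0 < β) {f : Phase d} (hf : Measurable f)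
    {c : ℝ≥0∞} (hc : c ≠ ∞) (h : f ≤ᵐ[volume] fun z => c * maxwellian α β z) : MemL1 f := by
  have hM := memL1_maxwellian (d := d) hα hβ
  refine MemL1.mono ⟨hM.1.const_mul c, ?_⟩ hf h
  rw [lintegral_const_mul _ hM.1]
  exact ENNReal.mul_ne_top hc hM.2

lemma memLinftyL1_sharp (hd : 2 ≤ d) (hK : K.Admissible d) (hα : 0 < α) (hβ : 0 < β)
    {A : TimeFun d} (hA : Measurable (Function.uncurry A)) {c : ℝ≥0∞} (hc : c ≠ ∞)
    (h : ∀ t ∈ timeSet T, A t ≤ᵐ[volume] fun z => c * K.Q d α β t z) :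
    MemLinftyL1 T (sharp A) := by
  obtain ⟨C, hC, hQ⟩ := K.exists_lintegral_sharp_Q_le hd hK hα hβ
  refine memLinftyL1_of_le (measurable_sharp hA) (ENNReal.mul_ne_top hc hC) fun t ht => ?_
  have h1 := (sharp_le_iff (g := fun t z => c * K.Q d α β t z)).2 (h t ht)
  refine (lintegral_mono_ae h1).trans ?_
  have : ∫⁻ z, sharp (fun t z => c * K.Q d α β t z) t z = c * ∫⁻ z, sharp (K.Q d α β) t z :=
    lintegral_const_mul _ (measurable_sharp (K.measurable_Q hK)).of_uncurry_left
  rw [this]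
  gcongr
  exact hQ t

lemma memLinftyM_sharp {f : TimeFun d} (hf : ∀ t ∈ timeSet T, Measurable (f t)) {c : ℝ≥0∞}
    (hc : c ≠ ∞) (h : ∀ t ∈ timeSet T, f t ≤ᵐ[volume] fun z => c * transMax d α β t z) :
    MemLinftyM T α β (sharp f) :=
  ⟨fun t ht => measurable_sharp_apply (hf t ht), (iSup₂_le fun t ht =>
    normM_le_iff.2 (sharp_le_maxwellian_iff.2 (h t ht))).trans_lt hc.lt_top⟩

lemma le_of_tripleNorm_le {f : TimeFun d} {c : ℝ≥0∞} (h : tripleNorm T α β (sharp f) ≤ c) :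
    ∀ t ∈ timeSet T, f t ≤ᵐ[volume] fun z => c * transMax d α β t z := fun t ht =>
  sharp_le_maxwellian_iff.1 (normM_le_iff.1 ((le_iSup₂ (f := fun t _ => normM α β (sharp f t))
    t ht).trans h))

end Bounds

/-! ### Existence for the linear problem -/

section Existence

/-- The explicit mild solution of the linear problem `∂ₜf + v · ∇ₓf = h - L(f, g, g)`. -/
def Kernel.linearSol (K : Kernel) (f₀ : Phase d) (g h : TimeFun d) : TimeFun d := fun t z =>
  linSol (f₀ (z.1 - t • z.2, z.2)) (fun σ => sharp (K.R g) σ (z.1 - t • z.2, z.2))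
    (fun σ => sharp h σ (z.1 - t • z.2, z.2)) t

variable {f₀ : Phase d} {g h g' h' : TimeFun d} {m c c₀ : ℝ≥0∞} {t : ℝ}

lemma Kernel.sharp_linearSol (K : Kernel) (f₀ : Phase d) (g h : TimeFun d) (t : ℝ)
    (z : Vec d × Vec d) : sharp (K.linearSol f₀ g h) t z =
      linSol (f₀ z) (fun σ => sharp (K.R g) σ z) (fun σ => sharp h σ z) t := by
  simp [sharp, Kernel.linearSol]

lemma Kernel.measurable_linearSol (hK : K.Admissible d) (hf₀ : Measurable f₀)
    (hg : Measurable (Function.uncurry g)) (hh : Measurable (Function.uncurry h)) :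
    Measurable (Function.uncurry (K.linearSol f₀ g h)) := by
  have h1 := measurable_linSol hf₀ (measurable_sharp (K.measurable_R hK hg)) (measurable_sharp hh)
  exact h1.comp (f := fun p : ℝ × Vec d × Vec d => (p.1, (p.2.1 - p.1 • p.2.2, p.2.2)))
    (by fun_prop)

lemma Kernel.linearSol_mono (hK : K.Admissible d) (hg : Measurable (Function.uncurry g))
    (hh : Measurable (Function.uncurry h)) (hg' : Measurable (Function.uncurry g'))
    (hh' : Measurable (Function.uncurry h')) (hgg : ∀ t ∈ timeSet T, g' t ≤ᵐ[volume] g t)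
    (hhh : ∀ t ∈ timeSet T, h t ≤ᵐ[volume] h' t) (ht : t ∈ timeSet T) :
    K.linearSol f₀ g h t ≤ᵐ[volume] K.linearSol f₀ g' h' t := by
  rw [← sharp_le_iff]
  have h1 := ae_ae_time_le (measurable_sharp (K.measurable_R hK hg'))
    (measurable_sharp (K.measurable_R hK hg)) measurableSet_Ioc fun τ hτ =>
    sharp_le_iff.2 (K.R_mono (hgg τ (Ioc_subset_timeSet ht hτ)))
  have h2 := ae_ae_time_le (measurable_sharp hh) (measurable_sharp hh') measurableSet_Ioc
    fun τ hτ => sharp_le_iff.2 (hhh τ (Ioc_subset_timeSet ht hτ))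
  filter_upwards [h1, h2] with z h1 h2
  rw [K.sharp_linearSol, K.sharp_linearSol]
  exact linSol_mono h1 h2

/-- The time integral of a source that is dominated by the Maxwellian collision term. -/
lemma Kernel.lintegral_sharp_le (hd : 2 ≤ d) (hK : K.Admissible d) (hα : 0 < α) (hβ : 0 < β)
    (hh : Measurable (Function.uncurry h))
    (hhc : ∀ t ∈ timeSet T, h t ≤ᵐ[volume] fun z => c * K.Q d α β t z) (ht : t ∈ timeSet T) :
    ∀ᵐ z, ∫⁻ τ in Ioc 0 t, sharp h τ z ≤ c * K.freqBound d α β * maxwellian α β z := by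
  have h2 := ae_ae_time_le (B := sharp fun t z => c * K.Q d α β t z) (measurable_sharp hh)
    (measurable_sharp ((K.measurable_Q hK).const_mul c)) measurableSet_Ioc
    fun τ hτ => sharp_le_iff.2 (hhc τ (Ioc_subset_timeSet ht hτ))
  filter_upwards [h2] with z hz
  have e : ∫⁻ τ in Ioc 0 t, sharp (fun t z => c * K.Q d α β t z) τ z =
      c * ∫⁻ τ in Ioc 0 t, sharp (K.Q d α β) τ z :=
    lintegral_const_mul _ (measurable_sharp (K.measurable_Q hK)).of_uncurry_right
  refine (lintegral_mono_ae hz).trans ?_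
  rw [e, mul_assoc]
  gcongr
  exact K.lintegral_sharp_Q_le hd hK hα hβ t z

lemma Kernel.linearSol_le (hd : 2 ≤ d) (hK : K.Admissible d) (hα : 0 < α) (hβ : 0 < β)
    (hf₀ : f₀ ≤ᵐ[volume] fun z => c₀ * maxwellian α β z)
    (hh : Measurable (Function.uncurry h))
    (hhc : ∀ t ∈ timeSet T, h t ≤ᵐ[volume] fun z => c * K.Q d α β t z) (ht : t ∈ timeSet T) :
    K.linearSol f₀ g h t ≤ᵐ[volume] fun z =>
      (c₀ + c * K.freqBound d α β) * transMax d α β t z := by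
  rw [← sharp_le_maxwellian_iff]
  filter_upwards [hf₀, K.lintegral_sharp_le hd hK hα hβ hh hhc ht] with z h1 h2
  rw [K.sharp_linearSol, add_mul]
  exact (linSol_le _ _ _ _).trans (add_le_add h1 h2)

/-- The scalar identity holds on almost every characteristic and is then integrated over `S`. It
needs a finite time integral of R(g)^#, which follows from g ≤ mW and the dispersive bound. -/
lemma Kernel.integralForm_linearSol (hd : 2 ≤ d) (hK : K.Admissible d) (hα : 0 < α) (hβ : 0 < β)
    (hf₀ : Measurable f₀) (hg : Measurable (Function.uncurry g))
    (hh : Measurable (Function.uncurry h)) (hm : m ≠ ∞)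
    (hgm : ∀ t ∈ timeSet T, g t ≤ᵐ[volume] fun z => m * transMax d α β t z) :
    IntegralForm T f₀ (sharp (K.linearSol f₀ g h)) (sharp (K.L (K.linearSol f₀ g h) g g))
      (sharp h) := by
  intro t ht S hS
  have mF := K.measurable_linearSol hK hf₀ hg hh
  have mR := measurable_sharp (K.measurable_R hK hg)
  have mRW := measurable_sharp (K.measurable_R hK (measurable_transMax (d := d) α β))
  have hR := ae_ae_time_le (B := sharp fun t z => (m + m ^ 2) * K.R (transMax d α β) t z) mR
    (measurable_sharp ((K.measurable_R hK (measurable_transMax α β)).const_mul _))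
    measurableSet_Ioc
    fun τ hτ => sharp_le_iff.2 (K.R_le hK (hgm τ (Ioc_subset_timeSet ht hτ)))
  have mL := measurable_sharp (K.measurable_L hK mF hg hg)
  have mh := measurable_sharp hh
  rw [lintegral_time_swap mL, lintegral_time_swap mh, ← lintegral_add_right, ← lintegral_add_right]
  rotate_left
  · exact mh.lintegral_prod_left'
  · exact mL.lintegral_prod_left'
  refine lintegral_congr_ae (ae_restrict_of_ae ?_)
  filter_upwards [hR] with z hz
  have hfin : ∫⁻ σ in Ioc 0 t, sharp (K.R g) σ z ≠ ∞ := by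
    refine ne_of_lt ((lintegral_mono_ae hz).trans_lt ?_)
    have e : ∫⁻ τ in Ioc 0 t, sharp (fun t z => (m + m ^ 2) * K.R (transMax d α β) t z) τ z =
        (m + m ^ 2) * ∫⁻ τ in Ioc 0 t, sharp (K.R (transMax d α β)) τ z :=
      lintegral_const_mul _ mRW.of_uncurry_right
    rw [e]
    refine ENNReal.mul_lt_top (by finiteness) ((setLIntegral_le_lintegral _ _).trans_lt ?_)
    exact (K.lintegral_sharp_R_transMax_le hd hK hα hβ z).trans_lt ENNReal.ofReal_lt_top
  have key := linSol_add_lintegral (f₀ := f₀ z) (h := fun σ => sharp h σ z) mR.of_uncurry_right mh.of_uncurry_right ht.1 hfin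
  have e : ∀ σ, sharp (K.L (K.linearSol f₀ g h) g g) σ z =
      linSol (f₀ z) (fun σ => sharp (K.R g) σ z) (fun σ => sharp h σ z) σ * sharp (K.R g) σ z :=
    fun σ => by
      rw [← K.sharp_linearSol]
      exact K.L_eq_mul_R hK _ hg.of_uncurry_left _
  rw [K.sharp_linearSol, lintegral_congr e]
  exact key

end Existence

/-! ### From the integral form to mild solutions -/

section Mild

variable {f₀ : Phase d} {F P Q g h : TimeFun d} {m c c₀ : ℝ≥0∞}

lemma IntegralForm.initial (hT : 0 < T) (h : IntegralForm T f₀ F P Q) (hf₀ : MemL1 f₀)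
    (hF : MemL1 (F 0)) : F 0 =ᵐ[volume] f₀ := by
  refine ae_eq_of_toL1_eq hF hf₀ (eq_of_setInt_eq fun S hS => ?_)
  have := h 0 (zero_mem_timeSet hT) S hS
  simp only [Ioc_self, Measure.restrict_empty, lintegral_zero_measure, add_zero] at this
  rw [setInt_toL1 hF, setInt_toL1 hf₀, this]

lemma Kernel.isLinearMildSolution_linearSol (hT : 0 < T) (hd : 2 ≤ d) (hK : K.Admissible d)
    (hα : 0 < α) (hβ : 0 < β) (hf₀ : Measurable f₀) (hc₀ : c₀ ≠ ∞)
    (hf₀c : f₀ ≤ᵐ[volume] fun z => c₀ * maxwellian α β z)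
    (hg : Measurable (Function.uncurry g)) (hh : Measurable (Function.uncurry h)) (hm : m ≠ ∞)
    (hgm : ∀ t ∈ timeSet T, g t ≤ᵐ[volume] fun z => m * transMax d α β t z) (hc : c ≠ ∞)
    (hhc : ∀ t ∈ timeSet T, h t ≤ᵐ[volume] fun z => c * K.Q d α β t z) :
    IsLinearMildSolution K T f₀ g h (K.linearSol f₀ g h) := by
  set F := K.linearSol f₀ g h
  have mF : Measurable (Function.uncurry F) := K.measurable_linearSol hK hf₀ hg hh
  have hF : ∀ t ∈ timeSet T, F t ≤ᵐ[volume] fun z =>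
      (c₀ + c * K.freqBound d α β) * transMax d α β t z :=
    fun t ht => K.linearSol_le hd hK hα hβ hf₀c hh hhc ht
  have hC : c₀ + c * K.freqBound d α β ≠ ∞ :=
    ENNReal.add_ne_top.2 ⟨hc₀, ENNReal.mul_ne_top hc K.freqBound_ne_top⟩
  have hI := K.integralForm_linearSol hd hK hα hβ hf₀ hg hh hm hgm
  have mL1 : ∀ t ∈ timeSet T, MemL1 (sharp F t) := fun t ht =>
    memL1_of_le_maxwellian hα hβ (measurable_sharp mF).of_uncurry_left hC
      (sharp_le_maxwellian_iff.2 (hF t ht))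
  have hf₀1 := memL1_of_le_maxwellian hα hβ hf₀ hc₀ hf₀c
  set M := max (c₀ + c * K.freqBound d α β) m
  have hM : M ≠ ∞ := (max_lt hC.lt_top hm.lt_top).ne
  have hL : MemLinftyL1 T (sharp (K.L F g g)) := by
    refine memLinftyL1_sharp hd hK hα hβ (K.measurable_L hK mF hg hg)
      (c := M * lip M) (ENNReal.mul_ne_top hM (lip_ne_top hM)) fun t ht => ?_
    refine K.L_le hK ((hF t ht).trans (ae_of_all _ fun z => ?_))
      ((hgm t ht).trans (ae_of_all _ fun z => ?_)) ((hgm t ht).trans (ae_of_all _ fun z => ?_))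
    · exact mul_le_mul_left (le_max_left _ _) _
    · exact mul_le_mul_left (le_max_right _ _) _
    · exact mul_le_mul_left (le_max_right _ _) _
  have hS : MemLinftyL1 T (sharp h) := memLinftyL1_sharp hd hK hα hβ hh hc hhc
  have hE := (integralForm_iff hf₀1 mL1 hL.memL1locL1 hS.memL1locL1).1 hI
  exact
    { measurable := fun t _ => mF.of_uncurry_left
      continuous := memC0L1_of_integral mL1 hL.memL1locL1 hS.memL1locL1 hE
      loss := hL.memL1locL1
      equation := weakDeriv_of_integral hL.memL1locL1 hS.memL1locL1 hE
      initial := hI.initial hT hf₀1 (mL1 0 (zero_mem_timeSet hT)) }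

end Mild

end

end BinaryTernary

namespace BinaryTernary

noncomputable section

variable {d : ℕ} {T : ℝ≥0∞} {K : Kernel} {α β : ℝ}

/-! ### Uniqueness for the linear problem -/

lemma eq_zero_of_le_mul_integral {φ : ℝ → ℝ} {t C : ℝ} (ht : 0 ≤ t) (hφ : ContinuousOn φ (Icc 0 t))
    (h0 : ∀ s ∈ Icc 0 t, 0 ≤ φ s) (h : ∀ s ∈ Icc 0 t, φ s ≤ C * ∫ x in (0 : ℝ)..s, φ x) : φ t = 0 := by
  -- Clamping the argument to [0, t] gives a function continuous on the line, whose primitive is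
  -- differentiable everywhere. Grönwall's inequality is then applied to the primitive.
  set ψ : ℝ → ℝ := fun x => φ (max 0 (min x t)) with hψ
  have hψc : Continuous ψ := hφ.comp_continuous (by fun_prop) fun x =>
    ⟨le_max_left _ _, max_le ht (min_le_right _ _)⟩
  have hψφ : ∀ s ∈ Icc 0 t, ψ s = φ s := fun s hs => by
    simp only [hψ]; rw [min_eq_left hs.2, max_eq_right hs.1]
  have hint : ∀ s ∈ Icc 0 t, ∫ x in (0 : ℝ)..s, ψ x = ∫ x in (0 : ℝ)..s, φ x := fun s hs => by
    refine intervalIntegral.integral_congr fun x hx => hψφ x ?_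
    rw [uIcc_of_le hs.1] at hx
    exact ⟨hx.1, hx.2.trans hs.2⟩
  have hd : ∀ s, HasDerivAt (fun s => ∫ x in (0 : ℝ)..s, ψ x) (ψ s) s := fun s =>
    (hψc.integral_hasStrictDerivAt 0 s).hasDerivAt
  have hΦ0 : ∀ s ∈ Icc 0 t, 0 ≤ ∫ x in (0 : ℝ)..s, ψ x := fun s hs =>
    intervalIntegral.integral_nonneg hs.1 fun x hx => by
      have hx' : x ∈ Icc 0 t := ⟨hx.1, hx.2.trans hs.2⟩
      rw [hψφ x hx']; exact h0 x hx'
  have key := norm_le_gronwallBound_of_norm_deriv_right_le (f := fun s => ∫ x in (0 : ℝ)..s, ψ x)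
    (f' := ψ) (δ := 0) (K := C) (ε := 0) (a := 0) (b := t)
    (fun s _ => (hd s).continuousAt.continuousWithinAt) (fun s _ => (hd s).hasDerivWithinAt)
    (by simp) (fun s hs => by
      have hs' := Ico_subset_Icc_self hs
      rw [Real.norm_of_nonneg (hΦ0 s hs'), hψφ s hs', Real.norm_of_nonneg (h0 s hs'), add_zero,
        hint s hs']
      exact h s hs') t (right_mem_Icc.2 ht)
  rw [gronwallBound_ε0_δ0, norm_le_zero_iff, hint t (right_mem_Icc.2 ht)] at key
  have := h t (right_mem_Icc.2 ht)
  rw [key, mul_zero] at this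
  exact this.antisymm (h0 t (right_mem_Icc.2 ht))

/-- Restriction to a set, as an operator on `L¹`. -/
def restrL1 (S : Set (Vec d × Vec d)) :
    PhaseL1 d →L[ℝ] Lp ℝ 1 ((volume : Measure (Vec d × Vec d)).restrict S) :=
  LpToLpRestrictCLM (Vec d × Vec d) ℝ ℝ volume 1 S

lemma coeFn_restrL1_toL1_sub {f g : Phase d} (hf : MemL1 f) (hg : MemL1 g)
    (S : Set (Vec d × Vec d)) : restrL1 S (toL1 f - toL1 g) =ᵐ[volume.restrict S]
      fun z => (f z).toReal - (g z).toReal := by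
  filter_upwards [LpToLpRestrictCLM_coeFn ℝ S (toL1 f - toL1 g),
    ae_restrict_of_ae (Lp.coeFn_sub (toL1 f) (toL1 g)), ae_restrict_of_ae (coeFn_toL1 hf),
    ae_restrict_of_ae (coeFn_toL1 hg)] with z h1 h2 h3 h4
  rw [restrL1, h1, h2, Pi.sub_apply, h3, h4]

lemma norm_restrL1_sub_le {f g p q r : Phase d} {S : Set (Vec d × Vec d)} (hS : MeasurableSet S)
    {C : ℝ≥0∞} (hC : C ≠ ∞) (hf : MemL1 f) (hg : MemL1 g) (hp : MemL1 p) (hq : MemL1 q)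
    (hpr : ∀ᵐ z, p z = f z * r z) (hqr : ∀ᵐ z, q z = g z * r z)
    (hr : ∀ᵐ z, z ∈ S → r z ≤ C) :
    ‖restrL1 S (toL1 q - toL1 p)‖ ≤ C.toReal * ‖restrL1 S (toL1 f - toL1 g)‖ := by
  refine Lp.norm_le_mul_norm_of_ae_le_mul ?_
  filter_upwards [coeFn_restrL1_toL1_sub hf hg S, coeFn_restrL1_toL1_sub hq hp S,
    ae_restrict_of_ae hpr, ae_restrict_of_ae hqr, ae_restrict_of_ae hr, ae_restrict_mem hS]
    with z h1 h2 h3 h4 h5 h6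
  rw [h1, h2, h3, h4, ENNReal.toReal_mul, ENNReal.toReal_mul, ← sub_mul, norm_mul, mul_comm,
    norm_sub_rev]
  refine mul_le_mul_of_nonneg_right ?_ (norm_nonneg _)
  rw [Real.norm_of_nonneg ENNReal.toReal_nonneg]
  exact ENNReal.toReal_mono hC (h5 h6)

/-- Multiplication by `r` is unbounded on L¹, so Grönwall fails globally. The loss is local,
however: the restriction of the difference to `S N` satisfies an inequality that involves only `S
N`, where `r` is bounded. Each restriction vanishes, and the sets cover the space. -/
lemma ae_eq_of_linear_integral_eq {F F' P P' r : TimeFun d} {S : ℕ → Set (Vec d × Vec d)}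
    (hS : ∀ N, MeasurableSet (S N)) (hSU : ∀ z, ∃ N, z ∈ S N)
    (hF : MemC0L1 T F) (hF' : MemC0L1 T F') (hP : MemL1locL1 T P) (hP' : MemL1locL1 T P')
    (hPr : ∀ t ∈ timeSet T, ∀ᵐ z, P t z = F t z * r t z)
    (hPr' : ∀ t ∈ timeSet T, ∀ᵐ z, P' t z = F' t z * r t z)
    (hr : ∀ N, ∃ C : ℝ≥0∞, C ≠ ∞ ∧ ∀ t ∈ timeSet T, ∀ᵐ z, z ∈ S N → r t z ≤ C)
    (h : ∀ t ∈ timeSet T, toL1 (F t) + ∫ τ in (0 : ℝ)..t, toL1 (P τ) =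
      toL1 (F' t) + ∫ τ in (0 : ℝ)..t, toL1 (P' τ)) {t : ℝ} (ht : t ∈ timeSet T) :
    F t =ᵐ[volume] F' t := by
  have hzero : ∀ N, restrL1 (S N) (toL1 (F t) - toL1 (F' t)) = 0 := by
    intro N
    obtain ⟨C, hC, hrC⟩ := hr N
    have hsub := Icc_subset_timeSet ht
    have hcont : ContinuousOn (fun s => ‖restrL1 (S N) (toL1 (F s) - toL1 (F' s))‖) (Icc 0 t) :=
      ((restrL1 (S N)).continuous.comp_continuousOn ((hF.2.sub hF'.2).mono hsub)).norm
    refine norm_eq_zero.1 (eq_zero_of_le_mul_integral (C := C.toReal) ht.1 hcont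
      (fun _ _ => norm_nonneg _) fun s hs => ?_)
    have hs' := hsub hs
    have i1 := LocallyIntegrableOn.intervalIntegrable_timeSet hP.2.2 hs'
    have i2 := LocallyIntegrableOn.intervalIntegrable_timeSet hP'.2.2 hs'
    have e : toL1 (F s) - toL1 (F' s) = ∫ τ in (0 : ℝ)..s, (toL1 (P' τ) - toL1 (P τ)) := by
      rw [intervalIntegral.integral_sub i2 i1]
      have := h s hs'
      rw [sub_eq_sub_iff_add_eq_add, this, add_comm]
    rw [e, ← (restrL1 (S N)).intervalIntegral_comp_comm (i2.sub i1),
      ← intervalIntegral.integral_const_mul]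
    refine intervalIntegral.norm_integral_le_of_norm_le hs.1 ?_ ?_
    · have hsub' : Ioc 0 s ⊆ timeSet T := Ioc_subset_timeSet hs'
      filter_upwards [(ae_restrict_iff' measurableSet_timeSet).1 hP.2.1,
        (ae_restrict_iff' measurableSet_timeSet).1 hP'.2.1] with τ h1 h2 hτ
      have hτ' := hsub' hτ
      exact norm_restrL1_sub_le (hS N) hC (hF.1 τ hτ') (hF'.1 τ hτ') (h1 hτ') (h2 hτ')
        (hPr τ hτ') (hPr' τ hτ') (hrC τ hτ')
    · refine ContinuousOn.intervalIntegrable (continuousOn_const.mul ?_)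
      rw [uIcc_of_le hs.1]
      exact hcont.mono (Icc_subset_Icc_right hs.2)
  have h1 : ∀ᵐ z, ∀ N, z ∈ S N → (F t z).toReal - (F' t z).toReal = 0 := by
    rw [ae_all_iff]
    intro N
    rw [← ae_restrict_iff' (hS N)]
    have h2 := coeFn_restrL1_toL1_sub (hF.1 t ht) (hF'.1 t ht) (S N)
    rw [hzero N] at h2
    filter_upwards [h2, Lp.coeFn_zero ℝ 1 (volume.restrict (S N))] with z a b
    rw [← a, b, Pi.zero_apply]
  filter_upwards [h1, (hF.1 t ht).ae_lt_top, (hF'.1 t ht).ae_lt_top] with z hz a b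
  obtain ⟨N, hN⟩ := hSU z
  rw [← ENNReal.toReal_eq_toReal_iff' a.ne b.ne]
  exact sub_eq_zero.1 (hz N hN)

section Linear

variable {f₀ : Phase d} {f f' g h g' h' : TimeFun d} {m : ℝ≥0∞}

/-- Both solutions have the same source and initial value, so their integral equations have the same
right side. The sets |v| ≤ N are those on which R(g) ≤ (m + m²)R(W) is bounded uniformly in time. -/
lemma IsLinearMildSolution.ae_eq (hT : 0 < T) (hd : 2 ≤ d) (hK : K.Admissible d) (hα : 0 < α)
    (hβ : 0 < β) (hg : ∀ t ∈ timeSet T, Measurable (g t)) (hm : m ≠ ∞)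
    (hgm : ∀ t ∈ timeSet T, g t ≤ᵐ[volume] fun z => m * transMax d α β t z)
    (hh : MemL1locL1 T (sharp h)) (hf : IsLinearMildSolution K T f₀ g h f)
    (hf' : IsLinearMildSolution K T f₀ g h f') {t : ℝ} (ht : t ∈ timeSet T) :
    f t =ᵐ[volume] f' t := by
  rw [← sharp_eq_iff]
  obtain ⟨C, hC, hR⟩ := K.exists_sharp_R_transMax_le hd hK hα hβ
  have hP : ∀ f : TimeFun d, ∀ t ∈ timeSet T, ∀ᵐ z,
      sharp (K.L f g g) t z = sharp f t z * sharp (K.R g) t z := fun f t ht =>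
    ae_of_all _ fun z => K.L_eq_mul_R hK f (hg t ht) _
  refine ae_eq_of_linear_integral_eq (S := fun N : ℕ => {z | ‖z.2‖ ≤ N}) (r := sharp (K.R g))
    (fun N => measurableSet_le (by fun_prop) measurable_const) (fun z => exists_nat_ge ‖z.2‖)
    hf.continuous hf'.continuous hf.loss hf'.loss (hP f) (hP f')
    (fun N => ⟨(m + m ^ 2) * (C * ENNReal.ofReal (1 + N)), by finiteness, fun t ht => ?_⟩)
    (fun t ht => ?_) ht
  · have h1 := sharp_le_iff (g := fun t z => (m + m ^ 2) * K.R (transMax d α β) t z) |>.2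
      (K.R_le hK (hgm t ht))
    filter_upwards [h1] with z hz hzN
    refine hz.trans ?_
    have h2 : sharp (K.R (transMax d α β)) t z ≤ C * ENNReal.ofReal (1 + N) := by
      refine (hR t z).trans ?_
      gcongr
    exact mul_le_mul_right h2 _
  · have h0 := zero_mem_timeSet hT
    rw [integral_of_weakDeriv hf.continuous hf.loss hh hf.equation ht,
      integral_of_weakDeriv hf'.continuous hf'.loss hh hf'.equation ht,
      toL1_congr (hf.continuous.1 0 h0).1 (hf'.continuous.1 0 h0).1
        (hf.initial.trans hf'.initial.symm)]

/-- Uniqueness determines iterates only up to null sets, so each next linear problem has to tolerate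
such changes of its data. -/
lemma IsLinearMildSolution.congr (hK : K.Admissible d) (hf : IsLinearMildSolution K T f₀ g h f)
    (hg : ∀ t ∈ timeSet T, Measurable (g t)) (hg' : ∀ t ∈ timeSet T, Measurable (g' t))
    (hh : ∀ t ∈ timeSet T, Measurable (h t)) (hh' : ∀ t ∈ timeSet T, Measurable (h' t))
    (hgg : ∀ t ∈ timeSet T, g t =ᵐ[volume] g' t) (hhh : ∀ t ∈ timeSet T, h t =ᵐ[volume] h' t) :
    IsLinearMildSolution K T f₀ g' h' f := by
  have mL : ∀ t ∈ timeSet T, Measurable (sharp (K.L f g g) t) := fun t ht =>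
    measurable_sharp_apply (K.measurable_L_apply hK (hf.measurable t ht) (hg t ht) (hg t ht))
  have mL' : ∀ t ∈ timeSet T, Measurable (sharp (K.L f g' g') t) := fun t ht =>
    measurable_sharp_apply (K.measurable_L_apply hK (hf.measurable t ht) (hg' t ht) (hg' t ht))
  have hL : ∀ t ∈ timeSet T, sharp (K.L f g' g') t =ᵐ[volume] sharp (K.L f g g) t :=
    fun t ht => sharp_eq_iff.2 (K.L_congr EventuallyEq.rfl (hgg t ht).symm (hgg t ht).symm)
  exact
    { measurable := hf.measurable
      continuous := hf.continuous
      loss := hf.loss.congr mL' hL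
      equation := hf.equation.congr (fun _ _ => rfl)
        (fun t ht => toL1_congr (mL' t ht) (mL t ht) (hL t ht))
        fun t ht => toL1_congr (measurable_sharp_apply (hh' t ht)) (measurable_sharp_apply (hh t ht))
          (sharp_eq_iff.2 (hhh t ht).symm)
      initial := hf.initial }

end Linear

end

end BinaryTernary

namespace BinaryTernary

noncomputable section

variable {d : ℕ} {T : ℝ≥0∞} {K : Kernel} {α β : ℝ}

/-! ### Stability of the integral form -/

lemma le_of_forall_le_add_mul {δ : ℕ → ℝ≥0∞} (hδ : Tendsto δ atTop (𝓝 0)) {a b c : ℝ≥0∞}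
    (hc : c ≠ ∞) (h : ∀ n, a ≤ b + δ n * c) : a ≤ b := by
  have h1 : Tendsto (fun n => b + δ n * c) atTop (𝓝 (b + 0 * c)) :=
    tendsto_const_nhds.add (ENNReal.Tendsto.mul_const hδ (Or.inr hc))
  rw [zero_mul, add_zero] at h1
  exact ge_of_tendsto' h1 h

section Stability

variable {f₀ : Phase d} {F F' P P' Q Q' : TimeFun d} {c δ : ℝ≥0∞} {t : ℝ}

/-- Comparison of time integrals over a set, with an error measured by the collision term of the
Maxwellian. -/
lemma Kernel.lintegral_time_le_add (hd : 2 ≤ d) (hK : K.Admissible d) (hα : 0 < α) (hβ : 0 < β)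
    (h : ∀ t ∈ timeSet T, P t ≤ᵐ[volume] fun z => P' t z + c * K.Q d α β t z)
    (ht : t ∈ timeSet T) (S : Set (Vec d × Vec d)) :
    ∫⁻ τ in Ioc 0 t, ∫⁻ z in S, sharp P τ z ≤ (∫⁻ τ in Ioc 0 t, ∫⁻ z in S, sharp P' τ z) +
      c * (K.freqBound d α β * ∫⁻ z in S, maxwellian α β z) := by
  have mQ := measurable_sharp (K.measurable_Q (α := α) (β := β) hK)
  have mQS : Measurable fun τ => ∫⁻ z in S, sharp (K.Q d α β) τ z := mQ.lintegral_prod_right'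
  have h1 : ∀ τ ∈ Ioc 0 t, ∫⁻ z in S, sharp P τ z ≤
      (∫⁻ z in S, sharp P' τ z) + c * ∫⁻ z in S, sharp (K.Q d α β) τ z := fun τ hτ => by
    have h2 := sharp_le_iff (g := fun t z => P' t z + c * K.Q d α β t z) |>.2
      (h τ (Ioc_subset_timeSet ht hτ))
    rw [← lintegral_const_mul _ mQ.of_uncurry_left,
      ← lintegral_add_right _ (mQ.of_uncurry_left.const_mul c)]
    exact lintegral_mono_ae (ae_restrict_of_ae h2)
  refine (setLIntegral_mono' measurableSet_Ioc h1).trans ?_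
  rw [lintegral_add_right _ (mQS.const_mul c), lintegral_const_mul _ mQS, lintegral_time_swap mQ,
    ← lintegral_const_mul _ (measurable_maxwellian α β)]
  gcongr
  exact K.lintegral_sharp_Q_le hd hK hα hβ t _

/-- The stability estimate for the integral form. -/
lemma IntegralForm.le_add (hd : 2 ≤ d) (hK : K.Admissible d) (hα : 0 < α) (hβ : 0 < β)
    (hI : IntegralForm T f₀ (sharp F) (sharp P) (sharp Q))
    (hI' : IntegralForm T f₀ (sharp F') (sharp P') (sharp Q'))
    (hF : ∀ t ∈ timeSet T, Measurable (F t))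
    (hPf : MemL1locL1 T (sharp P))
    (hP : ∀ t ∈ timeSet T, P' t ≤ᵐ[volume] fun z => P t z + c * K.Q d α β t z)
    (hQ : ∀ t ∈ timeSet T, Q t ≤ᵐ[volume] fun z => Q' t z + c * K.Q d α β t z)
    (ht : t ∈ timeSet T) :
    F t ≤ᵐ[volume] fun z => F' t z + 2 * c * K.freqBound d α β * transMax d α β t z := by
  rw [← sharp_le_add_maxwellian_iff]
  have mM := measurable_maxwellian (d := d) α β
  refine ae_le_of_forall_setLIntegral_le_of_sigmaFinite (measurable_sharp_apply (hF t ht))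
    fun S hS _ => ?_
  rw [lintegral_add_right _ (mM.const_mul _), lintegral_const_mul _ mM]
  have hfin := (hPf.setInt_integral ht S).1
  -- The finite loss integral of `F` is added to both sides in place of a subtraction. One error `E`
  -- comes from comparing the gains and one from comparing the losses, whence the factor 2.
  refine (ENNReal.add_le_add_iff_right hfin).1 ?_
  set E := c * (K.freqBound d α β * ∫⁻ z in S, maxwellian α β z) with hE
  have h1 := K.lintegral_time_le_add hd hK hα hβ hP ht S
  have h2 := K.lintegral_time_le_add hd hK hα hβ hQ ht S
  calc (∫⁻ z in S, sharp F t z) + ∫⁻ τ in Ioc 0 t, ∫⁻ z in S, sharp P τ z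
      = (∫⁻ z in S, f₀ z) + ∫⁻ τ in Ioc 0 t, ∫⁻ z in S, sharp Q τ z := hI t ht S hS
    _ ≤ (∫⁻ z in S, f₀ z) + ((∫⁻ τ in Ioc 0 t, ∫⁻ z in S, sharp Q' τ z) + E) := by gcongr
    _ = ((∫⁻ z in S, sharp F' t z) + ∫⁻ τ in Ioc 0 t, ∫⁻ z in S, sharp P' τ z) + E := by
        rw [hI' t ht S hS, add_assoc]
    _ ≤ ((∫⁻ z in S, sharp F' t z) + ((∫⁻ τ in Ioc 0 t, ∫⁻ z in S, sharp P τ z) + E)) + E := by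
        gcongr
    _ = _ := by rw [hE]; ring

/-- The integral form is stable under approximation. -/
lemma integralForm_of_approx (hd : 2 ≤ d) (hK : K.Admissible d) (hα : 0 < α) (hβ : 0 < β)
    {Fn Pn Qn : ℕ → TimeFun d} {δ : ℕ → ℝ≥0∞} (hδ : Tendsto δ atTop (𝓝 0)) (hc : c ≠ ∞)
    (hI : ∀ n, IntegralForm T f₀ (sharp (Fn n)) (sharp (Pn n)) (sharp (Qn n)))
    (h1 : ∀ n, ∀ t ∈ timeSet T, F t ≤ᵐ[volume] fun z => Fn n t z + δ n * transMax d α β t z)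
    (h1' : ∀ n, ∀ t ∈ timeSet T, Fn n t ≤ᵐ[volume] fun z => F t z + δ n * transMax d α β t z)
    (h2 : ∀ n, ∀ t ∈ timeSet T, P t ≤ᵐ[volume] fun z => Pn n t z + δ n * c * K.Q d α β t z)
    (h2' : ∀ n, ∀ t ∈ timeSet T, Pn n t ≤ᵐ[volume] fun z => P t z + δ n * c * K.Q d α β t z)
    (h3 : ∀ n, ∀ t ∈ timeSet T, Q t ≤ᵐ[volume] fun z => Qn n t z + δ n * c * K.Q d α β t z)
    (h3' : ∀ n, ∀ t ∈ timeSet T, Qn n t ≤ᵐ[volume] fun z => Q t z + δ n * c * K.Q d α β t z) :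
    IntegralForm T f₀ (sharp F) (sharp P) (sharp Q) := by
  intro t ht S hS
  have mM := measurable_maxwellian (d := d) α β
  have hA : ∀ {A B : TimeFun d} {e : ℝ≥0∞},
      (A t ≤ᵐ[volume] fun z => B t z + e * transMax d α β t z) →
      ∫⁻ z in S, sharp A t z ≤ (∫⁻ z in S, sharp B t z) + e * ∫⁻ z in S, maxwellian α β z := by
    intro A B e h
    rw [← lintegral_const_mul _ mM, ← lintegral_add_right _ (mM.const_mul _)]
    exact lintegral_mono_ae (ae_restrict_of_ae (sharp_le_add_maxwellian_iff.2 h))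
  set M := ∫⁻ z in S, maxwellian α β z with hM
  have hMf : M ≠ ∞ := (memL1_maxwellian hα hβ).setLIntegral_ne_top S
  set E := c * (K.freqBound d α β * M) with hE
  have hEf : E ≠ ∞ := ENNReal.mul_ne_top hc (ENNReal.mul_ne_top K.freqBound_ne_top hMf)
  have hCf : M + 2 * E ≠ ∞ := by finiteness
  -- Each inequality is routed through the n-th equation and costs δ_n M for the solution and δ_n E
  -- for each of the two time integrals; these errors vanish as n grows.
  refine le_antisymm (le_of_forall_le_add_mul hδ hCf fun n => ?_)
    (le_of_forall_le_add_mul hδ hCf fun n => ?_)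
  · calc _ ≤ ((∫⁻ z in S, sharp (Fn n) t z) + δ n * M) +
          ((∫⁻ τ in Ioc 0 t, ∫⁻ z in S, sharp (Pn n) τ z) +
            δ n * c * (K.freqBound d α β * M)) :=
          add_le_add (hA (h1 n t ht)) (K.lintegral_time_le_add hd hK hα hβ (h2 n) ht S)
      _ = ((∫⁻ z in S, sharp (Fn n) t z) + ∫⁻ τ in Ioc 0 t, ∫⁻ z in S, sharp (Pn n) τ z) +
            (δ n * M + δ n * E) := by rw [hE]; ring
      _ = (∫⁻ z in S, f₀ z) + (∫⁻ τ in Ioc 0 t, ∫⁻ z in S, sharp (Qn n) τ z) +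
            (δ n * M + δ n * E) := by rw [hI n t ht S hS]
      _ ≤ (∫⁻ z in S, f₀ z) + ((∫⁻ τ in Ioc 0 t, ∫⁻ z in S, sharp Q τ z) +
            δ n * c * (K.freqBound d α β * M)) + (δ n * M + δ n * E) := by
          gcongr
          exact K.lintegral_time_le_add hd hK hα hβ (h3' n) ht S
      _ = _ := by rw [hE]; ring
  · calc _ ≤ (∫⁻ z in S, f₀ z) + ((∫⁻ τ in Ioc 0 t, ∫⁻ z in S, sharp (Qn n) τ z) +
            δ n * c * (K.freqBound d α β * M)) := by
          gcongr
          exact K.lintegral_time_le_add hd hK hα hβ (h3 n) ht S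
      _ = (∫⁻ z in S, sharp (Fn n) t z) + (∫⁻ τ in Ioc 0 t, ∫⁻ z in S, sharp (Pn n) τ z) +
            δ n * E := by rw [hI n t ht S hS, hE]; ring
      _ ≤ ((∫⁻ z in S, sharp F t z) + δ n * M) + ((∫⁻ τ in Ioc 0 t, ∫⁻ z in S, sharp P τ z) +
            δ n * c * (K.freqBound d α β * M)) + δ n * E := by
          gcongr
          · exact hA (h1' n t ht)
          · exact K.lintegral_time_le_add hd hK hα hβ (h2' n) ht S
      _ = _ := by rw [hE]; ring

end Stability

/-! ### The contraction factor -/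

/-- The factor by which one step of the iteration contracts the gap between upper and lower
solutions that are bounded by `m` in `M_{α,β}`. -/
def Kernel.factor (K : Kernel) (d : ℕ) (α β : ℝ) (m : ℝ≥0∞) : ℝ≥0∞ :=
  2 * lip m * K.freqBound d α β

/-- Write k for K_β. The two entries of the minimum give mk/√α < 1/24 and m²k/√α < 1/24, so for k >
0 the factor 2(2m + 3m²)k/√α is below 10/24. -/
lemma Kernel.factor_lt_one (hα : 0 < α) {m : ℝ≥0∞}
    (hm : m < ENNReal.ofReal (K.lam d (dimConst d) α β)) : K.factor d α β m < 1 := by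
  set k := K.Kconst d (dimConst d) β with hk
  have hmt : m ≠ ∞ := (hm.trans ENNReal.ofReal_lt_top).ne
  rcases le_or_gt k 0 with hk0 | hk0
  -- For k ≤ 0 the truncation in `ENNReal.ofReal` makes the bound zero, so positivity of K_β need
  -- not be proved.
  · have : K.freqBound d α β = 0 :=
      ENNReal.ofReal_of_nonpos (div_nonpos_of_nonpos_of_nonneg hk0 (Real.sqrt_nonneg _))
    rw [Kernel.factor, this, mul_zero]; exact zero_lt_one
  · have hs : 0 < Real.sqrt α := Real.sqrt_pos.2 hα
    set r := m.toReal with hr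
    have hr0 : 0 ≤ r := ENNReal.toReal_nonneg
    have hmr : m = ENNReal.ofReal r := (ENNReal.ofReal_toReal hmt).symm
    have hrl : r < K.lam d (dimConst d) α β := by
      rw [hmr] at hm
      exact (ENNReal.ofReal_lt_ofReal_iff_of_nonneg hr0).1 hm
    have h1 : r < Real.sqrt α / (24 * k) := by
      have := hrl.trans_le (min_le_left _ _)
      rwa [← Real.sqrt_eq_rpow] at this
    have h2 : r < α ^ (1 / 4 : ℝ) / (2 * Real.sqrt (6 * k)) := hrl.trans_le (min_le_right _ _)
    have h3 : r ^ 2 < Real.sqrt α / (24 * k) := by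
      have h4 : r ^ 2 < (α ^ (1 / 4 : ℝ) / (2 * Real.sqrt (6 * k))) ^ 2 :=
        pow_lt_pow_left₀ h2 hr0 two_ne_zero
      have h5 : (α ^ (1 / 4 : ℝ)) ^ 2 = Real.sqrt α := by
        rw [Real.sqrt_eq_rpow, ← Real.rpow_natCast, ← Real.rpow_mul hα.le]; norm_num
      rw [div_pow, h5, mul_pow, Real.sq_sqrt (by positivity)] at h4
      calc r ^ 2 < _ := h4
        _ = _ := by congr 1; ring
    have h6 : r * (k / Real.sqrt α) < 1 / 24 := by
      rw [lt_div_iff₀ (by positivity)] at h1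
      rw [mul_div_assoc', div_lt_iff₀ hs]; linarith
    have h7 : r ^ 2 * (k / Real.sqrt α) < 1 / 24 := by
      rw [lt_div_iff₀ (by positivity)] at h3
      rw [mul_div_assoc', div_lt_iff₀ hs]; linarith
    have h8 : K.factor d α β m = ENNReal.ofReal (2 * (2 * r + 3 * r ^ 2) * (k / Real.sqrt α)) := by
      rw [Kernel.factor, Kernel.freqBound, ← hk, lip, hmr, ENNReal.ofReal_mul (by positivity),
        ENNReal.ofReal_mul (by positivity), ENNReal.ofReal_add (by positivity) (by positivity),
        ENNReal.ofReal_mul (by positivity), ENNReal.ofReal_mul (by positivity),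
        ENNReal.ofReal_pow hr0]
      norm_num
    rw [h8, ENNReal.ofReal_lt_one]
    nlinarith

lemma Kernel.tendsto_factor_pow (hα : 0 < α) {m : ℝ≥0∞}
    (hm : m < ENNReal.ofReal (K.lam d (dimConst d) α β)) :
    Tendsto (fun n : ℕ => m * K.factor d α β m ^ n) atTop (𝓝 0) := by
  have h1 := ENNReal.tendsto_pow_atTop_nhds_zero_of_lt_one (K.factor_lt_one hα hm)
  have := ENNReal.Tendsto.const_mul h1 (Or.inr (hm.trans ENNReal.ofReal_lt_top).ne)
  rwa [mul_zero] at this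

end

end BinaryTernary

namespace BinaryTernary

noncomputable section

variable {d : ℕ} {T : ℝ≥0∞} {K : Kernel} {α β : ℝ}

/-! ### The Kaniel-Shinbrot iteration -/

/-- The iterates `(l_n, u_n)`, given by the explicit solutions of the linear problems. -/
def Kernel.iter (K : Kernel) (f₀ φ ψ : Phase d) : ℕ → TimeFun d × TimeFun d
  | 0 => (ofStationarySharp φ, ofStationarySharp ψ)
  | n + 1 =>
    (K.linearSol f₀ (K.iter f₀ φ ψ n).2
      (K.G (K.iter f₀ φ ψ n).1 (K.iter f₀ φ ψ n).1 (K.iter f₀ φ ψ n).1),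
     K.linearSol f₀ (K.iter f₀ φ ψ n).1
      (K.G (K.iter f₀ φ ψ n).2 (K.iter f₀ φ ψ n).2 (K.iter f₀ φ ψ n).2))

/-- The lower iterates. -/
def Kernel.lower (K : Kernel) (f₀ φ ψ : Phase d) (n : ℕ) : TimeFun d := (K.iter f₀ φ ψ n).1

/-- The upper iterates. -/
def Kernel.upper (K : Kernel) (f₀ φ ψ : Phase d) (n : ℕ) : TimeFun d := (K.iter f₀ φ ψ n).2

section Iteration

variable {f₀ φ ψ : Phase d}

lemma Kernel.upper_zero : K.upper f₀ φ ψ 0 = ofStationarySharp ψ := rfl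

lemma Kernel.measurable_iter (hK : K.Admissible d) (hf₀ : Measurable f₀) (hφ : Measurable φ)
    (hψ : Measurable ψ) (n : ℕ) : Measurable (Function.uncurry (K.lower f₀ φ ψ n)) ∧
      Measurable (Function.uncurry (K.upper f₀ φ ψ n)) := by
  induction n with
  | zero => exact ⟨measurable_ofStationarySharp hφ, measurable_ofStationarySharp hψ⟩
  | succ n ih =>
    exact ⟨K.measurable_linearSol hK hf₀ ih.2 (K.measurable_G hK ih.1 ih.1 ih.1),
      K.measurable_linearSol hK hf₀ ih.1 (K.measurable_G hK ih.2 ih.2 ih.2)⟩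

/-- The beginning condition, for the explicit iterates. -/
structure BeginningCondition (K : Kernel) (T : ℝ≥0∞) (f₀ φ ψ : Phase d) : Prop where
  measurable_f₀ : Measurable f₀
  measurable_l : Measurable φ
  measurable_u : Measurable ψ
  l_le : ∀ t ∈ timeSet T, K.lower f₀ φ ψ 0 t ≤ᵐ[volume] K.lower f₀ φ ψ 1 t
  le : ∀ t ∈ timeSet T, K.lower f₀ φ ψ 1 t ≤ᵐ[volume] K.upper f₀ φ ψ 1 t
  u_le : ∀ t ∈ timeSet T, K.upper f₀ φ ψ 1 t ≤ᵐ[volume] K.upper f₀ φ ψ 0 t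

namespace BeginningCondition

variable (hB : BeginningCondition K T f₀ φ ψ) (hK : K.Admissible d)

include hB hK

lemma measurable_lower (n : ℕ) : Measurable (Function.uncurry (K.lower f₀ φ ψ n)) :=
  (K.measurable_iter hK hB.measurable_f₀ hB.measurable_l hB.measurable_u n).1

lemma measurable_upper (n : ℕ) : Measurable (Function.uncurry (K.upper f₀ φ ψ n)) :=
  (K.measurable_iter hK hB.measurable_f₀ hB.measurable_l hB.measurable_u n).2

lemma measurable_G_lower (n : ℕ) : Measurable (Function.uncurry
    (K.G (K.lower f₀ φ ψ n) (K.lower f₀ φ ψ n) (K.lower f₀ φ ψ n))) :=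
  K.measurable_G hK (hB.measurable_lower hK n) (hB.measurable_lower hK n) (hB.measurable_lower hK n)

lemma measurable_G_upper (n : ℕ) : Measurable (Function.uncurry
    (K.G (K.upper f₀ φ ψ n) (K.upper f₀ φ ψ n) (K.upper f₀ φ ψ n))) :=
  K.measurable_G hK (hB.measurable_upper hK n) (hB.measurable_upper hK n) (hB.measurable_upper hK n)

/-- Each l_{n+1} has source G(l_n) and frequency R(u_n), and each u_{n+1} has the two roles
exchanged. A larger l and a smaller u thus raise the next lower iterate and lower the next upper
one, and l ≤ u is inherited for the same reason. -/
lemma monotone_step (n : ℕ) :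
    (∀ t ∈ timeSet T, K.lower f₀ φ ψ n t ≤ᵐ[volume] K.lower f₀ φ ψ (n + 1) t) ∧
    (∀ t ∈ timeSet T, K.lower f₀ φ ψ (n + 1) t ≤ᵐ[volume] K.upper f₀ φ ψ (n + 1) t) ∧
    (∀ t ∈ timeSet T, K.upper f₀ φ ψ (n + 1) t ≤ᵐ[volume] K.upper f₀ φ ψ n t) := by
  have mlow := hB.measurable_lower hK
  have mu := hB.measurable_upper hK
  have mGl := hB.measurable_G_lower hK
  have mGu := hB.measurable_G_upper hK
  induction n with
  | zero => exact ⟨hB.l_le, hB.le, hB.u_le⟩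
  | succ n ih =>
    obtain ⟨h1, h2, h3⟩ := ih
    refine ⟨fun t ht => ?_, fun t ht => ?_, fun t ht => ?_⟩
    · exact K.linearSol_mono hK (mu n) (mGl n) (mu (n + 1)) (mGl (n + 1)) h3
        (fun t ht => K.G_mono (h1 t ht) (h1 t ht) (h1 t ht)) ht
    · exact K.linearSol_mono hK (mu (n + 1)) (mGl (n + 1)) (mlow (n + 1)) (mGu (n + 1)) h2
        (fun t ht => K.G_mono (h2 t ht) (h2 t ht) (h2 t ht)) ht
    · exact K.linearSol_mono hK (mlow (n + 1)) (mGu (n + 1)) (mlow n) (mGu n) h1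
        (fun t ht => K.G_mono (h3 t ht) (h3 t ht) (h3 t ht)) ht

lemma lower_le_upper (n : ℕ) : ∀ t ∈ timeSet T,
    K.lower f₀ φ ψ n t ≤ᵐ[volume] K.upper f₀ φ ψ n t := by
  intro t ht
  cases n with
  | zero => exact ((hB.l_le t ht).trans (hB.le t ht)).trans (hB.u_le t ht)
  | succ n => exact (hB.monotone_step hK n).2.1 t ht

lemma ae_monotone {t : ℝ} (ht : t ∈ timeSet T) :
    ∀ᵐ z, Monotone (fun n => K.lower f₀ φ ψ n t z) ∧ Antitone (fun n => K.upper f₀ φ ψ n t z) ∧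
      ∀ n, K.lower f₀ φ ψ n t z ≤ K.upper f₀ φ ψ n t z := by
  filter_upwards [ae_all_iff.2 fun n => (hB.monotone_step hK n).1 t ht,
    ae_all_iff.2 fun n => (hB.monotone_step hK n).2.2 t ht,
    ae_all_iff.2 fun n => hB.lower_le_upper hK n t ht] with z h1 h2 h3
  exact ⟨monotone_nat_of_le_succ h1, antitone_nat_of_succ_le h2, h3⟩

lemma upper_le (n : ℕ) : ∀ t ∈ timeSet T,
    K.upper f₀ φ ψ n t ≤ᵐ[volume] fun z => normM α β ψ * transMax d α β t z := by
  intro t ht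
  have h0 : K.upper f₀ φ ψ 0 t ≤ᵐ[volume] fun z => normM α β ψ * transMax d α β t z := by
    rw [← sharp_le_maxwellian_iff, K.upper_zero, sharp_ofStationarySharp]
    exact le_normM_mul ψ
  filter_upwards [h0, hB.ae_monotone hK ht] with z h0 h1
  exact (h1.2.1 (Nat.zero_le n)).trans h0

lemma lower_le (n : ℕ) : ∀ t ∈ timeSet T,
    K.lower f₀ φ ψ n t ≤ᵐ[volume] fun z => normM α β ψ * transMax d α β t z :=
  fun t ht => (hB.lower_le_upper hK n t ht).trans (hB.upper_le hK n t ht)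

lemma measurable_iSup_lower :
    Measurable (Function.uncurry fun t z => ⨆ n, K.lower f₀ φ ψ n t z) := by
  have := Measurable.iSup fun n => hB.measurable_lower hK n
  convert this using 1
  ext p
  simp [Function.uncurry]

end BeginningCondition

/-! ### The limit of the iteration -/

/-- The limit of the iteration, as the supremum of the lower iterates. -/
def Kernel.limit (K : Kernel) (f₀ φ ψ : Phase d) : TimeFun d := fun t z =>
  ⨆ n, K.lower f₀ φ ψ n t z

lemma Kernel.lower_le_limit (n : ℕ) (t : ℝ) (z : Vec d × Vec d) :
    K.lower f₀ φ ψ n t z ≤ K.limit f₀ φ ψ t z := le_iSup (fun n => K.lower f₀ φ ψ n t z) n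

end Iteration

/-- The standing assumptions: an admissible kernel in dimension at least two, positive parameters,
and data that satisfy the beginning condition with a small upper bound. -/
structure Setting (K : Kernel) (d : ℕ) (T : ℝ≥0∞) (α β : ℝ) (f₀ φ ψ : Phase d) : Prop where
  two_le : 2 ≤ d
  admissible : K.Admissible d
  T_pos : 0 < T
  α_pos : 0 < α
  β_pos : 0 < β
  f₀_mem : MemM α β f₀
  beginning : BeginningCondition K T f₀ φ ψ
  small : normM α β ψ < ENNReal.ofReal (K.lam d (dimConst d) α β)

namespace Setting

variable {f₀ φ ψ : Phase d} (hS : Setting K d T α β f₀ φ ψ)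

include hS

lemma norm_ne_top : normM α β ψ ≠ ∞ := (hS.small.trans ENNReal.ofReal_lt_top).ne

lemma factor_lt_one : K.factor d α β (normM α β ψ) < 1 := K.factor_lt_one hS.α_pos hS.small

lemma memL1_f₀ : MemL1 f₀ :=
  memL1_of_le_maxwellian hS.α_pos hS.β_pos hS.f₀_mem.1 hS.f₀_mem.2.ne (le_normM_mul f₀)

lemma memL1_sharp {f : TimeFun d} {t : ℝ} (hf : Measurable (f t))
    (h : f t ≤ᵐ[volume] fun z => normM α β ψ * transMax d α β t z) : MemL1 (sharp f t) :=
  memL1_of_le_maxwellian hS.α_pos hS.β_pos (measurable_sharp_apply hf) hS.norm_ne_top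
    (sharp_le_maxwellian_iff.2 h)

lemma memLinftyL1_G {f : TimeFun d} (hf : Measurable (Function.uncurry f))
    (h : ∀ t ∈ timeSet T, f t ≤ᵐ[volume] fun z => normM α β ψ * transMax d α β t z) :
    MemLinftyL1 T (sharp (K.G f f f)) :=
  memLinftyL1_sharp hS.two_le hS.admissible hS.α_pos hS.β_pos
    (K.measurable_G hS.admissible hf hf hf)
    (ENNReal.mul_ne_top hS.norm_ne_top (lip_ne_top hS.norm_ne_top))
    fun t ht => K.G_le hS.admissible (h t ht) (h t ht) (h t ht)

lemma memLinftyL1_L {f g : TimeFun d} (hf : Measurable (Function.uncurry f))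
    (hg : Measurable (Function.uncurry g))
    (h : ∀ t ∈ timeSet T, f t ≤ᵐ[volume] fun z => normM α β ψ * transMax d α β t z)
    (h' : ∀ t ∈ timeSet T, g t ≤ᵐ[volume] fun z => normM α β ψ * transMax d α β t z) :
    MemLinftyL1 T (sharp (K.L f g g)) :=
  memLinftyL1_sharp hS.two_le hS.admissible hS.α_pos hS.β_pos
    (K.measurable_L hS.admissible hf hg hg)
    (ENNReal.mul_ne_top hS.norm_ne_top (lip_ne_top hS.norm_ne_top))
    fun t ht => K.L_le hS.admissible (h t ht) (h' t ht) (h' t ht)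

lemma isLinearMildSolution_linearSol {f g : TimeFun d} (hf : Measurable (Function.uncurry f))
    (hg : Measurable (Function.uncurry g))
    (h : ∀ t ∈ timeSet T, f t ≤ᵐ[volume] fun z => normM α β ψ * transMax d α β t z)
    (h' : ∀ t ∈ timeSet T, g t ≤ᵐ[volume] fun z => normM α β ψ * transMax d α β t z) :
    IsLinearMildSolution K T f₀ g (K.G f f f) (K.linearSol f₀ g (K.G f f f)) :=
  K.isLinearMildSolution_linearSol hS.T_pos hS.two_le hS.admissible hS.α_pos hS.β_pos
    hS.f₀_mem.1 hS.f₀_mem.2.ne (le_normM_mul f₀) hg (K.measurable_G hS.admissible hf hf hf)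
    hS.norm_ne_top h' (ENNReal.mul_ne_top hS.norm_ne_top (lip_ne_top hS.norm_ne_top))
    fun t ht => K.G_le hS.admissible (h t ht) (h t ht) (h t ht)

lemma measurable_lower (n : ℕ) : Measurable (Function.uncurry (K.lower f₀ φ ψ n)) :=
  hS.beginning.measurable_lower hS.admissible n

lemma measurable_upper (n : ℕ) : Measurable (Function.uncurry (K.upper f₀ φ ψ n)) :=
  hS.beginning.measurable_upper hS.admissible n

lemma lower_le (n : ℕ) : ∀ t ∈ timeSet T,
    K.lower f₀ φ ψ n t ≤ᵐ[volume] fun z => normM α β ψ * transMax d α β t z :=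
  hS.beginning.lower_le hS.admissible n

lemma upper_le (n : ℕ) : ∀ t ∈ timeSet T,
    K.upper f₀ φ ψ n t ≤ᵐ[volume] fun z => normM α β ψ * transMax d α β t z :=
  hS.beginning.upper_le hS.admissible n

lemma isLinearMildSolution_lower (n : ℕ) : IsLinearMildSolution K T f₀ (K.upper f₀ φ ψ n)
    (K.G (K.lower f₀ φ ψ n) (K.lower f₀ φ ψ n) (K.lower f₀ φ ψ n)) (K.lower f₀ φ ψ (n + 1)) :=
  hS.isLinearMildSolution_linearSol (hS.measurable_lower n) (hS.measurable_upper n)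
    (hS.lower_le n) (hS.upper_le n)

lemma isLinearMildSolution_upper (n : ℕ) : IsLinearMildSolution K T f₀ (K.lower f₀ φ ψ n)
    (K.G (K.upper f₀ φ ψ n) (K.upper f₀ φ ψ n) (K.upper f₀ φ ψ n)) (K.upper f₀ φ ψ (n + 1)) :=
  hS.isLinearMildSolution_linearSol (hS.measurable_upper n) (hS.measurable_lower n)
    (hS.upper_le n) (hS.lower_le n)

lemma integralForm_lower (n : ℕ) : IntegralForm T f₀ (sharp (K.lower f₀ φ ψ (n + 1)))
    (sharp (K.L (K.lower f₀ φ ψ (n + 1)) (K.upper f₀ φ ψ n) (K.upper f₀ φ ψ n)))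
    (sharp (K.G (K.lower f₀ φ ψ n) (K.lower f₀ φ ψ n) (K.lower f₀ φ ψ n))) :=
  K.integralForm_linearSol hS.two_le hS.admissible hS.α_pos hS.β_pos hS.f₀_mem.1
    (hS.measurable_upper n) (hS.beginning.measurable_G_lower hS.admissible n)
    hS.norm_ne_top (hS.upper_le n)

lemma integralForm_upper (n : ℕ) : IntegralForm T f₀ (sharp (K.upper f₀ φ ψ (n + 1)))
    (sharp (K.L (K.upper f₀ φ ψ (n + 1)) (K.lower f₀ φ ψ n) (K.lower f₀ φ ψ n)))
    (sharp (K.G (K.upper f₀ φ ψ n) (K.upper f₀ φ ψ n) (K.upper f₀ φ ψ n))) :=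
  K.integralForm_linearSol hS.two_le hS.admissible hS.α_pos hS.β_pos hS.f₀_mem.1
    (hS.measurable_lower n) (hS.beginning.measurable_G_upper hS.admissible n)
    hS.norm_ne_top (hS.lower_le n)

/-- The gap between the upper and the lower iterates. -/
lemma upper_le_lower_add (n : ℕ) : ∀ t ∈ timeSet T, K.upper f₀ φ ψ n t ≤ᵐ[volume] fun z =>
    K.lower f₀ φ ψ n t z +
      normM α β ψ * K.factor d α β (normM α β ψ) ^ n * transMax d α β t z := by
  induction n with
  | zero =>
    intro t ht
    filter_upwards [hS.upper_le 0 t ht] with z hz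
    rw [pow_zero, mul_one]
    exact hz.trans le_add_self
  | succ n ih =>
    intro t ht
    set m := normM α β ψ
    set δ := m * K.factor d α β m ^ n with hδ
    -- In the comparison of the losses the new iterates enter only in the direction l_{n+1} ≤
    -- u_{n+1}, which the order provides. The estimate therefore closes with the gap at level n
    -- alone.
    have hlu : ∀ t ∈ timeSet T, K.lower f₀ φ ψ (n + 1) t ≤ᵐ[volume] fun z =>
        K.upper f₀ φ ψ (n + 1) t z + δ * transMax d α β t z := fun t ht => by
      filter_upwards [hS.beginning.lower_le_upper hS.admissible (n + 1) t ht] with z hz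
      exact hz.trans le_self_add
    have key := (hS.integralForm_upper n).le_add hS.two_le hS.admissible hS.α_pos hS.β_pos
      (hS.integralForm_lower n) (fun t _ => (hS.measurable_upper (n + 1)).of_uncurry_left)
      (hS.isLinearMildSolution_upper n).loss (c := δ * lip m)
      (fun t ht => K.L_le_add hS.admissible (hlu t ht) (ih t ht) (ih t ht) (hS.upper_le n t ht)
        (hS.upper_le n t ht) (hS.upper_le (n + 1) t ht) (hS.lower_le n t ht))
      (fun t ht => K.G_le_add hS.admissible (ih t ht) (ih t ht) (ih t ht) (hS.upper_le n t ht)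
        (hS.upper_le n t ht) (hS.lower_le n t ht) (hS.lower_le n t ht)) ht
    have e : 2 * (δ * lip m) * K.freqBound d α β = m * K.factor d α β m ^ (n + 1) := by
      rw [hδ, pow_succ]
      nth_rewrite 3 [Kernel.factor]
      ring
    rwa [e] at key

lemma tendsto_gap : Tendsto (fun n : ℕ => normM α β ψ * K.factor d α β (normM α β ψ) ^ n)
    atTop (𝓝 0) := K.tendsto_factor_pow hS.α_pos hS.small

lemma measurable_limit : Measurable (Function.uncurry (K.limit f₀ φ ψ)) :=
  hS.beginning.measurable_iSup_lower hS.admissible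

lemma limit_le_upper (n : ℕ) : ∀ t ∈ timeSet T,
    K.limit f₀ φ ψ t ≤ᵐ[volume] K.upper f₀ φ ψ n t := by
  intro t ht
  filter_upwards [hS.beginning.ae_monotone hS.admissible ht] with z h
  refine iSup_le fun k => ?_
  rcases le_total k n with hkn | hkn
  · exact (h.1 hkn).trans (h.2.2 n)
  · exact (h.2.2 k).trans (h.2.1 hkn)

lemma limit_le : ∀ t ∈ timeSet T,
    K.limit f₀ φ ψ t ≤ᵐ[volume] fun z => normM α β ψ * transMax d α β t z :=
  fun t ht => (hS.limit_le_upper 0 t ht).trans (hS.upper_le 0 t ht)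

lemma limit_le_lower_add (n : ℕ) : ∀ t ∈ timeSet T, K.limit f₀ φ ψ t ≤ᵐ[volume] fun z =>
    K.lower f₀ φ ψ n t z +
      normM α β ψ * K.factor d α β (normM α β ψ) ^ n * transMax d α β t z :=
  fun t ht => (hS.limit_le_upper n t ht).trans (hS.upper_le_lower_add n t ht)

lemma upper_le_limit_add (n : ℕ) : ∀ t ∈ timeSet T, K.upper f₀ φ ψ n t ≤ᵐ[volume] fun z =>
    K.limit f₀ φ ψ t z +
      normM α β ψ * K.factor d α β (normM α β ψ) ^ n * transMax d α β t z := by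
  intro t ht
  filter_upwards [hS.upper_le_lower_add n t ht] with z hz
  refine hz.trans ?_
  gcongr
  exact K.lower_le_limit n t z

/-- The equation of l_{n+1} contains l_{n+1}, l_n and u_n, all within δ_n W of the limit from both
sides. Its three terms converge with errors of order δ_n, and the limit equation already has equal
arguments throughout. -/
lemma integralForm_limit : IntegralForm T f₀ (sharp (K.limit f₀ φ ψ))
    (sharp (K.L (K.limit f₀ φ ψ) (K.limit f₀ φ ψ) (K.limit f₀ φ ψ)))
    (sharp (K.G (K.limit f₀ φ ψ) (K.limit f₀ φ ψ) (K.limit f₀ φ ψ))) := by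
  set m := normM α β ψ
  set δ : ℕ → ℝ≥0∞ := fun n => m * K.factor d α β m ^ n with hδ
  -- The gap at level n + 1 is relaxed to δ_n so that one error sequence serves the iterates of both
  -- levels.
  have hδle : ∀ n, δ (n + 1) ≤ δ n := fun n => by
    simp only [hδ]
    gcongr m * ?_
    exact pow_le_pow_right_of_le_one' hS.factor_lt_one.le (Nat.le_succ n)
  have hK := hS.admissible
  have a1 : ∀ n, ∀ t ∈ timeSet T, K.limit f₀ φ ψ t ≤ᵐ[volume] fun z =>
      K.lower f₀ φ ψ (n + 1) t z + δ n * transMax d α β t z := fun n t ht => by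
    filter_upwards [hS.limit_le_lower_add (n + 1) t ht] with z hz
    refine hz.trans ?_
    gcongr
    exact hδle n
  have a2 : ∀ n k, ∀ t ∈ timeSet T, K.lower f₀ φ ψ n t ≤ᵐ[volume] fun z =>
      K.limit f₀ φ ψ t z + δ k * transMax d α β t z := fun n k t ht =>
    ae_of_all _ fun z => (K.lower_le_limit n t z).trans le_self_add
  have a3 : ∀ n, ∀ t ∈ timeSet T, K.limit f₀ φ ψ t ≤ᵐ[volume] fun z =>
      K.upper f₀ φ ψ n t z + δ n * transMax d α β t z := fun n t ht => by
    filter_upwards [hS.limit_le_upper n t ht] with z hz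
    exact hz.trans le_self_add
  have a4 := hS.upper_le_limit_add
  have a5 := hS.limit_le_lower_add
  have b := hS.limit_le
  have bl := hS.lower_le
  have bu := hS.upper_le
  exact integralForm_of_approx hS.two_le hK hS.α_pos hS.β_pos hS.tendsto_gap
    (lip_ne_top hS.norm_ne_top) hS.integralForm_lower a1 (fun n => a2 (n + 1) n)
    (fun n t ht => K.L_le_add hK (a1 n t ht) (a3 n t ht) (a3 n t ht) (b t ht) (b t ht)
      (bl (n + 1) t ht) (bu n t ht))
    (fun n t ht => K.L_le_add hK (a2 (n + 1) n t ht) (a4 n t ht) (a4 n t ht) (bu n t ht)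
      (bu n t ht) (b t ht) (b t ht))
    (fun n t ht => K.G_le_add hK (a5 n t ht) (a5 n t ht) (a5 n t ht) (b t ht) (b t ht)
      (bl n t ht) (bl n t ht))
    (fun n t ht => K.G_le_add hK (a2 n n t ht) (a2 n n t ht) (a2 n n t ht) (bl n t ht)
      (bl n t ht) (b t ht) (b t ht))

/-- The integral equation for the limit. -/
lemma integral_limit : ∀ t ∈ timeSet T, toL1 (sharp (K.limit f₀ φ ψ) t) + ∫ τ in (0 : ℝ)..t,
      toL1 (sharp (K.L (K.limit f₀ φ ψ) (K.limit f₀ φ ψ) (K.limit f₀ φ ψ)) τ) =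
    toL1 f₀ + ∫ τ in (0 : ℝ)..t,
      toL1 (sharp (K.G (K.limit f₀ φ ψ) (K.limit f₀ φ ψ) (K.limit f₀ φ ψ)) τ) :=
  (integralForm_iff hS.memL1_f₀
    (fun t ht => hS.memL1_sharp hS.measurable_limit.of_uncurry_left (hS.limit_le t ht))
    (hS.memLinftyL1_L hS.measurable_limit hS.measurable_limit hS.limit_le hS.limit_le).memL1locL1
    (hS.memLinftyL1_G hS.measurable_limit hS.limit_le).memL1locL1).1 hS.integralForm_limit

/-- The limit is a mild solution. -/
lemma isMildSolution_limit : IsMildSolution K T α β f₀ (K.limit f₀ φ ψ) := by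
  have m := hS.measurable_limit
  have b := hS.limit_le
  have hL := hS.memLinftyL1_L m m b b
  have hG := hS.memLinftyL1_G m b
  have hF : ∀ t ∈ timeSet T, MemL1 (sharp (K.limit f₀ φ ψ) t) := fun t ht =>
    hS.memL1_sharp m.of_uncurry_left (b t ht)
  exact
    { measurable := fun t _ => m.of_uncurry_left
      continuous := memC0L1_of_integral hF hL.memL1locL1 hG.memL1locL1 hS.integral_limit
      bounded := memLinftyM_sharp (fun t _ => m.of_uncurry_left) hS.norm_ne_top b
      loss := hL
      gain := hG
      equation := weakDeriv_of_integral hL.memL1locL1 hG.memL1locL1 hS.integral_limit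
      initial := hS.integralForm_limit.initial hS.T_pos hS.memL1_f₀
        (hF 0 (zero_mem_timeSet hS.T_pos)) }

/-! ### Uniqueness of mild solutions and of the iteration -/

/-- Two mild solutions that are close to within `δ` are close to within a fraction of `δ`. -/
lemma contraction {f g : TimeFun d} (hf : IsMildSolution K T α β f₀ f)
    (hg : IsMildSolution K T α β f₀ g)
    (bf : ∀ t ∈ timeSet T, f t ≤ᵐ[volume] fun z => normM α β ψ * transMax d α β t z)
    (bg : ∀ t ∈ timeSet T, g t ≤ᵐ[volume] fun z => normM α β ψ * transMax d α β t z) {δ : ℝ≥0∞}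
    (h : ∀ t ∈ timeSet T, f t ≤ᵐ[volume] fun z => g t z + δ * transMax d α β t z)
    (h' : ∀ t ∈ timeSet T, g t ≤ᵐ[volume] fun z => f t z + δ * transMax d α β t z) :
    ∀ t ∈ timeSet T, f t ≤ᵐ[volume] fun z =>
      g t z + δ * K.factor d α β (normM α β ψ) * transMax d α β t z := by
  have hI : ∀ {f : TimeFun d}, IsMildSolution K T α β f₀ f → IntegralForm T f₀ (sharp f)
      (sharp (K.L f f f)) (sharp (K.G f f f)) := fun {f} hf => by
    rw [integralForm_iff hS.memL1_f₀ hf.continuous.1 hf.loss.memL1locL1 hf.gain.memL1locL1]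
    intro t ht
    rw [integral_of_weakDeriv hf.continuous hf.loss.memL1locL1 hf.gain.memL1locL1 hf.equation ht,
      toL1_congr (hf.continuous.1 0 (zero_mem_timeSet hS.T_pos)).1 hS.f₀_mem.1 hf.initial]
  intro t ht
  have key := (hI hf).le_add hS.two_le hS.admissible hS.α_pos hS.β_pos (hI hg) hf.measurable
    hf.loss.memL1locL1 (c := δ * lip (normM α β ψ))
    (fun t ht => K.L_le_add hS.admissible (h' t ht) (h' t ht) (h' t ht) (bg t ht) (bg t ht)
      (bf t ht) (bf t ht))
    (fun t ht => K.G_le_add hS.admissible (h t ht) (h t ht) (h t ht) (bf t ht) (bf t ht)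
      (bg t ht) (bg t ht)) ht
  have e : 2 * (δ * lip (normM α β ψ)) * K.freqBound d α β =
      δ * K.factor d α β (normM α β ψ) := by rw [Kernel.factor]; ring
  rwa [e] at key

/-- Uniqueness of mild solutions in the ball. -/
lemma mild_unique {f g : TimeFun d} (hf : IsMildSolution K T α β f₀ f)
    (hg : IsMildSolution K T α β f₀ g)
    (bf : ∀ t ∈ timeSet T, f t ≤ᵐ[volume] fun z => normM α β ψ * transMax d α β t z)
    (bg : ∀ t ∈ timeSet T, g t ≤ᵐ[volume] fun z => normM α β ψ * transMax d α β t z) :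
    ∀ t ∈ timeSet T, f t =ᵐ[volume] g t := by
  have key : ∀ n : ℕ,
      (∀ t ∈ timeSet T, f t ≤ᵐ[volume] fun z => g t z +
        normM α β ψ * K.factor d α β (normM α β ψ) ^ n * transMax d α β t z) ∧
      (∀ t ∈ timeSet T, g t ≤ᵐ[volume] fun z => f t z +
        normM α β ψ * K.factor d α β (normM α β ψ) ^ n * transMax d α β t z) := by
    intro n
    induction n with
    | zero =>
      -- The contraction starts from δ = m, a trivial bound because both solutions lie below mW.
      simp only [pow_zero, mul_one]
      exact ⟨fun t ht => (bf t ht).trans (ae_of_all _ fun z => le_add_self),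
        fun t ht => (bg t ht).trans (ae_of_all _ fun z => le_add_self)⟩
    | succ n ih =>
      simp only [pow_succ, ← mul_assoc]
      exact ⟨hS.contraction hf hg bf bg ih.1 ih.2, hS.contraction hg hf bg bf ih.2 ih.1⟩
  intro t ht
  filter_upwards [ae_all_iff.2 fun n => (key n).1 t ht, ae_all_iff.2 fun n => (key n).2 t ht]
    with z h1 h2
  have hW : transMax d α β t z ≠ ∞ := maxwellian_ne_top _ _ _
  exact le_antisymm (le_of_forall_le_add_mul hS.tendsto_gap hW h1)
    (le_of_forall_le_add_mul hS.tendsto_gap hW h2)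

/-- The lower iterates increase to their supremum. The upper ones are squeezed between it and the
same limit plus δ_n W. -/
lemma ae_tendsto {t : ℝ} (ht : t ∈ timeSet T) : ∀ᵐ z,
    Tendsto (fun n => K.lower f₀ φ ψ n t z) atTop (𝓝 (K.limit f₀ φ ψ t z)) ∧
    Tendsto (fun n => K.upper f₀ φ ψ n t z) atTop (𝓝 (K.limit f₀ φ ψ t z)) := by
  filter_upwards [hS.beginning.ae_monotone hS.admissible ht,
    ae_all_iff.2 fun n => hS.limit_le_upper n t ht,
    ae_all_iff.2 fun n => hS.upper_le_limit_add n t ht] with z h1 h2 h3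
  refine ⟨tendsto_atTop_iSup h1.1, ?_⟩
  have hW : transMax d α β t z ≠ ∞ := maxwellian_ne_top _ _ _
  have h4 := (ENNReal.Tendsto.mul_const hS.tendsto_gap (Or.inr hW)).const_add
    (K.limit f₀ φ ψ t z)
  rw [zero_mul, add_zero] at h4
  exact tendsto_of_tendsto_of_tendsto_of_le_of_le tendsto_const_nhds h4 h2 h3

/-- Every iteration agrees with the explicit one. -/
lemma iteration_unique {l u : ℕ → TimeFun d} (h : IsKSIteration K T f₀ φ ψ l u) (n : ℕ) :
    ∀ t ∈ timeSet T, l n t =ᵐ[volume] K.lower f₀ φ ψ n t ∧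
      u n t =ᵐ[volume] K.upper f₀ φ ψ n t := by
  have hK := hS.admissible
  have mm : ∀ n, (∀ t ∈ timeSet T, Measurable (l n t)) ∧ ∀ t ∈ timeSet T, Measurable (u n t) := by
    intro n
    cases n with
    | zero =>
      rw [h.l_zero, h.u_zero]
      exact ⟨fun t _ => (measurable_ofStationarySharp hS.beginning.measurable_l).of_uncurry_left,
        fun t _ => (measurable_ofStationarySharp hS.beginning.measurable_u).of_uncurry_left⟩
    | succ n => exact ⟨(h.l_succ n).measurable, (h.u_succ n).measurable⟩
  induction n with
  | zero =>
    rw [h.l_zero, h.u_zero]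
    exact fun t _ => ⟨EventuallyEq.rfl, EventuallyEq.rfl⟩
  | succ n ih =>
    have ml : ∀ t ∈ timeSet T, Measurable (K.lower f₀ φ ψ n t) := fun t _ =>
      (hS.measurable_lower n).of_uncurry_left
    have mu : ∀ t ∈ timeSet T, Measurable (K.upper f₀ φ ψ n t) := fun t _ =>
      (hS.measurable_upper n).of_uncurry_left
    have mG : ∀ {f : TimeFun d}, (∀ t ∈ timeSet T, Measurable (f t)) → ∀ t ∈ timeSet T,
        Measurable (K.G f f f t) := fun hf t ht =>
      K.measurable_G_apply hK (hf t ht) (hf t ht) (hf t ht)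
    -- The given iterate solves a problem with data almost everywhere equal to the explicit ones.
    -- After the exchange of data, uniqueness for the linear problem identifies the two solutions.
    have h1 := (h.l_succ n).congr hK (mm n).2 mu (mG (mm n).1) (mG ml) (fun t ht => (ih t ht).2)
      (fun t ht => K.G_congr (ih t ht).1 (ih t ht).1 (ih t ht).1)
    have h2 := (h.u_succ n).congr hK (mm n).1 ml (mG (mm n).2) (mG mu) (fun t ht => (ih t ht).1)
      (fun t ht => K.G_congr (ih t ht).2 (ih t ht).2 (ih t ht).2)
    exact fun t ht => ⟨h1.ae_eq hS.T_pos hS.two_le hK hS.α_pos hS.β_pos mu hS.norm_ne_top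
        (hS.upper_le n) (hS.memLinftyL1_G (hS.measurable_lower n) (hS.lower_le n)).memL1locL1
        (hS.isLinearMildSolution_lower n) ht,
      h2.ae_eq hS.T_pos hS.two_le hK hS.α_pos hS.β_pos ml hS.norm_ne_top
        (hS.lower_le n) (hS.memLinftyL1_G (hS.measurable_upper n) (hS.upper_le n)).memL1locL1
        (hS.isLinearMildSolution_upper n) ht⟩

end Setting

end

end BinaryTernary

namespace BinaryTernary

noncomputable section

section Main

variable {d : ℕ} {T : ℝ≥0∞} {K : Kernel} {α β : ℝ} {f₀ φ ψ : Phase d} {l₁ u₁ : TimeFun d}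

/-! ### The first iterates -/

/-- The given first iterates agree with the explicit ones. -/
lemma first_iterates_eq (hd : 2 ≤ d) (hK : K.Admissible d) (hT : 0 < T) (hα : 0 < α) (hβ : 0 < β)
    (hf₀ : MemM α β f₀) (hφ : MemM α β φ) (hψ : MemM α β ψ) (hφψ : φ ≤ᵐ[volume] ψ)
    (hl : IsLinearMildSolution K T f₀ (ofStationarySharp ψ)
      (K.G (ofStationarySharp φ) (ofStationarySharp φ) (ofStationarySharp φ)) l₁)
    (hu : IsLinearMildSolution K T f₀ (ofStationarySharp φ)
      (K.G (ofStationarySharp ψ) (ofStationarySharp ψ) (ofStationarySharp ψ)) u₁) :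
    ∀ t ∈ timeSet T, l₁ t =ᵐ[volume] K.lower f₀ φ ψ 1 t ∧ u₁ t =ᵐ[volume] K.upper f₀ φ ψ 1 t := by
  have mφ := measurable_ofStationarySharp hφ.1
  have mψ := measurable_ofStationarySharp hψ.1
  have bound : ∀ {χ : Phase d}, χ ≤ᵐ[volume] ψ → ∀ t ∈ timeSet T,
      ofStationarySharp χ t ≤ᵐ[volume] fun z => normM α β ψ * transMax d α β t z :=
    fun {χ} h t _ => by
      rw [← sharp_le_maxwellian_iff, sharp_ofStationarySharp]
      exact h.trans (le_normM_mul ψ)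
  have bφ := bound hφψ
  have bψ := bound (EventuallyLE.refl _ ψ)
  have hc := ENNReal.mul_ne_top hψ.2.ne (lip_ne_top hψ.2.ne)
  have step : ∀ {f g F : TimeFun d}, Measurable (Function.uncurry f) →
      Measurable (Function.uncurry g) →
      (∀ t ∈ timeSet T, f t ≤ᵐ[volume] fun z => normM α β ψ * transMax d α β t z) →
      (∀ t ∈ timeSet T, g t ≤ᵐ[volume] fun z => normM α β ψ * transMax d α β t z) →
      IsLinearMildSolution K T f₀ g (K.G f f f) F → ∀ t ∈ timeSet T,
      F t =ᵐ[volume] K.linearSol f₀ g (K.G f f f) t := by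
    intro f g F mf mg bf bg hF t ht
    have mG := K.measurable_G hK mf mf mf
    have bG : ∀ t ∈ timeSet T, K.G f f f t ≤ᵐ[volume] fun z =>
        normM α β ψ * lip (normM α β ψ) * K.Q d α β t z := fun t ht =>
      K.G_le hK (bf t ht) (bf t ht) (bf t ht)
    exact hF.ae_eq hT hd hK hα hβ (fun t _ => mg.of_uncurry_left) hψ.2.ne bg
      (memLinftyL1_sharp hd hK hα hβ mG hc bG).memL1locL1
      (K.isLinearMildSolution_linearSol hT hd hK hα hβ hf₀.1 hf₀.2.ne (le_normM_mul f₀) mg mG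
        hψ.2.ne bg hc bG) ht
  exact fun t ht => ⟨step mφ mψ bφ bψ hl t ht, step mψ mφ bψ bφ hu t ht⟩

/-- The beginning condition is assumed for the given first iterates; it is carried over to the
explicit ones, which are jointly measurable in time and phase. -/
lemma setting_of_first_iterates (hd : 2 ≤ d) (hK : K.Admissible d) (hT : 0 < T) (hα : 0 < α)
    (hβ : 0 < β) (hf₀ : MemM α β f₀) (hφ : MemM α β φ) (hψ : MemM α β ψ)
    (hsmall : normM α β ψ < ENNReal.ofReal (K.lam d (dimConst d) α β))
    (hfirst : ∀ t ∈ timeSet T,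
      l₁ t =ᵐ[volume] K.lower f₀ φ ψ 1 t ∧ u₁ t =ᵐ[volume] K.upper f₀ φ ψ 1 t)
    (hb : ∀ t ∈ timeSet T, φ ≤ᵐ[volume] sharp l₁ t ∧
      sharp l₁ t ≤ᵐ[volume] sharp u₁ t ∧ sharp u₁ t ≤ᵐ[volume] ψ) :
    Setting K d T α β f₀ φ ψ where
  two_le := hd
  admissible := hK
  T_pos := hT
  α_pos := hα
  β_pos := hβ
  f₀_mem := hf₀
  small := hsmall
  beginning :=
    { measurable_f₀ := hf₀.1
      measurable_l := hφ.1
      measurable_u := hψ.1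
      l_le := fun t ht => by
        have h1 := (hb t ht).1
        rw [← sharp_ofStationarySharp φ t, sharp_le_iff] at h1
        exact h1.trans (hfirst t ht).1.le
      le := fun t ht => by
        have h1 := sharp_le_iff.1 (hb t ht).2.1
        exact ((hfirst t ht).1.symm.le.trans h1).trans (hfirst t ht).2.le
      u_le := fun t ht => by
        have h1 := (hb t ht).2.2
        rw [← sharp_ofStationarySharp ψ t, sharp_le_iff] at h1
        exact (hfirst t ht).2.symm.le.trans h1 }

namespace Setting

variable (hS : Setting K d T α β f₀ φ ψ)

include hS

/-- A sequence that agrees with the explicit one inherits its linear problems. -/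
lemma isKSIteration_update (hl : IsLinearMildSolution K T f₀ (ofStationarySharp ψ)
      (K.G (ofStationarySharp φ) (ofStationarySharp φ) (ofStationarySharp φ)) l₁)
    (hu : IsLinearMildSolution K T f₀ (ofStationarySharp φ)
      (K.G (ofStationarySharp ψ) (ofStationarySharp ψ) (ofStationarySharp ψ)) u₁)
    (hfirst : ∀ t ∈ timeSet T,
      l₁ t =ᵐ[volume] K.lower f₀ φ ψ 1 t ∧ u₁ t =ᵐ[volume] K.upper f₀ φ ψ 1 t) :
    IsKSIteration K T f₀ φ ψ (Function.update (K.lower f₀ φ ψ) 1 l₁)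
      (Function.update (K.upper f₀ φ ψ) 1 u₁) := by
  have hK := hS.admissible
  have el : ∀ n, ∀ t ∈ timeSet T,
      Function.update (K.lower f₀ φ ψ) 1 l₁ n t =ᵐ[volume] K.lower f₀ φ ψ n t := fun n t ht => by
    rcases eq_or_ne n 1 with rfl | hn
    · simpa using (hfirst t ht).1
    · rw [Function.update_of_ne hn]
  have eu : ∀ n, ∀ t ∈ timeSet T,
      Function.update (K.upper f₀ φ ψ) 1 u₁ n t =ᵐ[volume] K.upper f₀ φ ψ n t := fun n t ht => by
    rcases eq_or_ne n 1 with rfl | hn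
    · simpa using (hfirst t ht).2
    · rw [Function.update_of_ne hn]
  have ml : ∀ n, ∀ t ∈ timeSet T, Measurable (Function.update (K.lower f₀ φ ψ) 1 l₁ n t) :=
    fun n t ht => by
      rcases eq_or_ne n 1 with rfl | hn
      · simpa using hl.measurable t ht
      · rw [Function.update_of_ne hn]; exact (hS.measurable_lower n).of_uncurry_left
  have mu : ∀ n, ∀ t ∈ timeSet T, Measurable (Function.update (K.upper f₀ φ ψ) 1 u₁ n t) :=
    fun n t ht => by
      rcases eq_or_ne n 1 with rfl | hn
      · simpa using hu.measurable t ht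
      · rw [Function.update_of_ne hn]; exact (hS.measurable_upper n).of_uncurry_left
  have mG : ∀ {f : TimeFun d}, (∀ t ∈ timeSet T, Measurable (f t)) → ∀ t ∈ timeSet T,
      Measurable (K.G f f f t) := fun hf t ht =>
    K.measurable_G_apply hK (hf t ht) (hf t ht) (hf t ht)
  have ml' : ∀ n, ∀ t ∈ timeSet T, Measurable (K.lower f₀ φ ψ n t) := fun n t _ =>
    (hS.measurable_lower n).of_uncurry_left
  have mu' : ∀ n, ∀ t ∈ timeSet T, Measurable (K.upper f₀ φ ψ n t) := fun n t _ =>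
    (hS.measurable_upper n).of_uncurry_left
  refine ⟨?_, ?_, fun n => ?_, fun n => ?_⟩
  · rw [Function.update_of_ne zero_ne_one]; rfl
  · rw [Function.update_of_ne zero_ne_one]; rfl
  · rcases Nat.eq_zero_or_pos n with rfl | hn
    · rw [Function.update_of_ne zero_ne_one, Function.update_of_ne zero_ne_one, zero_add,
        Function.update_self]
      exact hl
    -- From here on the solution itself is the explicit one. Only its data can be affected by the
    -- replacement, for n = 1, and only on null sets.
    · rw [Function.update_of_ne (a := n + 1) (by omega)]
      exact (hS.isLinearMildSolution_lower n).congr hK (mu' n) (mu n) (mG (ml' n)) (mG (ml n))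
        (fun t ht => (eu n t ht).symm) fun t ht =>
          (K.G_congr (el n t ht) (el n t ht) (el n t ht)).symm
  · rcases Nat.eq_zero_or_pos n with rfl | hn
    · rw [Function.update_of_ne zero_ne_one, Function.update_of_ne zero_ne_one, zero_add,
        Function.update_self]
      exact hu
    · rw [Function.update_of_ne (a := n + 1) (by omega)]
      exact (hS.isLinearMildSolution_upper n).congr hK (ml' n) (ml n) (mG (mu' n)) (mG (mu n))
        (fun t ht => (el n t ht).symm) fun t ht =>
          (K.G_congr (eu n t ht) (eu n t ht) (eu n t ht)).symm

lemma isLinearData_of_ae_eq {f g f' g' : TimeFun d} (mf : Measurable (Function.uncurry f))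
    (bf : ∀ t ∈ timeSet T, f t ≤ᵐ[volume] fun z => normM α β ψ * transMax d α β t z)
    (bg : ∀ t ∈ timeSet T, g t ≤ᵐ[volume] fun z => normM α β ψ * transMax d α β t z)
    (mf' : ∀ t ∈ timeSet T, Measurable (f' t)) (mg' : ∀ t ∈ timeSet T, Measurable (g' t))
    (hf : ∀ t ∈ timeSet T, f' t =ᵐ[volume] f t) (hg : ∀ t ∈ timeSet T, g' t =ᵐ[volume] g t) :
    IsLinearData T α β g' (K.G f' f' f') := by
  refine ⟨memLinftyM_sharp mg' hS.norm_ne_top fun t ht => (hg t ht).le.trans (bg t ht), ?_⟩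
  exact (hS.memLinftyL1_G mf bf).memL1locL1.congr
    (fun t ht => measurable_sharp_apply
      (K.measurable_G_apply hS.admissible (mf' t ht) (mf' t ht) (mf' t ht)))
    fun t ht => sharp_eq_iff.2 (K.G_congr (hf t ht) (hf t ht) (hf t ht))

lemma tendstoM_of_ae_eq {F F' : ℕ → TimeFun d} {f : TimeFun d} {t : ℝ}
    (hF : ∀ᵐ z, Tendsto (fun n => F n t z) atTop (𝓝 (f t z)))
    (bF : ∀ n, F n t ≤ᵐ[volume] fun z => normM α β ψ * transMax d α β t z)
    (hFF : ∀ n, F' n t =ᵐ[volume] F n t) : TendstoM α β (fun n => sharp (F' n) t) (sharp f t) := by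
  constructor
  · refine (ae_sharp_iff t (P := fun z => Tendsto (fun n => F' n t z) atTop (𝓝 (f t z)))).2 ?_
    filter_upwards [hF, ae_all_iff.2 hFF] with z h1 h2
    simpa only [h2] using h1
  · refine (iSup_le fun n => ?_).trans_lt hS.norm_ne_top.lt_top
    exact normM_le_iff.2 (sharp_le_maxwellian_iff.2 ((hFF n).le.trans (bF n)))

end Setting

end Main

end

end BinaryTernary

/-! ### Assembly of the theorem -/

theorem theorem4p1 (d : ℕ) (hd : 2 ≤ d) :
    ∃ C : ℝ, 0 < C ∧
      ∀ (K : Kernel) (_ : K.Admissible d)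
        (T : ℝ≥0∞) (_ : 0 < T) (α β : ℝ) (_ : 0 < α) (_ : 0 < β)
        (f₀ l₀s u₀s : Phase d)
        (_ : MemM α β f₀) (_ : MemM α β l₀s) (_ : MemM α β u₀s)
        -- smallness of `u₀^#`
        (_ : normM α β u₀s < ENNReal.ofReal (K.lam d C α β))
        -- the first iterates `l₁`, `u₁`
        (l₁ u₁ : TimeFun d)
        (_ : IsLinearMildSolution K T f₀ (ofStationarySharp u₀s)
          (K.G (ofStationarySharp l₀s) (ofStationarySharp l₀s) (ofStationarySharp l₀s)) l₁)
        (_ : IsLinearMildSolution K T f₀ (ofStationarySharp l₀s)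
          (K.G (ofStationarySharp u₀s) (ofStationarySharp u₀s) (ofStationarySharp u₀s)) u₁)
        -- the beginning condition
        (_ : ∀ t ∈ timeSet T, l₀s ≤ᵐ[volume] sharp l₁ t ∧
          sharp l₁ t ≤ᵐ[volume] sharp u₁ t ∧ sharp u₁ t ≤ᵐ[volume] u₀s),
        ∃ l u : ℕ → TimeFun d,
          -- (i) existence of the sequences
          (IsKSIteration K T f₀ l₀s u₀s l u ∧ l 1 = l₁ ∧ u 1 = u₁ ∧
            ∀ n, IsLinearData T α β (u n) (K.G (l n) (l n) (l n)) ∧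
              IsLinearData T α β (l n) (K.G (u n) (u n) (u n))) ∧
          -- (i) uniqueness of the sequences
          (∀ l' u' : ℕ → TimeFun d, IsKSIteration K T f₀ l₀s u₀s l' u' →
            ∀ n, ∀ t ∈ timeSet T, l' n t =ᵐ[volume] l n t ∧ u' n t =ᵐ[volume] u n t) ∧
          -- (i) monotonicity
          (∀ n, ∀ t ∈ timeSet T, sharp (l n) t ≤ᵐ[volume] sharp (l (n + 1)) t ∧
            sharp (l n) t ≤ᵐ[volume] sharp (u n) t ∧
            sharp (u (n + 1)) t ≤ᵐ[volume] sharp (u n) t) ∧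
          ∃ lim_l lim_u : TimeFun d,
            -- (ii) convergence in `M_{α,β}`
            (∀ t ∈ timeSet T, TendstoM α β (fun n => sharp (l n) t) (sharp lim_l t) ∧
              TendstoM α β (fun n => sharp (u n) t) (sharp lim_u t)) ∧
            -- (ii) regularity of the limits
            (MemC0L1 T (sharp lim_l) ∧ MemLinftyM T α β (sharp lim_l) ∧
              MemC0L1 T (sharp lim_u) ∧ MemLinftyM T α β (sharp lim_u)) ∧
            (MemLinftyL1 T (sharp (K.L lim_l lim_u lim_u)) ∧
              MemLinftyL1 T (sharp (K.L lim_u lim_l lim_l)) ∧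
              MemLinftyL1 T (sharp (K.G lim_l lim_l lim_l)) ∧
              MemLinftyL1 T (sharp (K.G lim_u lim_u lim_u))) ∧
            -- (ii) the integral equations, in `L¹_{x,v}`
            (∀ t ∈ timeSet T,
              toL1 (sharp lim_l t) + ∫ τ in (0 : ℝ)..t, toL1 (sharp (K.L lim_l lim_u lim_u) τ) =
                toL1 f₀ + ∫ τ in (0 : ℝ)..t, toL1 (sharp (K.G lim_l lim_l lim_l) τ)) ∧
            (∀ t ∈ timeSet T,
              toL1 (sharp lim_u t) + ∫ τ in (0 : ℝ)..t, toL1 (sharp (K.L lim_u lim_l lim_l) τ) =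
                toL1 f₀ + ∫ τ in (0 : ℝ)..t, toL1 (sharp (K.G lim_u lim_u lim_u) τ)) ∧
            -- (iii) the limits coincide
            (∀ t ∈ timeSet T, lim_u t =ᵐ[volume] lim_l t) ∧
            -- (iv) the common limit is the unique mild solution below `u₀^#`
            IsMildSolution K T α β f₀ lim_l ∧
            tripleNorm T α β (sharp lim_l) ≤ normM α β u₀s ∧
            ∀ f : TimeFun d, IsMildSolution K T α β f₀ f →
              tripleNorm T α β (sharp f) ≤ normM α β u₀s →
              ∀ t ∈ timeSet T, f t =ᵐ[volume] lim_l t := by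
  refine ⟨dimConst d, dimConst_pos d, ?_⟩
  intro K hK T hT α β hα hβ f₀ φ ψ hf₀ hφ hψ hsmall l₁ u₁ hl hu hb
  have hφψ : φ ≤ᵐ[volume] ψ := by
    obtain ⟨h1, h2, h3⟩ := hb 0 (zero_mem_timeSet hT)
    exact (h1.trans h2).trans h3
  have hfirst := first_iterates_eq hd hK hT hα hβ hf₀ hφ hψ hφψ hl hu
  have hS := setting_of_first_iterates hd hK hT hα hβ hf₀ hφ hψ hsmall hfirst hb
  have hit := hS.isKSIteration_update hl hu hfirst
  have heq := hS.iteration_unique hit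
  set l := Function.update (K.lower f₀ φ ψ) 1 l₁
  set u := Function.update (K.upper f₀ φ ψ) 1 u₁
  have mlu : ∀ n, (∀ t ∈ timeSet T, Measurable (l n t)) ∧ ∀ t ∈ timeSet T, Measurable (u n t) := by
    intro n
    cases n with
    | zero =>
      rw [hit.l_zero, hit.u_zero]
      exact ⟨fun t _ => (measurable_ofStationarySharp hφ.1).of_uncurry_left,
        fun t _ => (measurable_ofStationarySharp hψ.1).of_uncurry_left⟩
    | succ n => exact ⟨(hit.l_succ n).measurable, (hit.u_succ n).measurable⟩
  have hmild := hS.isMildSolution_limit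
  -- Both limits are witnessed by the same function, as the gap between the iterates vanishes. The
  -- two integral equations then coincide, and equality of the limits is reflexivity.
  refine ⟨l, u, ⟨hit, Function.update_self _ _ _, Function.update_self _ _ _, fun n => ⟨?_, ?_⟩⟩,
    ?_, ?_, K.limit f₀ φ ψ, K.limit f₀ φ ψ, ?_, ?_, ?_, hS.integral_limit, hS.integral_limit,
    fun _ _ => Filter.EventuallyEq.rfl, hmild, ?_, ?_⟩
  · exact hS.isLinearData_of_ae_eq (hS.measurable_lower n) (hS.lower_le n) (hS.upper_le n)
      (mlu n).1 (mlu n).2 (fun t ht => (heq n t ht).1) fun t ht => (heq n t ht).2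
  · exact hS.isLinearData_of_ae_eq (hS.measurable_upper n) (hS.upper_le n) (hS.lower_le n)
      (mlu n).2 (mlu n).1 (fun t ht => (heq n t ht).2) fun t ht => (heq n t ht).1
  · intro l' u' h' n t ht
    obtain ⟨h1, h2⟩ := hS.iteration_unique h' n t ht
    exact ⟨h1.trans (heq n t ht).1.symm, h2.trans (heq n t ht).2.symm⟩
  · intro n t ht
    obtain ⟨a1, a2⟩ := heq n t ht
    obtain ⟨b1, b2⟩ := heq (n + 1) t ht
    obtain ⟨h1, -, h3⟩ := hS.beginning.monotone_step hK n
    refine ⟨sharp_le_iff.2 ((a1.le.trans (h1 t ht)).trans b1.symm.le), sharp_le_iff.2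
      ((a1.le.trans (hS.beginning.lower_le_upper hK n t ht)).trans a2.symm.le),
      sharp_le_iff.2 ((b2.le.trans (h3 t ht)).trans a2.symm.le)⟩
  · intro t ht
    have h := hS.ae_tendsto ht
    exact ⟨hS.tendstoM_of_ae_eq (h.mono fun _ h => h.1) (fun n => hS.lower_le n t ht)
        fun n => (heq n t ht).1,
      hS.tendstoM_of_ae_eq (h.mono fun _ h => h.2) (fun n => hS.upper_le n t ht)
        fun n => (heq n t ht).2⟩
  · exact ⟨hmild.continuous, hmild.bounded, hmild.continuous, hmild.bounded⟩
  · exact ⟨hmild.loss, hmild.loss, hmild.gain, hmild.gain⟩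
  · exact iSup₂_le fun t ht => normM_le_iff.2 (sharp_le_maxwellian_iff.2 (hS.limit_le t ht))
  · exact fun f hf hfb t ht =>
      hS.mild_unique hf hmild (le_of_tripleNorm_le hfb) hS.limit_le t ht
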